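/- **Setting.** Let $\pi:Y\to X$ be a fibered manifold, $\dim X=N\ge 1$, $\dim Y=N+m$, and $(V,\psi)$, $\psi=(x^i,y^\sigma)$, a fibered chart whose image $U=\psi(V)\subset\mathbb R^N\times\mathbb R^m$ is open and vertically star-shaped ($(x,y)\in U$, $t\in[0,1]$ imply $(x,ty)\in U$). Work in the induced coordinates $(x^i,y^\sigma_J)$, $|J|\le s$, of the jet prolongation $V^s=J^sV$, with projections $\pi^{S,s}:V^S\to V^s$, $\pi^s:V^s\to\pi(V)$. Put $\omega_0=dx^1\wedge\dots\wedge dx^N$, $\omega_i=\mathbf i_{\partial_i}\omega_0$, $\omega^\sigma_J=dy^\sigma_J-y^\sigma_{Jj}dx^j$, let $d_i$ be the total derivative, and let $\partial/\partial y^\sigma_{j_1\dots j_k}$ be the symmetrized partial derivative, repeated indices being summed over all values. For a form $\rho$ on $V^s$ let $h\rho$ and $p_1\rho$ (forms on $V^{s+1}$) be its horizontal and its 1-contact component, i.e. the parts of $(\pi^{s+1,s})^*\rho$ having no, respectively exactly one, factor $\omega^\sigma_J$ when written in the forms $dx^i,\omega^\sigma_J$ ($|J|\le s$); $\rho$ is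 called *1-contact* if $(\pi^{s+1,s})^*\rho=p_1\rho$. For a Lagrangian $\lambda=\mathcal L\,\omega_0$ (a smooth $\pi^s$-horizontal $N$-form) on $V^s$, the principal Lepage equivalent (on $V^{2s-1}$) and the Euler–Lagrange form (on $V^{2s}$) are $$\Theta_\lambda=\mathcal L\,\omega_0+\sum_{k=0}^{s-1}\Big(\sum_{l=0}^{s-1-k}(-1)^l d_{p_1}\cdots d_{p_l}\frac{\partial\mathcal L}{\partial y^\sigma_{j_1\dots j_kp_1\dots p_li}}\,\omega^\sigma_{j_1\dots j_k}\Big)\wedge\omega_i,$$ $$\mathcal E_\lambda=\Big(\sum_{k=0}^{s}(-1)^k d_{i_1}\cdots d_{i_k}\frac{\partial\mathcal L}{\partial y^\sigma_{i_1\dots i_k}}\Big)\,\omega^\sigma\wedge\omega_0 .$$ The fibered homotopy operator is $I\rho=\int_0^1\mathbf i_{\partial_t}(\chi^*\rho)\,dt$, where $\chi(t,(x^i,y^\sigma_J))=(x^i,ty^\sigma_J)$. **Proposition.** Let $\lambda$ be a Lagrangian on $V^r$, $r\ge1$. Let $\lambda_{VT}=I\mathcal E_\lambda$ (on $V^{2r}$)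 be its Vainberg–Tonti Lagrangian, let $\mu_0$ be a smooth $(N-1)$-form on $\pi(V)$ such that $d\mu_0=0^*\Theta_\lambda$, where $0:x\mapsto(x,0,\dots,0)$ is the zero section, and put $$\alpha=I\Theta_\lambda+(\pi^{2r-1})^*\mu_0 ,\qquad \Phi_\lambda=\Theta_{\lambda_{VT}}+(\pi^{4r-1,2r-1})^*d\alpha$$ ($\Phi_\lambda$ is the canonical Lepage equivalent of $\lambda$, regarded as a form on $V^{4r-1}$). Then: 1. $(\pi^{2r,r})^*\lambda=\lambda_{VT}+hd\alpha$ on $V^{2r}$; 2. $\Phi_\lambda=(\pi^{4r-1,2r-1})^*\Theta_\lambda+D$ on $V^{4r-1}$, where $D:=(\pi^{4r-1,2r-1})^*d\alpha-\Theta_{hd\alpha}$; 3. $D$ is 1-contact; 4. there are an order $s$ with $s+1\ge 4r-1$ and a smooth 1-contact $(N-1)$-form $\nu$ on $V^s$ such that $(\pi^{s+1,4r-1})^*D=p_1d\nu$ on $V^{s+1}$. -/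

import Mathlib

open scoped ContDiff Nat

noncomputable section

namespace LepageForms

/-! ### Jet coordinates over a fibered chart

`N` is the dimension of the base, `m` the dimension of the fibre, `s` the order of the jets.
The derivative coordinates `y^σ_{j₁…j_k}` are symmetric in the lower indices, so they are
indexed by multisets `J` of base indices, with `card J ≤ s`; `J = 0` is `y^σ` itself. -/

/-- Multi-indices of length at most `s`. -/
abbrev JetIndex (N s : ℕ) : Type := {J : Multiset (Fin N) // J.card ≤ s}

instance jetIndexFinite (N s : ℕ) : Finite (JetIndex N s) := by
  refine Finite.of_injective
    (fun (J : JetIndex N s) (i : Fin N) =>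
      (⟨J.1.count i, Nat.lt_succ_of_le ((Multiset.count_le_card i J.1).trans J.2)⟩ :
        Fin (s + 1))) ?_
  intro J K h
  apply Subtype.ext
  refine Multiset.ext.mpr fun i => ?_
  have := congrFun h i
  simpa using this

instance jetIndexFintype (N s : ℕ) : Fintype (JetIndex N s) := Fintype.ofFinite _

/-- Coordinates `(x, y)` on the `s`-jet prolongation of `ℝ^N × ℝ^m → ℝ^N`: `z.1 i = x^i` and
`z.2 J σ = y^σ_J`. -/
abbrev Jet (N m s : ℕ) : Type := (Fin N → ℝ) × (JetIndex N s → Fin m → ℝ)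

/-- `k`-forms in the jet coordinates of order `s`. -/
abbrev JetForm (N m s k : ℕ) : Type := Jet N m s → (Jet N m s) [⋀^Fin k]→L[ℝ] ℝ

/-- `k`-forms on the base. -/
abbrev BaseForm (N k : ℕ) : Type := (Fin N → ℝ) → (Fin N → ℝ) [⋀^Fin k]→L[ℝ] ℝ

/-- The prolongation `V^s` of the chart domain `V`, whose image in `ℝ^N × ℝ^m` is `U`. -/
def jetDomain {N m : ℕ} (U : Set ((Fin N → ℝ) × (Fin m → ℝ))) (s : ℕ) : Set (Jet N m s) :=
  {z | (z.1, z.2 ⟨0, Nat.zero_le s⟩) ∈ U}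

/-- `U` is vertically star-shaped. -/
def VerticallyStarShaped {N m : ℕ} (U : Set ((Fin N → ℝ) × (Fin m → ℝ))) : Prop :=
  ∀ p ∈ U, ∀ t ∈ Set.Icc (0 : ℝ) 1, (p.1, t • p.2) ∈ U

section coordinates

variable {N m : ℕ}

/-- The jet projection `π^{S,s}`. -/
def jetProj {s S : ℕ} (h : s ≤ S) : Jet N m S →L[ℝ] Jet N m s :=
  (ContinuousLinearMap.fst ℝ _ _).prod
    ((ContinuousLinearMap.pi fun J : JetIndex N s =>
      ContinuousLinearMap.proj (⟨J.1, J.2.trans h⟩ : JetIndex N S)) ∘L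
        ContinuousLinearMap.snd ℝ _ _)

/-- The projection `π^s` to the base. -/
def baseProj (N m s : ℕ) : Jet N m s →L[ℝ] (Fin N → ℝ) := ContinuousLinearMap.fst ℝ _ _

/-- The zero section `x ↦ (x, 0, …, 0)`. -/
def zeroSection (N m s : ℕ) : (Fin N → ℝ) →L[ℝ] Jet N m s := ContinuousLinearMap.inl ℝ _ _

/-- Pull-back of a differential form by a linear map. -/
def pullback {E F : Type*} [NormedAddCommGroup E] [NormedSpace ℝ E] [NormedAddCommGroup F]
    [NormedSpace ℝ F] {k : ℕ} (A : E →L[ℝ] F) (ρ : F → F [⋀^Fin k]→L[ℝ] ℝ) :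
    E → E [⋀^Fin k]→L[ℝ] ℝ :=
  fun z => (ρ (A z)).compContinuousLinearMap A

/-- Pull-back of a form along `π^{S,s}`. -/
def lift {s S k : ℕ} (h : s ≤ S) (ρ : JetForm N m s k) : JetForm N m S k :=
  pullback (jetProj h) ρ

/-- The coordinate vector `∂_i = ∂/∂x^i` at a point of the `s`-jets. -/
def basePartial (m s : ℕ) (i : Fin N) : Jet N m s := (Pi.single i 1, 0)

/-- The coordinate vector `∂/∂y^σ_J`; it is `0` if `card J > s`, when a function on the
`s`-jets does not depend on `y^σ_J`. -/
def fibrePartial (s : ℕ) (J : Multiset (Fin N)) (σ : Fin m) : Jet N m s :=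
  (0, fun K τ => if K.1 = J ∧ τ = σ then 1 else 0)

/-- The formal derivative field `∂_i + ∑_{J} y^σ_{Ji} ∂/∂y^σ_J` (`card J ≤ s`), at the point `z`
of the `(s+1)`-jets (or of higher jets), as a tangent vector to the `s`-jets. -/
def formalVector {s S : ℕ} (h : s + 1 ≤ S) (i : Fin N) (z : Jet N m S) : Jet N m s :=
  (Pi.single i 1, fun J => z.2 ⟨i ::ₘ J.1, by
    rw [Multiset.card_cons]; exact (Nat.succ_le_succ J.2).trans h⟩)

/-- The total derivative `d_i f`, a function on the `(s+1)`-jets. -/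
def totalDeriv {s : ℕ} (i : Fin N) (f : Jet N m s → ℝ) : Jet N m (s + 1) → ℝ :=
  fun z => fderiv ℝ f (jetProj (Nat.le_succ s) z) (formalVector le_rfl i z)

/-- The iterated total derivative `d_{p₁} ⋯ d_{p_l} f`. -/
def iterTotalDeriv {s : ℕ} : (l : ℕ) → (Fin l → Fin N) → (Jet N m s → ℝ) → Jet N m (s + l) → ℝ
  | 0, _, f => f
  | l + 1, p, f => totalDeriv (p 0) (iterTotalDeriv l (Fin.tail p) f)

/-- The multi-index of a tuple `(j₁, …, j_k)`. -/
def tupleIndex {k : ℕ} (j : Fin k → Fin N) : Multiset (Fin N) := Finset.univ.val.map j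

/-- The symmetrized partial derivative `∂f/∂y^σ_{j₁…j_k}`, where `J` is the multi-index of
`(j₁, …, j_k)`. Sums over repeated indices run over all tuples, and the factor `J!/|J|!` is the
usual one that makes every multi-index be counted once in total. -/
def symPartial {s : ℕ} (J : Multiset (Fin N)) (σ : Fin m) (f : Jet N m s → ℝ) : Jet N m s → ℝ :=
  fun z => ((∏ i : Fin N, ((J.count i)! : ℝ)) / ((J.card)! : ℝ)) *
    fderiv ℝ f z (fibrePartial s J σ)

/-- The coordinate function `y^σ_J` on the `s`-jets (for `card J ≤ s`), as a linear functional;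
as a constant 1-form it is `dy^σ_J`. -/
def jetCoord (s : ℕ) (J : Multiset (Fin N)) (σ : Fin m) : Jet N m s →L[ℝ] ℝ :=
  if h : J.card ≤ s then
    ContinuousLinearMap.proj σ ∘L ContinuousLinearMap.proj (⟨J, h⟩ : JetIndex N s) ∘L
      ContinuousLinearMap.snd ℝ _ _
  else 0

/-- `dx^i`. -/
def dx (m s : ℕ) (i : Fin N) : Jet N m s →L[ℝ] ℝ :=
  ContinuousLinearMap.proj i ∘L baseProj N m s

/-- The contact form `ω^σ_J = dy^σ_J - ∑_i y^σ_{Ji} dx^i` on the `s`-jets, for `card J < s`. -/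
def contactForm (s : ℕ) (J : Multiset (Fin N)) (σ : Fin m) (z : Jet N m s) : Jet N m s →L[ℝ] ℝ :=
  jetCoord s J σ - ∑ i, jetCoord s (i ::ₘ J) σ z • dx m s i

/-- Exterior product `θ ∧ η` of a covector and a `k`-covector:
`(θ ∧ η)(v₀, …, v_k) = ∑ i, (-1)^i θ(v_i) η(v₀, …, v̂_i, …, v_k)`. -/
def wedgeOne {E : Type*} [NormedAddCommGroup E] [NormedSpace ℝ E] {k : ℕ}
    (θ : E →L[ℝ] ℝ) (η : E [⋀^Fin k]→L[ℝ] ℝ) : E [⋀^Fin (k + 1)]→L[ℝ] ℝ :=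
  ContinuousAlternatingMap.alternatizeUncurryFin (θ.smulRight η)

/-- `dx^1 ∧ ⋯ ∧ dx^N` on `ℝ^N`. -/
def baseVolume (N : ℕ) : (Fin N → ℝ) [⋀^Fin N]→L[ℝ] ℝ :=
  { (Matrix.detRowAlternating : (Fin N → ℝ) [⋀^Fin N]→ₗ[ℝ] ℝ) with
    cont := by
      change Continuous fun M : Fin N → Fin N → ℝ => Matrix.det (Matrix.of M)
      fun_prop }

/-- `ω₀ = dx^1 ∧ ⋯ ∧ dx^N` on the jets. -/
def omegaZero (N m s : ℕ) : (Jet N m s) [⋀^Fin N]→L[ℝ] ℝ :=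
  (baseVolume N).compContinuousLinearMap (baseProj N m s)

/-- `ω_i`, the interior product of `∂_i` and `ω₀`. -/
def omegaOne {n : ℕ} (m s : ℕ) (i : Fin (n + 1)) : (Jet (n + 1) m s) [⋀^Fin n]→L[ℝ] ℝ :=
  (omegaZero (n + 1) m s).curryLeft (basePartial m s i)

/-! ### Horizontalization and the 1-contact component -/

/-- The horizontal part of tangent vectors: `v ↦ ∑_i dx^i(v) d_i`, at a point `z` of higher
jets. -/
def horVec {s S : ℕ} (h : s + 1 ≤ S) (z : Jet N m S) : Jet N m S →L[ℝ] Jet N m s :=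
  ∑ i, (dx m S i).smulRight (formalVector h i z)

/-- The contact part of tangent vectors: `v ↦ Tπ^{S,s} v` minus its horizontal part. -/
def conVec {s S : ℕ} (h : s + 1 ≤ S) (z : Jet N m S) : Jet N m S →L[ℝ] Jet N m s :=
  jetProj ((Nat.le_succ s).trans h) - horVec h z

/-- Horizontalization `hρ`, as a form on the `S`-jets, `S ≥ s + 1`. -/
def horizontalize {s S k : ℕ} (h : s + 1 ≤ S) (ρ : JetForm N m s k) : JetForm N m S k :=
  fun z => (ρ (jetProj ((Nat.le_succ s).trans h) z)).compContinuousLinearMap (horVec h z)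

/-- The 1-contact component `p₁ρ`, on the `(s+1)`-jets: exactly one argument of `ρ` is replaced
by its contact part and all others by their horizontal parts, see `contactOne_apply`. -/
def contactOne {s k : ℕ} (ρ : JetForm N m s k) : JetForm N m (s + 1) k :=
  fun z => (ρ (jetProj (Nat.le_succ s) z)).fderivCompContinuousLinearMap
    (horVec le_rfl z) (conVec le_rfl z)

theorem contactOne_apply {s k : ℕ} (ρ : JetForm N m s k) (z : Jet N m (s + 1))
    (v : Fin k → Jet N m (s + 1)) :
    contactOne ρ z v = ∑ i, ρ (jetProj (Nat.le_succ s) z)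
      (Function.update (fun j => horVec le_rfl z (v j)) i (conVec le_rfl z (v i))) := by
  simp only [contactOne, ContinuousAlternatingMap.fderivCompContinuousLinearMap_apply]
  refine Finset.sum_congr rfl fun i _ => ?_
  congr 1
  funext j
  by_cases hj : j = i
  · subst hj; simp
  · simp [Function.update_of_ne hj]

/-- A form on `V^s` is 1-contact if it coincides, after pull-back to `V^{s+1}`, with its
1-contact component: each term contains precisely one contact 1-form. -/
def IsOneContact {s k : ℕ} (U : Set ((Fin N → ℝ) × (Fin m → ℝ))) (ρ : JetForm N m s k) : Prop :=
  ∀ z ∈ jetDomain U (s + 1), lift (Nat.le_succ s) ρ z = contactOne ρ z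

/-! ### Lagrangians, the principal Lepage equivalent and the Euler–Lagrange form -/

/-- A Lagrangian on `V^s`: a smooth `π^s`-horizontal form of degree `N = dim X`. -/
structure IsLagrangian {s : ℕ} (U : Set ((Fin N → ℝ) × (Fin m → ℝ)))
    (lam : JetForm N m s N) : Prop where
  smooth : ContDiffOn ℝ ∞ lam (jetDomain U s)
  horizontal : ∀ z ∈ jetDomain U s, ∀ v : Fin N → Jet N m s,
    (∃ i, baseProj N m s (v i) = 0) → lam z v = 0

/-- The function `L` with `λ = L ω₀`, for a horizontal form `λ` of degree `N`. -/
def lagrangeFunction {s : ℕ} (lam : JetForm N m s N) : Jet N m s → ℝ :=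
  fun z => lam z (basePartial m s)

variable {n : ℕ}

/-- The principal Lepage equivalent `Θ_λ` of a Lagrangian `λ = L ω₀` of order `s`, of order
`2s - 1`:
`L ω₀ + ∑_{k<s} ∑_{l<s-k} (-1)^l d_{p₁}⋯d_{p_l} (∂L/∂y^σ_{j₁…j_k p₁…p_l i}) ω^σ_{j₁…j_k} ∧ ω_i`. -/
def principalLepage {s : ℕ} (lam : JetForm (n + 1) m s (n + 1)) :
    JetForm (n + 1) m (2 * s - 1) (n + 1) :=
  fun z =>
    lagrangeFunction lam (jetProj (by omega) z) • omegaZero (n + 1) m (2 * s - 1) +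
    ∑ k : Fin s, ∑ l : Fin (s - k), ∑ j : Fin k → Fin (n + 1), ∑ p : Fin l → Fin (n + 1),
      ∑ i : Fin (n + 1), ∑ σ : Fin m,
        ((-1 : ℝ) ^ (l : ℕ) *
          iterTotalDeriv l p
            (symPartial (tupleIndex j + tupleIndex p + {i}) σ (lagrangeFunction lam))
            (jetProj (by have := k.2; have := l.2; omega) z)) •
          wedgeOne (contactForm (2 * s - 1) (tupleIndex j) σ z) (omegaOne m (2 * s - 1) i)

/-- The Euler–Lagrange expression
`E_σ(λ) = ∑_{k ≤ s} (-1)^k d_{i₁}⋯d_{i_k} (∂L/∂y^σ_{i₁…i_k})`, on the `2s`-jets. -/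
def eulerLagrangeExpr {s : ℕ} (lam : JetForm N m s N) (σ : Fin m) : Jet N m (2 * s) → ℝ :=
  fun z => ∑ k : Fin (s + 1), ∑ j : Fin k → Fin N,
    (-1 : ℝ) ^ (k : ℕ) *
      iterTotalDeriv k j (symPartial (tupleIndex j) σ (lagrangeFunction lam))
        (jetProj (by have := k.2; omega) z)

/-- The Euler–Lagrange form `E_σ(λ) ω^σ ∧ ω₀`. -/
def eulerLagrangeForm {s : ℕ} (lam : JetForm N m s N) : JetForm N m (2 * s) (N + 1) :=
  fun z => ∑ σ : Fin m, eulerLagrangeExpr lam σ z •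
    wedgeOne (contactForm (2 * s) 0 σ z) (omegaZero N m (2 * s))

/-! ### The fibered homotopy operator, the Vainberg–Tonti Lagrangian, the canonical Lepage
equivalent -/

/-- The fibre rescaling `χ(t, ·) : (x, y) ↦ (x, t y)`. -/
def fibreScaling (N m s : ℕ) (t : ℝ) : Jet N m s →L[ℝ] Jet N m s :=
  (ContinuousLinearMap.fst ℝ _ _).prod (t • ContinuousLinearMap.snd ℝ _ _)

/-- The fibered homotopy operator `Iρ = ∫₀¹ i_{∂_t}(χ^*ρ) dt`. As `∂χ/∂t = (0, y)` at `(x, y)`,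
the integrand is `ρ` at `χ(t, (x, y))`, contracted with `(0, y)` and pulled back by `χ(t, ·)`. -/
def fiberedHomotopy {s k : ℕ} (ρ : JetForm N m s (k + 1)) : JetForm N m s k :=
  fun z => ∫ t in (0 : ℝ)..1,
    ((ρ (fibreScaling N m s t z)).curryLeft (0, z.2)).compContinuousLinearMap
      (fibreScaling N m s t)

/-- The Vainberg–Tonti Lagrangian `λ_VT = I E_λ`. -/
def vainbergTonti {s : ℕ} (lam : JetForm N m s N) : JetForm N m (2 * s) N :=
  fiberedHomotopy (eulerLagrangeForm lam)

/-- The form `α = I Θ_λ + (π^{2s-1})^* μ₀`. -/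
def alphaForm {s : ℕ} (lam : JetForm (n + 1) m s (n + 1)) (mu0 : BaseForm (n + 1) n) :
    JetForm (n + 1) m (2 * s - 1) n :=
  fiberedHomotopy (principalLepage lam) + pullback (baseProj (n + 1) m (2 * s - 1)) mu0

/-- The canonical Lepage equivalent `Φ_λ = Θ_{λ_VT} + dα`, on the jets of order `2(2s) - 1`, where
`Θ_{λ_VT}` is defined. -/
def canonicalLepage {s : ℕ} (lam : JetForm (n + 1) m s (n + 1)) (mu0 : BaseForm (n + 1) n) :
    JetForm (n + 1) m (2 * (2 * s) - 1) (n + 1) :=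
  principalLepage (vainbergTonti lam) + lift (by omega) (extDeriv (alphaForm lam mu0))

end coordinates

end LepageForms

end

/-! Let `L` be the Lagrange function of `λ`, `E_σ` its Euler–Lagrange expressions and `c^{Ji}_σ(L)`
the coefficient of `ω^σ_J ∧ ω_i` in `Θ_λ`. Two identities carry the proof. Repeated integration by
parts gives the first variation formula `∂L/∂y^σ_J = δ_{J,0} E_σ + ∑_i (d_i c^{Ji}_σ +
c^{J-i,i}_σ)`, the last term being present only if `i ∈ J` (`sum_dTot_lepageCoeff`). Moreover
`∂/∂y^σ_J` commutes with `d_i` up to `∂/∂y^σ_{J-i}` (`dFib_dTot`).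

For claim 1, `I Θ_λ = ∑ a^i ω_i`, where `a^i` integrates `∑ c^{Ji}_σ y^σ_J` along the fibre
rescaling. Contract the first variation formula with `y^σ_J` and integrate along the rescaling. The
left side gives `L - L(x,0)`, the `E_σ` give the Vainberg–Tonti Lagrangian, and the rest gives `∑
d_i a^i`, because the rescaling respects the total derivative fields
(`HasOrder.integral_momentum_add_sum_dTot`). Contact forms vanish along the zero section, so `dμ₀ =
L(x,0) ω₀` on the base. Hence `hdα = T ω₀` with `T = ∑ d_i a^i + L(x,0)`, and `L` is the
Vainberg–Tonti function plus `T`.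

Claim 2 then follows because the principal Lepage equivalent is linear in the Lagrange function. For
claim 3, `dα` and `Θ_{hdα}` have the same horizontal part `T ω₀`, so `D = ∑ (∂a^i/∂y^σ_J -
c^{Ji}_σ(T)) ω^σ_J ∧ ω_i`.

Claim 4 is an exactness statement. The two identities, applied to `T`, show that the coefficients of
`D` satisfy `∑_i δ_i D^i = 0` in every multi-index other than `0`, where `δ_i` is the action of
`d_i` on coefficients of contact forms (`shiftDeriv`). The part of `δ_i` that raises the length of
the multi-index is multiplication by a polynomial variable. The polynomial Koszul homotopy therefore
removes the top degree, and induction on the degree gives antisymmetric `b^{ij}` with `D^i = ∑_j δ_j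
b^{ij}` (`exists_koszul_primitive`). The form `ν = -1/2 ∑ b^{ij}_{σJ} ω^σ_J ∧ ω_{ij}` then has `p₁dν
= D`.

Functions are placed on infinite jets, so that total derivatives are commuting endomorphisms of one
vector space; their finite order is recorded separately by `HasOrder`. -/

noncomputable section

namespace LepageForms

section


open Filter Topology

variable {N m : ℕ}

/-! ### Functions of finite order on infinite jets -/

/-- Coordinates `(x, y)` on the infinite jets: `z.2 J σ = y^σ_J`, without a bound on `card J`. -/
abbrev InfJet (N m : ℕ) : Type := (Fin N → ℝ) × (Multiset (Fin N) → Fin m → ℝ)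

/-- The projection of infinite jets to `s`-jets. -/
def trunc (s : ℕ) : InfJet N m →ₗ[ℝ] Jet N m s where
  toFun z := (z.1, fun J => z.2 J.1)
  map_add' _ _ := rfl
  map_smul' _ _ := rfl

/-- Extension of an `s`-jet by zero to an infinite jet. -/
def extend {s : ℕ} : Jet N m s →ₗ[ℝ] InfJet N m where
  toFun z := (z.1, fun J σ => if h : J.card ≤ s then z.2 ⟨J, h⟩ σ else 0)
  map_add' z w := by
    refine Prod.ext rfl ?_
    funext J σ
    by_cases h : J.card ≤ s <;> simp [h]
  map_smul' c z := by
    refine Prod.ext rfl ?_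
    funext J σ
    by_cases h : J.card ≤ s <;> simp [h]

theorem jetProj_apply {s S : ℕ} (h : s ≤ S) (z : Jet N m S) :
    jetProj h z = (z.1, fun J : JetIndex N s => z.2 ⟨J.1, J.2.trans h⟩) := rfl

theorem trunc_extend {s S : ℕ} (h : s ≤ S) (z : Jet N m S) :
    trunc s (extend z) = jetProj h z := by
  refine Prod.ext rfl ?_
  funext J σ
  simp [trunc, extend, jetProj_apply, J.2.trans h]

theorem trunc_extend_self {s : ℕ} (z : Jet N m s) : trunc s (extend z) = z := by
  rw [trunc_extend le_rfl]; rfl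

theorem jetProj_trunc {s S : ℕ} (h : s ≤ S) (z : InfJet N m) :
    jetProj h (trunc S z) = trunc s z := rfl

/-- The infinite prolongation of the chart domain. -/
def infDomain (U : Set ((Fin N → ℝ) × (Fin m → ℝ))) : Set (InfJet N m) := {z | (z.1, z.2 0) ∈ U}

variable {U : Set ((Fin N → ℝ) × (Fin m → ℝ))}

theorem trunc_mem_jetDomain {s : ℕ} {z : InfJet N m} :
    trunc s z ∈ jetDomain U s ↔ z ∈ infDomain U := Iff.rfl

theorem extend_mem_infDomain {s : ℕ} {z : Jet N m s} :
    extend z ∈ infDomain U ↔ z ∈ jetDomain U s := by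
  rw [← trunc_mem_jetDomain (s := s), trunc_extend_self]

theorem isOpen_jetDomain (hU : IsOpen U) (s : ℕ) : IsOpen (jetDomain U s) :=
  hU.preimage (by fun_prop :
    Continuous fun z : Jet N m s => (z.1, z.2 ⟨0, Nat.zero_le s⟩))

/-- `f` is, over the domain, a smooth function of the `s`-jet. -/
def HasOrder (U : Set ((Fin N → ℝ) × (Fin m → ℝ))) (f : InfJet N m → ℝ) (s : ℕ) : Prop :=
  ContDiffOn ℝ ∞ (fun z : Jet N m s => f (extend z)) (jetDomain U s) ∧
    ∀ z ∈ infDomain U, f z = f (extend (trunc s z))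

theorem hasOrder_of_eq {s : ℕ} {f : InfJet N m → ℝ} {g : Jet N m s → ℝ}
    (hg : ContDiffOn ℝ ∞ g (jetDomain U s)) (h : ∀ z ∈ infDomain U, f z = g (trunc s z)) :
    HasOrder U f s := by
  refine ⟨hg.congr fun z hz => ?_, fun z hz => ?_⟩
  · rw [h _ (extend_mem_infDomain.2 hz), trunc_extend_self]
  · rw [h z hz, h _ (extend_mem_infDomain.2 (trunc_mem_jetDomain.2 hz)), trunc_extend_self]

theorem HasOrder.mono {f : InfJet N m → ℝ} {s S : ℕ} (hf : HasOrder U f s) (h : s ≤ S) :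
    HasOrder U f S :=
  hasOrder_of_eq (g := fun z => f (extend (jetProj h z)))
    (hf.1.comp (jetProj h).contDiff.contDiffOn fun _ hz => hz) fun z hz => hf.2 z hz

theorem HasOrder.add {f g : InfJet N m → ℝ} {s : ℕ} (hf : HasOrder U f s) (hg : HasOrder U g s) :
    HasOrder U (f + g) s :=
  ⟨hf.1.add hg.1, fun z hz => congrArg₂ (· + ·) (hf.2 z hz) (hg.2 z hz)⟩

theorem HasOrder.smul {f : InfJet N m → ℝ} {s : ℕ} (c : ℝ) (hf : HasOrder U f s) :
    HasOrder U (c • f) s :=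
  ⟨contDiffOn_const.mul hf.1, fun z hz => congrArg (c * ·) (hf.2 z hz)⟩

theorem HasOrder.zero {s : ℕ} : HasOrder U (0 : InfJet N m → ℝ) s :=
  ⟨contDiffOn_const, fun _ _ => rfl⟩

/-- Smooth functions of finite order on the infinite prolongation of the domain, extended by zero
off the domain. -/
def smoothFn (U : Set ((Fin N → ℝ) × (Fin m → ℝ))) : Submodule ℝ (InfJet N m → ℝ) where
  carrier := {f | (∀ z, z ∉ infDomain U → f z = 0) ∧ ∃ s, HasOrder U f s}
  add_mem' := by
    rintro f g ⟨hf0, s, hf⟩ ⟨hg0, t, hg⟩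
    exact ⟨fun z hz => by simp [hf0 z hz, hg0 z hz], max s t,
      (hf.mono (le_max_left _ _)).add (hg.mono (le_max_right _ _))⟩
  zero_mem' := ⟨fun _ _ => rfl, 0, HasOrder.zero⟩
  smul_mem' := by
    rintro c f ⟨hf0, s, hf⟩
    exact ⟨fun z hz => by simp [hf0 z hz], s, hf.smul c⟩

instance : CoeFun (smoothFn U) fun _ => InfJet N m → ℝ := ⟨fun f => f.1⟩

-- Vanishing off the domain makes equality a matter of the domain alone. Identities between
-- differential operators thus become literal equations in a real vector space, which is what the
-- Koszul argument needs.
@[ext]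
theorem smoothFn.ext {f g : smoothFn U} (h : ∀ z ∈ infDomain U, f z = g z) : f = g := by
  apply Subtype.ext
  funext z
  by_cases hz : z ∈ infDomain U
  · exact h z hz
  · rw [f.2.1 z hz, g.2.1 z hz]

theorem smoothFn.sum_apply {ι : Type*} (t : Finset ι) (f : ι → smoothFn U) (z : InfJet N m) :
    (∑ i ∈ t, f i) z = ∑ i ∈ t, f i z := by
  rw [AddSubmonoidClass.coe_finsetSum, Finset.sum_apply]

theorem smoothFn.add_apply (f g : smoothFn U) (z : InfJet N m) : (f + g) z = f z + g z := rfl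

theorem smoothFn.sub_apply (f g : smoothFn U) (z : InfJet N m) : (f - g) z = f z - g z := rfl

theorem smoothFn.smul_apply (c : ℝ) (f : smoothFn U) (z : InfJet N m) : (c • f) z = c * f z := rfl

theorem smoothFn.zero_apply (z : InfJet N m) : (0 : smoothFn U) z = 0 := rfl

theorem HasOrder.sub {f g : smoothFn U} {s : ℕ} (hf : HasOrder U f s) (hg : HasOrder U g s) :
    HasOrder U (f - g : smoothFn U) s := by
  have := hf.add (hg.smul (-1))
  convert this using 1
  funext z
  simp [sub_eq_add_neg]

theorem HasOrder.sum {ι : Type*} (t : Finset ι) {f : ι → smoothFn U} {s : ℕ}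
    (hf : ∀ i ∈ t, HasOrder U (f i) s) : HasOrder U (∑ i ∈ t, f i : smoothFn U) s := by
  classical
  induction t using Finset.induction_on with
  | empty => simpa using HasOrder.zero
  | insert a t ha ih =>
    rw [Finset.sum_insert ha]
    exact (hf a (by simp)).add (ih fun i hi => hf i (by simp [hi]))

theorem eventually_mem_infDomain (hU : IsOpen U) {z : InfJet N m} (hz : z ∈ infDomain U)
    (v : InfJet N m) : ∀ᶠ t : ℝ in 𝓝 0, z + t • v ∈ infDomain U := by
  have hc : Continuous fun t : ℝ => ((z + t • v).1, (z + t • v).2 0) := by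
    simp only [Prod.fst_add, Prod.smul_fst, Prod.snd_add, Prod.smul_snd, Pi.add_apply,
      Pi.smul_apply]
    fun_prop
  apply (hU.preimage hc).mem_nhds
  simpa [infDomain] using hz

theorem HasOrder.differentiableAt (hU : IsOpen U) {f : InfJet N m → ℝ} {s : ℕ}
    (hf : HasOrder U f s) {z : Jet N m s} (hz : z ∈ jetDomain U s) :
    DifferentiableAt ℝ (fun z : Jet N m s => f (extend z)) z :=
  (hf.1.contDiffAt ((isOpen_jetDomain hU s).mem_nhds hz)).differentiableAt (by simp)

/-- The infinite product of coordinates carries no norm, hence the use of line derivatives. For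
small `t` the line stays in the open domain, where `f` factors through the `s`-jet, so everything
reduces to a Fréchet derivative in finite dimension. -/
theorem HasOrder.lineDeriv_eq (hU : IsOpen U) {f : InfJet N m → ℝ} {s : ℕ} (hf : HasOrder U f s)
    {z : InfJet N m} (hz : z ∈ infDomain U) (v : InfJet N m) :
    lineDeriv ℝ f z v =
      fderiv ℝ (fun z : Jet N m s => f (extend z)) (trunc s z) (trunc s v) := by
  rw [← (hf.differentiableAt hU (trunc_mem_jetDomain.2 hz)).lineDeriv_eq_fderiv]
  unfold lineDeriv
  apply EventuallyEq.deriv_eq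
  filter_upwards [eventually_mem_infDomain hU hz v] with t ht
  rw [hf.2 _ ht, map_add, map_smul]

/-- A vector field on the infinite jets whose `s`-jet component is a smooth function of the
`(s+c)`-jet. -/
def IsFieldOfOrder (V : InfJet N m → InfJet N m) (c : ℕ) : Prop :=
  ∀ s, ∃ A : Jet N m (s + c) → Jet N m s, ContDiff ℝ ∞ A ∧ ∀ z, trunc s (V z) = A (trunc (s + c) z)

/-- The derivative of `f` along `V`. -/
def alongField (U : Set ((Fin N → ℝ) × (Fin m → ℝ))) (V : InfJet N m → InfJet N m)
    (f : InfJet N m → ℝ) : InfJet N m → ℝ :=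
  (infDomain U).indicator fun z => lineDeriv ℝ f z (V z)

theorem alongField_apply {V : InfJet N m → InfJet N m} {f : InfJet N m → ℝ} {z : InfJet N m}
    (hz : z ∈ infDomain U) : alongField U V f z = lineDeriv ℝ f z (V z) :=
  Set.indicator_of_mem hz _

protected theorem HasOrder.alongField (hU : IsOpen U) {f : InfJet N m → ℝ} {s c : ℕ} (hf : HasOrder U f s)
    {V : InfJet N m → InfJet N m} (hV : IsFieldOfOrder V c) :
    HasOrder U (alongField U V f) (s + c) := by
  obtain ⟨A, hA, hVA⟩ := hV s
  refine hasOrder_of_eq (g := fun z => fderiv ℝ (fun z : Jet N m s => f (extend z))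
    (jetProj (Nat.le_add_right s c) z) (A z)) ?_ fun z hz => ?_
  · have h1 : ContDiffOn ℝ ∞ (fderiv ℝ (fun z : Jet N m s => f (extend z))) (jetDomain U s) :=
      hf.1.fderiv_of_isOpen (isOpen_jetDomain hU s) (by simp)
    exact (h1.comp (jetProj (Nat.le_add_right s c)).contDiff.contDiffOn fun _ hz => hz).clm_apply
      hA.contDiffOn
  · rw [alongField_apply hz, hf.lineDeriv_eq hU hz, hVA, jetProj_trunc]

/-- The derivative along a vector field, as a linear endomorphism of `smoothFn U`. -/
def alongFieldₗ (hU : IsOpen U) (V : InfJet N m → InfJet N m) {c : ℕ} (hV : IsFieldOfOrder V c) :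
    smoothFn U →ₗ[ℝ] smoothFn U where
  toFun f := ⟨alongField U V f, fun z hz => Set.indicator_of_notMem hz _,
    f.2.2.imp' (· + c) fun _ h => h.alongField hU hV⟩
  map_add' f g := by
    ext z hz
    obtain ⟨s, hf⟩ := f.2.2
    obtain ⟨t, hg⟩ := g.2.2
    have hf := hf.mono (le_max_left s t)
    have hg := hg.mono (le_max_right s t)
    change alongField U V (f.1 + g.1) z = alongField U V f z + alongField U V g z
    rw [alongField_apply hz, alongField_apply hz, alongField_apply hz, hf.lineDeriv_eq hU hz,
      hg.lineDeriv_eq hU hz, (hf.add hg).lineDeriv_eq hU hz]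
    exact DFunLike.congr_fun (fderiv_add (hf.differentiableAt hU (trunc_mem_jetDomain.2 hz))
      (hg.differentiableAt hU (trunc_mem_jetDomain.2 hz))) _
  map_smul' a f := by
    ext z hz
    obtain ⟨s, hf⟩ := f.2.2
    change alongField U V (a • f.1) z = a * alongField U V f z
    rw [alongField_apply hz, alongField_apply hz, hf.lineDeriv_eq hU hz,
      (hf.smul a).lineDeriv_eq hU hz]
    exact DFunLike.congr_fun
      (fderiv_const_mul (hf.differentiableAt hU (trunc_mem_jetDomain.2 hz)) a) _

/-- Product rule for `t ↦ Dg(z + tW)(V(z + tW))` with `V` affine of linear part `V'`. Since the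
second derivative is symmetric, only the terms `V'(W)` can contribute to a commutator of two such
fields. -/
theorem alongField_alongField (hU : IsOpen U) {f : InfJet N m → ℝ} {s : ℕ} (hf : HasOrder U f s)
    {V V' W : InfJet N m → InfJet N m}
    (hVV' : ∀ (z w : InfJet N m) (t : ℝ), V (z + t • w) = V z + t • V' w)
    {z : InfJet N m} (hz : z ∈ infDomain U) :
    alongField U W (alongField U V f) z =
      fderiv ℝ (fderiv ℝ (fun z : Jet N m s => f (extend z))) (trunc s z) (trunc s (W z))
        (trunc s (V z)) + lineDeriv ℝ f z (V' (W z)) := by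
  rw [alongField_apply hz, hf.lineDeriv_eq hU hz]
  set g := fun z : Jet N m s => f (extend z) with hg
  set w := W z
  have hz' := (trunc_mem_jetDomain (s := s)).2 hz
  have hd : DifferentiableAt ℝ (fderiv ℝ g) (trunc s z) :=
    ((hf.1.fderiv_of_isOpen (isOpen_jetDomain hU s) (m := ∞) (by simp)).contDiffAt
      ((isOpen_jetDomain hU s).mem_nhds hz')).differentiableAt (by simp)
  have h1 : HasDerivAt (fun t : ℝ => trunc s z + t • trunc s w) (trunc s w) 0 := by
    simpa using ((hasDerivAt_id (0 : ℝ)).smul_const (trunc s w)).const_add (trunc s z)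
  have h2 : HasDerivAt (fun t : ℝ => trunc s (V z) + t • trunc s (V' w)) (trunc s (V' w)) 0 := by
    simpa using ((hasDerivAt_id (0 : ℝ)).smul_const (trunc s (V' w))).const_add (trunc s (V z))
  have h3 : HasDerivAt (fun t : ℝ => fderiv ℝ g (trunc s z + t • trunc s w))
      (fderiv ℝ (fderiv ℝ g) (trunc s z) (trunc s w)) 0 := by
    have hd' : HasFDerivAt (fderiv ℝ g) (fderiv ℝ (fderiv ℝ g) (trunc s z))
        (trunc s z + (0 : ℝ) • trunc s w) := by simpa using hd.hasFDerivAt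
    exact hd'.comp_hasDerivAt 0 h1
  have h4 := (h3.clm_apply h2).deriv
  simp only [zero_smul, add_zero] at h4
  rw [lineDeriv, ← h4]
  apply EventuallyEq.deriv_eq
  filter_upwards [eventually_mem_infDomain hU hz w] with t ht
  rw [alongField_apply ht, hf.lineDeriv_eq hU ht, hVV']
  simp only [map_add, map_smul, hg]

theorem HasOrder.fderiv_fderiv_comm (hU : IsOpen U) {f : InfJet N m → ℝ} {s : ℕ}
    (hf : HasOrder U f s) {z : Jet N m s} (hz : z ∈ jetDomain U s) (v w : Jet N m s) :
    fderiv ℝ (fderiv ℝ (fun z : Jet N m s => f (extend z))) z v w =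
      fderiv ℝ (fderiv ℝ (fun z : Jet N m s => f (extend z))) z w v :=
  ((hf.1.contDiffAt ((isOpen_jetDomain hU s).mem_nhds hz)).isSymmSndFDerivAt
    (by
      rw [minSmoothness_of_isRCLikeNormedField]
      exact WithTop.coe_le_coe.2 (le_top : (2 : ℕ∞) ≤ ⊤))) v w

/-- The total derivative field `∂_i + ∑_J y^σ_{Ji} ∂/∂y^σ_J` on the infinite jets. -/
def totalField (i : Fin N) (z : InfJet N m) : InfJet N m := (Pi.single i 1, fun J => z.2 (i ::ₘ J))

/-- The linear part of `totalField`. -/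
def totalFieldLin (i : Fin N) (z : InfJet N m) : InfJet N m := (0, fun J => z.2 (i ::ₘ J))

open Classical in
/-- The field `∂/∂y^σ_J` on the infinite jets. -/
def fibreField (J : Multiset (Fin N)) (σ : Fin m) : InfJet N m :=
  (0, fun K τ => if K = J ∧ τ = σ then 1 else 0)

theorem isFieldOfOrder_totalField (i : Fin N) :
    IsFieldOfOrder (totalField i : InfJet N m → InfJet N m) 1 := by
  refine fun s => ⟨formalVector le_rfl i, ?_, fun z => rfl⟩
  unfold formalVector
  refine contDiff_const.prodMk (contDiff_pi.2 fun J => ?_)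
  fun_prop

theorem isFieldOfOrder_fibreField (J : Multiset (Fin N)) (σ : Fin m) :
    IsFieldOfOrder (fun _ : InfJet N m => fibreField J σ) 0 :=
  fun s => ⟨fun _ => trunc s (fibreField J σ), contDiff_const, fun _ => rfl⟩

/-- The total derivative on `smoothFn U`. -/
def dTot (hU : IsOpen U) (i : Fin N) : smoothFn U →ₗ[ℝ] smoothFn U :=
  alongFieldₗ hU (totalField i) (isFieldOfOrder_totalField i)

/-- The partial derivative `∂/∂y^σ_J` on `smoothFn U`. -/
def dFib (hU : IsOpen U) (J : Multiset (Fin N)) (σ : Fin m) : smoothFn U →ₗ[ℝ] smoothFn U :=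
  alongFieldₗ hU (fun _ => fibreField J σ) (isFieldOfOrder_fibreField J σ)

theorem dTot_apply (hU : IsOpen U) (i : Fin N) (f : smoothFn U) {z : InfJet N m}
    (hz : z ∈ infDomain U) : dTot hU i f z = lineDeriv ℝ f z (totalField i z) :=
  alongField_apply (V := totalField i) hz

theorem dFib_apply (hU : IsOpen U) (J : Multiset (Fin N)) (σ : Fin m) (f : smoothFn U)
    {z : InfJet N m} (hz : z ∈ infDomain U) :
    dFib hU J σ f z = lineDeriv ℝ f z (fibreField J σ) :=
  alongField_apply (V := fun _ => fibreField J σ) hz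

protected theorem HasOrder.dTot (hU : IsOpen U) (i : Fin N) {f : smoothFn U} {s : ℕ} (hf : HasOrder U f s) :
    HasOrder U (dTot hU i f) (s + 1) :=
  HasOrder.alongField hU hf (isFieldOfOrder_totalField i)

protected theorem HasOrder.dFib (hU : IsOpen U) (J : Multiset (Fin N)) (σ : Fin m) {f : smoothFn U} {s : ℕ}
    (hf : HasOrder U f s) : HasOrder U (dFib hU J σ f) s :=
  HasOrder.alongField hU hf (isFieldOfOrder_fibreField J σ)

/-- The linear-part terms agree because `y^σ_{Jij} = y^σ_{Jji}`, multi-indices being unordered. -/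
theorem dTot_comm (hU : IsOpen U) (i j : Fin N) (f : smoothFn U) :
    dTot hU i (dTot hU j f) = dTot hU j (dTot hU i f) := by
  ext z hz
  obtain ⟨s, hf⟩ := f.2.2
  have hlin : ∀ (i : Fin N) (z w : InfJet N m) (t : ℝ),
      totalField i (z + t • w) = totalField i z + t • totalFieldLin i w := fun i z w t =>
    Prod.ext (by simp [totalField, totalFieldLin]) rfl
  refine (alongField_alongField hU hf (hlin j) hz).trans ?_
  refine Eq.trans ?_ (alongField_alongField hU hf (hlin i) hz).symm
  rw [hf.fderiv_fderiv_comm hU (trunc_mem_jetDomain.2 hz)]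
  congr 2
  refine Prod.ext rfl ?_
  funext J
  simp only [totalFieldLin, totalField]
  rw [Multiset.cons_swap]

/-- The field `d_i` involves the coordinate `y^σ_J` only in its component along `∂/∂y^σ_{J-i}`,
where it appears with coefficient one; this component exists exactly when `i ∈ J`. -/
theorem dFib_dTot (hU : IsOpen U) (J : Multiset (Fin N)) (σ : Fin m) (i : Fin N) (f : smoothFn U) :
    dFib hU J σ (dTot hU i f) =
      dTot hU i (dFib hU J σ f) + if i ∈ J then dFib hU (J.erase i) σ f else 0 := by
  ext z hz
  obtain ⟨s, hf⟩ := f.2.2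
  have hlin : ∀ (i : Fin N) (z w : InfJet N m) (t : ℝ),
      totalField i (z + t • w) = totalField i z + t • totalFieldLin i w := fun i z w t =>
    Prod.ext (by simp [totalField, totalFieldLin]) rfl
  have hconst : ∀ (z w : InfJet N m) (t : ℝ), (fun _ : InfJet N m => fibreField J σ) (z + t • w) =
      fibreField J σ + t • (fun _ => 0 : InfJet N m → InfJet N m) w := by simp
  refine (alongField_alongField hU hf (W := fun _ => fibreField J σ) (hlin i) hz).trans ?_
  rw [smoothFn.add_apply]
  have h2 := alongField_alongField hU hf (W := totalField i)
    (V := fun _ => fibreField J σ) (V' := fun _ => 0) hconst hz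
  change dTot hU i (dFib hU J σ f) z = _ at h2
  rw [h2, hf.fderiv_fderiv_comm hU (trunc_mem_jetDomain.2 hz), add_assoc]
  congr 1
  have h0 : lineDeriv ℝ (f : InfJet N m → ℝ) z 0 = 0 := by
    rw [hf.lineDeriv_eq hU hz]; simp
  rw [h0, zero_add]
  split_ifs with hi
  · refine Eq.trans ?_ (dFib_apply hU _ σ f hz).symm
    congr 1
    refine Prod.ext rfl ?_
    funext K τ
    have : i ::ₘ K = J ↔ K = J.erase i := by
      constructor
      · rintro rfl; simp
      · rintro rfl; exact Multiset.cons_erase hi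
    simp only [totalFieldLin, fibreField, this]
  · have : totalFieldLin i (fibreField J σ) = (0 : InfJet N m) := by
      refine Prod.ext rfl ?_
      funext K τ
      have : ¬ (i ::ₘ K = J ∧ τ = σ) := fun h => hi (h.1 ▸ Multiset.mem_cons_self _ _)
      simp [totalFieldLin, fibreField, this]
    rw [this, h0, smoothFn.zero_apply]

/-! ### Functions on finite jets as elements of `smoothFn U` -/

/-- A smooth function on the `s`-jets as an element of `smoothFn U`. -/
def ofJet {s : ℕ} (g : Jet N m s → ℝ) (hg : ContDiffOn ℝ ∞ g (jetDomain U s)) : smoothFn U :=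
  ⟨(infDomain U).indicator fun z => g (trunc s z), fun _ hz => Set.indicator_of_notMem hz _, s,
    hasOrder_of_eq hg fun _ hz => Set.indicator_of_mem hz _⟩

section ofJet

variable {s : ℕ} {g : Jet N m s → ℝ} (hg : ContDiffOn ℝ ∞ g (jetDomain U s))

include hg

theorem ofJet_apply {z : InfJet N m} (hz : z ∈ infDomain U) : ofJet g hg z = g (trunc s z) :=
  Set.indicator_of_mem (f := fun z => g (trunc s z)) hz

theorem ofJet_extend {S : ℕ} (h : s ≤ S) {z : Jet N m S} (hz : z ∈ jetDomain U S) :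
    ofJet g hg (extend z) = g (jetProj h z) := by
  rw [ofJet_apply hg (extend_mem_infDomain.2 hz), trunc_extend h]

theorem hasOrder_ofJet : HasOrder U (ofJet g hg) s :=
  hasOrder_of_eq hg fun _ hz => ofJet_apply hg hz

theorem fderiv_ofJet_extend (hU : IsOpen U) {z : Jet N m s} (hz : z ∈ jetDomain U s) :
    fderiv ℝ (fun z : Jet N m s => ofJet g hg (extend z)) z = fderiv ℝ g z := by
  apply EventuallyEq.fderiv_eq
  filter_upwards [(isOpen_jetDomain hU s).mem_nhds hz] with w hw
  exact ofJet_extend hg le_rfl hw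

theorem dTot_ofJet_apply (hU : IsOpen U) (i : Fin N) {z : InfJet N m} (hz : z ∈ infDomain U) :
    dTot hU i (ofJet g hg) z = fderiv ℝ g (trunc s z) (trunc s (totalField i z)) := by
  rw [dTot_apply hU i _ hz, (hasOrder_ofJet hg).lineDeriv_eq hU hz,
    fderiv_ofJet_extend hg hU (trunc_mem_jetDomain.2 hz)]

theorem dTot_ofJet_extend (hU : IsOpen U) (i : Fin N) {S : ℕ} (h : s + 1 ≤ S) {z : Jet N m S}
    (hz : z ∈ jetDomain U S) :
    dTot hU i (ofJet g hg) (extend z) =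
      fderiv ℝ g (jetProj ((Nat.le_succ s).trans h) z) (formalVector h i z) := by
  rw [dTot_ofJet_apply hg hU i (extend_mem_infDomain.2 hz), trunc_extend ((Nat.le_succ s).trans h)]
  congr 1
  refine Prod.ext rfl ?_
  funext J σ
  have hJ : (i ::ₘ J.1).card ≤ S := by
    rw [Multiset.card_cons]; exact (Nat.succ_le_succ J.2).trans h
  simp only [trunc, totalField, extend, formalVector, LinearMap.coe_mk, AddHom.coe_mk, dif_pos hJ]

omit hg in
theorem trunc_fibreField (J : Multiset (Fin N)) (σ : Fin m) :
    trunc s (fibreField J σ) = fibrePartial s J σ := by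
  refine Prod.ext rfl ?_
  funext K τ
  simp [trunc, fibreField, fibrePartial]

theorem dFib_ofJet_apply (hU : IsOpen U) (J : Multiset (Fin N)) (σ : Fin m) {z : InfJet N m}
    (hz : z ∈ infDomain U) :
    dFib hU J σ (ofJet g hg) z = fderiv ℝ g (trunc s z) (fibrePartial s J σ) := by
  rw [dFib_apply hU J σ _ hz, (hasOrder_ofJet hg).lineDeriv_eq hU hz,
    fderiv_ofJet_extend hg hU (trunc_mem_jetDomain.2 hz), trunc_fibreField]

theorem dFib_ofJet_extend (hU : IsOpen U) (J : Multiset (Fin N)) (σ : Fin m) {S : ℕ} (h : s ≤ S)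
    {z : Jet N m S} (hz : z ∈ jetDomain U S) :
    dFib hU J σ (ofJet g hg) (extend z) = fderiv ℝ g (jetProj h z) (fibrePartial s J σ) := by
  rw [dFib_ofJet_apply hg hU J σ (extend_mem_infDomain.2 hz), trunc_extend h]

theorem contDiffOn_totalDeriv (hU : IsOpen U) (i : Fin N) :
    ContDiffOn ℝ ∞ (totalDeriv i g) (jetDomain U (s + 1)) := by
  refine ((hasOrder_ofJet hg).dTot hU i).1.congr fun z hz => ?_
  rw [dTot_ofJet_extend hg hU i le_rfl hz]
  rfl

theorem ofJet_totalDeriv (hU : IsOpen U) (i : Fin N) :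
    ofJet (totalDeriv i g) (contDiffOn_totalDeriv hg hU i) = dTot hU i (ofJet g hg) := by
  ext z hz
  rw [ofJet_apply _ hz, dTot_ofJet_apply hg hU i hz]
  rfl

theorem contDiffOn_symPartial (hU : IsOpen U) (J : Multiset (Fin N)) (σ : Fin m) :
    ContDiffOn ℝ ∞ (symPartial J σ g) (jetDomain U s) := by
  refine contDiffOn_const.mul (((hasOrder_ofJet hg).dFib hU J σ).1.congr fun z hz => ?_)
  rw [dFib_ofJet_extend hg hU J σ le_rfl hz]
  rfl

end ofJet

theorem HasOrder.dFib_eq_zero (hU : IsOpen U) {f : smoothFn U} {s : ℕ} (hf : HasOrder U f s)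
    {J : Multiset (Fin N)} (hJ : s < J.card) (σ : Fin m) : dFib hU J σ f = 0 := by
  ext z hz
  rw [dFib_apply hU J σ f hz, hf.lineDeriv_eq hU hz]
  have : trunc s (fibreField J σ) = 0 := by
    refine Prod.ext rfl ?_
    funext K τ
    have : ¬ (K.1 = J ∧ τ = σ) := by
      rintro ⟨h, -⟩
      have := K.2
      rw [h] at this
      omega
    simp [trunc, fibreField, this]
  rw [this, map_zero, smoothFn.zero_apply]

/-- The iterated total derivative on `smoothFn U`. -/
def dIter (hU : IsOpen U) : (l : ℕ) → (Fin l → Fin N) → smoothFn U →ₗ[ℝ] smoothFn U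
  | 0, _ => LinearMap.id
  | l + 1, p => dTot hU (p 0) ∘ₗ dIter hU l (Fin.tail p)

theorem contDiffOn_iterTotalDeriv (hU : IsOpen U) {s : ℕ} {g : Jet N m s → ℝ}
    (hg : ContDiffOn ℝ ∞ g (jetDomain U s)) : ∀ (l : ℕ) (p : Fin l → Fin N),
    ContDiffOn ℝ ∞ (iterTotalDeriv l p g) (jetDomain U (s + l))
  | 0, _ => hg
  | l + 1, p => contDiffOn_totalDeriv (contDiffOn_iterTotalDeriv hU hg l (Fin.tail p)) hU (p 0)

theorem ofJet_iterTotalDeriv (hU : IsOpen U) {s : ℕ} {g : Jet N m s → ℝ}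
    (hg : ContDiffOn ℝ ∞ g (jetDomain U s)) : ∀ (l : ℕ) (p : Fin l → Fin N),
    ofJet (iterTotalDeriv l p g) (contDiffOn_iterTotalDeriv hU hg l p) = dIter hU l p (ofJet g hg)
  | 0, _ => rfl
  | l + 1, p => (ofJet_totalDeriv (contDiffOn_iterTotalDeriv hU hg l (Fin.tail p)) hU (p 0)).trans
      (congrArg (dTot hU (p 0)) (ofJet_iterTotalDeriv hU hg l (Fin.tail p)))

protected theorem HasOrder.dIter (hU : IsOpen U) {f : smoothFn U} {s : ℕ} (hf : HasOrder U f s) :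
    ∀ (l : ℕ) (p : Fin l → Fin N), HasOrder U (dIter hU l p f) (s + l)
  | 0, _ => hf
  | l + 1, p => HasOrder.dTot hU (p 0) (HasOrder.dIter hU hf l (Fin.tail p))

/-- The factor `J!/|J|!`. -/
def symFactor (J : Multiset (Fin N)) : ℝ := (∏ i : Fin N, ((J.count i)! : ℝ)) / ((J.card)! : ℝ)

/-- The symmetrized partial derivative on `smoothFn U`. -/
def dSym (hU : IsOpen U) (J : Multiset (Fin N)) (σ : Fin m) : smoothFn U →ₗ[ℝ] smoothFn U :=
  symFactor J • dFib hU J σ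

theorem ofJet_symPartial (hU : IsOpen U) {s : ℕ} {g : Jet N m s → ℝ}
    (hg : ContDiffOn ℝ ∞ g (jetDomain U s)) (J : Multiset (Fin N)) (σ : Fin m) :
    ofJet (symPartial J σ g) (contDiffOn_symPartial hg hU J σ) = dSym hU J σ (ofJet g hg) := by
  ext z hz
  rw [ofJet_apply _ hz]
  change _ = symFactor J * dFib hU J σ (ofJet g hg) z
  rw [dFib_ofJet_apply hg hU J σ hz]
  rfl

end

section


open Filter Topology

variable {N m : ℕ} {U : Set ((Fin N → ℝ) × (Fin m → ℝ))}

/-! ### Sums over multi-indices -/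

/-- The number `|J|!/J!` of tuples with multi-index `J`. -/
def multinomialFactor (J : Multiset (Fin N)) : ℝ :=
  ((J.card)! : ℝ) / (∏ i : Fin N, ((J.count i)! : ℝ))

theorem prod_factorial_count_ne_zero (J : Multiset (Fin N)) :
    (∏ i : Fin N, ((J.count i)! : ℝ)) ≠ 0 :=
  Finset.prod_ne_zero_iff.2 fun _ _ => Nat.cast_ne_zero.2 (Nat.factorial_ne_zero _)

theorem multinomialFactor_mul_symFactor (J : Multiset (Fin N)) :
    multinomialFactor J * symFactor J = 1 := by
  have h1 := prod_factorial_count_ne_zero J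
  have h2 : ((J.card)! : ℝ) ≠ 0 := Nat.cast_ne_zero.2 (Nat.factorial_ne_zero _)
  unfold multinomialFactor symFactor
  field_simp

theorem multinomialFactor_zero : multinomialFactor (0 : Multiset (Fin N)) = 1 := by
  simp [multinomialFactor]

theorem card_mul_multinomialFactor_cons (a : Fin N) (J : Multiset (Fin N)) :
    ((a ::ₘ J).card : ℝ) * multinomialFactor J =
      ((a ::ₘ J).count a : ℝ) * multinomialFactor (a ::ₘ J) := by
  have h1 := prod_factorial_count_ne_zero J
  have h3 : (∏ i : Fin N, (((a ::ₘ J).count i)! : ℝ)) =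
      (J.count a + 1) * ∏ i : Fin N, ((J.count i)! : ℝ) := by
    rw [← Finset.mul_prod_erase _ _ (Finset.mem_univ a),
      ← Finset.mul_prod_erase _ (fun i => ((J.count i)! : ℝ)) (Finset.mem_univ a), ← mul_assoc]
    congr 1
    · simp [Nat.factorial_succ]
    · refine Finset.prod_congr rfl fun i hi => ?_
      rw [Multiset.count_cons_of_ne (Finset.ne_of_mem_erase hi)]
  have h4 : (J.count a + 1 : ℝ) ≠ 0 := by positivity
  unfold multinomialFactor
  rw [h3, Multiset.card_cons, Multiset.count_cons_self, Nat.factorial_succ]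
  push_cast
  field_simp

/-- Pascal's rule for multinomial coefficients: the orderings of `J` are classified by their first
entry. The proof multiplies by `|J|` and uses that the multiplicities add up to `|J|`. -/
theorem sum_multinomialFactor_erase {J : Multiset (Fin N)} (hJ : J ≠ 0) :
    (∑ i : Fin N, if i ∈ J then multinomialFactor (J.erase i) else 0) = multinomialFactor J := by
  have hc : (J.card : ℝ) ≠ 0 := Nat.cast_ne_zero.2 (Multiset.card_pos.2 hJ).ne'
  apply mul_left_cancel₀ hc
  rw [Finset.mul_sum]
  have h : ∀ i : Fin N, (J.card : ℝ) * (if i ∈ J then multinomialFactor (J.erase i) else 0) =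
      (J.count i : ℝ) * multinomialFactor J := by
    intro i
    split_ifs with hi
    · have := card_mul_multinomialFactor_cons i (J.erase i)
      rwa [Multiset.cons_erase hi] at this
    · simp [Multiset.count_eq_zero_of_notMem hi]
  rw [Finset.sum_congr rfl fun i _ => h i, ← Finset.sum_mul, ← Nat.cast_sum,
    Multiset.sum_count_eq_card fun i _ => Finset.mem_univ i]

theorem sum_jetIndex_of_le {M : Type*} [AddCommMonoid M] {K L : ℕ} (h : K ≤ L)
    {Φ : Multiset (Fin N) → M} (hΦ : ∀ J, K < J.card → Φ J = 0) :
    ∑ J : JetIndex N L, Φ J.1 = ∑ J : JetIndex N K, Φ J.1 := by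
  symm
  refine Finset.sum_of_injOn (fun J => ⟨J.1, J.2.trans h⟩) ?_ (by simp) ?_ (by simp)
  · intro J _ J' _ hJ
    exact Subtype.ext (by simpa using hJ)
  · intro J _ hJ
    apply hΦ
    by_contra hc
    exact hJ ⟨⟨J.1, not_lt.1 hc⟩, by simp, rfl⟩

/-- The change of variable `J ↦ J + a`: multi-indices containing `a` correspond to all multi-indices
one shorter. Every later transfer of an index between a coefficient and a coordinate or contact form
is of this kind. -/
theorem sum_jetIndex_succ_erase {M : Type*} [AddCommMonoid M] {K : ℕ} (a : Fin N)
    (Φ : Multiset (Fin N) → M) :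
    (∑ J : JetIndex N (K + 1), if a ∈ J.1 then Φ (J.1.erase a) else 0) =
      ∑ J : JetIndex N K, Φ J.1 := by
  symm
  refine Finset.sum_of_injOn
    (fun J => ⟨a ::ₘ J.1, by rw [Multiset.card_cons]; exact Nat.succ_le_succ J.2⟩) ?_ (by simp)
    ?_ ?_
  · intro J _ J' _ hJ
    exact Subtype.ext (by simpa using hJ)
  · intro J _ hJ
    rw [if_neg]
    intro ha
    refine hJ ⟨⟨J.1.erase a, ?_⟩, by simp, Subtype.ext (Multiset.cons_erase ha)⟩
    have := J.2
    rw [Multiset.card_erase_of_mem ha, Nat.pred_eq_sub_one]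
    omega
  · intro J _
    simp

theorem tupleIndex_cons {k : ℕ} (a : Fin N) (j : Fin k → Fin N) :
    tupleIndex (Fin.cons a j : Fin (k + 1) → Fin N) = a ::ₘ tupleIndex j := by
  simp only [tupleIndex]
  rw [Fin.univ_succ]
  simp [Function.comp_def]

theorem card_tupleIndex {k : ℕ} (j : Fin k → Fin N) : (tupleIndex j).card = k := by
  simp [tupleIndex]

theorem tupleIndex_zero (j : Fin 0 → Fin N) : tupleIndex j = 0 := rfl

theorem sum_tuple_succ {M : Type*} [AddCommMonoid M] {k : ℕ} (f : (Fin (k + 1) → Fin N) → M) :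
    ∑ j, f j = ∑ a : Fin N, ∑ j : Fin k → Fin N, f (Fin.cons a j) := by
  rw [← (Fin.consEquiv fun _ => Fin N).sum_comp, Fintype.sum_prod_type]
  rfl

/-- Each `J` of length `k` arises from `|J|!/J!` tuples. The induction splits off the first entry
and closes with `sum_multinomialFactor_erase`; the bound `K` is left free so that it can drop along
with `k`. -/
theorem sum_tupleIndex {M : Type*} [AddCommGroup M] [Module ℝ M] (k : ℕ) :
    ∀ {K : ℕ} (_ : k ≤ K) (Φ : Multiset (Fin N) → M),
    ∑ j : Fin k → Fin N, Φ (tupleIndex j) =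
      ∑ J : JetIndex N K, if J.1.card = k then multinomialFactor J.1 • Φ J.1 else 0 := by
  induction k with
  | zero =>
    intro K _ Φ
    rw [Finset.sum_eq_single (⟨0, Nat.zero_le K⟩ : JetIndex N K)]
    · simp [multinomialFactor_zero, tupleIndex_zero]
    · intro J _ hJ
      rw [if_neg]
      intro h
      exact hJ (Subtype.ext (Multiset.card_eq_zero.1 h))
    · simp
  | succ k ih =>
    intro K hK Φ
    obtain ⟨K, rfl⟩ : ∃ K', K = K' + 1 := ⟨K - 1, by omega⟩
    rw [sum_tuple_succ]
    simp_rw [tupleIndex_cons]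
    have h1 : ∀ a : Fin N, ∑ j : Fin k → Fin N, Φ (a ::ₘ tupleIndex j) =
        ∑ J : JetIndex N (K + 1), if a ∈ J.1 then
          (if J.1.card = k + 1 then multinomialFactor (J.1.erase a) • Φ J.1 else 0) else 0 := by
      intro a
      rw [ih (Nat.le_of_succ_le_succ hK) fun J => Φ (a ::ₘ J)]
      rw [← sum_jetIndex_succ_erase a fun J =>
        if J.card = k then multinomialFactor J • Φ (a ::ₘ J) else 0]
      refine Finset.sum_congr rfl fun J _ => ?_
      split_ifs with h1 h2 h3 h3
      · rw [Multiset.cons_erase h1]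
      · exact absurd (by rw [← Multiset.card_erase_add_one h1, h2]) h3
      · rw [← Multiset.card_erase_add_one h1] at h3
        exact absurd (Nat.succ_injective h3) h2
      · rfl
      · rfl
    rw [Finset.sum_congr rfl fun a _ => h1 a, Finset.sum_comm]
    refine Finset.sum_congr rfl fun J _ => ?_
    split_ifs with h
    · rw [← sum_multinomialFactor_erase (J := J.1) (by rintro h0; simp [h0] at h), Finset.sum_smul]
      refine Finset.sum_congr rfl fun a _ => ?_
      split_ifs <;> simp
    · simp

theorem sum_range_tupleIndex {M : Type*} [AddCommGroup M] [Module ℝ M] (K : ℕ)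
    (Φ : Multiset (Fin N) → M) :
    ∑ k ∈ Finset.range (K + 1), ∑ j : Fin k → Fin N, Φ (tupleIndex j) =
      ∑ J : JetIndex N K, multinomialFactor J.1 • Φ J.1 := by
  rw [Finset.sum_congr rfl fun k hk =>
    sum_tupleIndex k (Nat.le_of_lt_succ (Finset.mem_range.1 hk)) Φ, Finset.sum_comm]
  refine Finset.sum_congr rfl fun J _ => ?_
  rw [Finset.sum_ite_eq, if_pos (Finset.mem_range.2 (Nat.lt_succ_of_le J.2))]

/-! ### Repeated integration by parts -/

/-- `∑ d_{q₁}⋯d_{q_l} ∂/∂y^σ_{M q₁…q_l}` (symmetrized). -/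
def dIterSym (hU : IsOpen U) (l : ℕ) (M : Multiset (Fin N)) (σ : Fin m) :
    smoothFn U →ₗ[ℝ] smoothFn U :=
  ∑ q : Fin l → Fin N, dIter hU l q ∘ₗ dSym hU (M + tupleIndex q) σ

theorem dIterSym_zero (hU : IsOpen U) (M : Multiset (Fin N)) (σ : Fin m) :
    dIterSym hU 0 M σ = dSym hU M σ := by
  simp [dIterSym, tupleIndex_zero, dIter]

theorem dIterSym_succ (hU : IsOpen U) (l : ℕ) (M : Multiset (Fin N)) (σ : Fin m)
    (f : smoothFn U) :
    dIterSym hU (l + 1) M σ f = ∑ i, dTot hU i (dIterSym hU l (i ::ₘ M) σ f) := by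
  simp only [dIterSym]
  rw [sum_tuple_succ]
  simp only [LinearMap.sum_apply, map_sum]
  refine Finset.sum_congr rfl fun i _ => Finset.sum_congr rfl fun q _ => ?_
  simp [dIter, tupleIndex_cons]

theorem HasOrder.dSym_eq_zero (hU : IsOpen U) {f : smoothFn U} {s : ℕ} (hf : HasOrder U f s)
    {J : Multiset (Fin N)} (hJ : s < J.card) (σ : Fin m) : dSym hU J σ f = 0 := by
  rw [dSym, LinearMap.smul_apply, hf.dFib_eq_zero hU hJ, smul_zero]

theorem HasOrder.dIterSym_eq_zero (hU : IsOpen U) {f : smoothFn U} {s : ℕ} (hf : HasOrder U f s)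
    {l : ℕ} {M : Multiset (Fin N)} (h : s < M.card + l) (σ : Fin m) :
    dIterSym hU l M σ f = 0 := by
  simp only [dIterSym, LinearMap.sum_apply]
  refine Finset.sum_eq_zero fun q _ => ?_
  rw [LinearMap.comp_apply, hf.dSym_eq_zero hU (by rw [Multiset.card_add, card_tupleIndex]; exact h),
    map_zero]

/-- `∑_{l<R} (-1)^l d_{q₁}⋯d_{q_l} ∂/∂y^σ_{M q₁…q_l}`; for large `R` this is the Euler–Lagrange
expression when `M = 0`, and gives the coefficients of the principal Lepage equivalent in
general. -/
def momentum (hU : IsOpen U) (R : ℕ) (M : Multiset (Fin N)) (σ : Fin m) :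
    smoothFn U →ₗ[ℝ] smoothFn U :=
  ∑ l ∈ Finset.range R, (-1 : ℝ) ^ l • dIterSym hU l M σ

theorem momentum_apply (hU : IsOpen U) (R : ℕ) (M : Multiset (Fin N)) (σ : Fin m)
    (f : smoothFn U) :
    momentum hU R M σ f = ∑ l ∈ Finset.range R, (-1 : ℝ) ^ l • dIterSym hU l M σ f := by
  simp [momentum]

/-- Terms with `|M| + l > s` differentiate by coordinates of too high order and vanish, so the
cut-off `R` is immaterial once large. Momenta of functions of different orders can therefore be
taken with one common `R`. -/
theorem HasOrder.momentum_eq (hU : IsOpen U) {f : smoothFn U} {s : ℕ} (hf : HasOrder U f s)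
    {R R' : ℕ} {M : Multiset (Fin N)} (hR : R ≤ R') (h : s < M.card + R) (σ : Fin m) :
    momentum hU R' M σ f = momentum hU R M σ f := by
  rw [momentum_apply, momentum_apply]
  symm
  refine Finset.sum_subset (Finset.range_mono hR) fun l _ hl => ?_
  rw [hf.dIterSym_eq_zero hU (by simp at hl; omega), smul_zero]

theorem HasOrder.momentum_eq_zero (hU : IsOpen U) {f : smoothFn U} {s : ℕ} (hf : HasOrder U f s)
    (R : ℕ) {M : Multiset (Fin N)} (h : s < M.card) (σ : Fin m) : momentum hU R M σ f = 0 := by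
  rw [hf.momentum_eq hU (Nat.zero_le R) (by omega)]
  simp [momentum]

/-- Telescoping: peeling the outermost total derivative off the `l`-th term, for `l ≥ 1`, turns it
into minus `d_i` of the `(l-1)`-st term of the momentum with index `M + i`. Only the term `l = 0`
survives. -/
theorem momentum_add_sum_dTot (hU : IsOpen U) {f : smoothFn U} {s : ℕ} (hf : HasOrder U f s)
    {R : ℕ} (M : Multiset (Fin N)) (h : s < M.card + R) (σ : Fin m) :
    momentum hU R M σ f + ∑ i, dTot hU i (momentum hU R (i ::ₘ M) σ f) = dSym hU M σ f := by
  have h1 : ∑ i, dTot hU i (momentum hU R (i ::ₘ M) σ f) =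
      -∑ l ∈ Finset.range R, (-1 : ℝ) ^ (l + 1) • dIterSym hU (l + 1) M σ f := by
    simp only [momentum_apply, map_sum, map_smul]
    rw [Finset.sum_comm, ← Finset.sum_neg_distrib]
    refine Finset.sum_congr rfl fun l _ => ?_
    rw [dIterSym_succ, ← Finset.smul_sum, pow_succ]
    module
  rw [h1, ← hf.momentum_eq hU (Nat.le_succ R) h, momentum_apply, Finset.sum_range_succ',
    dIterSym_zero]
  simp

theorem multinomialFactor_smul_dSym (hU : IsOpen U) (J : Multiset (Fin N)) (σ : Fin m)
    (f : smoothFn U) : multinomialFactor J • dSym hU J σ f = dFib hU J σ f := by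
  rw [dSym, LinearMap.smul_apply, smul_smul, multinomialFactor_mul_symFactor, one_smul]

/-- The coefficient of `ω^σ_J ∧ ω_i` in the principal Lepage equivalent. -/
def lepageCoeff (hU : IsOpen U) (R : ℕ) (J : Multiset (Fin N)) (i : Fin N) (σ : Fin m) :
    smoothFn U →ₗ[ℝ] smoothFn U :=
  multinomialFactor J • momentum hU R (i ::ₘ J) σ

theorem HasOrder.lepageCoeff_eq_zero (hU : IsOpen U) {f : smoothFn U} {s : ℕ} (hf : HasOrder U f s)
    (R : ℕ) {J : Multiset (Fin N)} (h : s ≤ J.card) (i : Fin N) (σ : Fin m) :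
    lepageCoeff hU R J i σ f = 0 := by
  rw [lepageCoeff, LinearMap.smul_apply,
    hf.momentum_eq_zero hU R (by rw [Multiset.card_cons]; omega), smul_zero]

theorem HasOrder.lepageCoeff_eq (hU : IsOpen U) {f : smoothFn U} {s : ℕ} (hf : HasOrder U f s)
    {R R' : ℕ} (hR : R ≤ R') (h : s ≤ R) (J : Multiset (Fin N)) (i : Fin N) (σ : Fin m) :
    lepageCoeff hU R' J i σ f = lepageCoeff hU R J i σ f := by
  rw [lepageCoeff, lepageCoeff, LinearMap.smul_apply, LinearMap.smul_apply,
    hf.momentum_eq hU hR (by rw [Multiset.card_cons]; omega)]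

/-- The first variation formula, coefficient by coefficient: `momentum_add_sum_dTot` multiplied by
`|J|!/J!`. The momenta reached by erasing an index `i` from `J` are all equal to the one with index
`J`, and their weights add up by Pascal's rule. -/
theorem sum_dTot_lepageCoeff (hU : IsOpen U) {f : smoothFn U} {s : ℕ} (hf : HasOrder U f s)
    {R : ℕ} (hR : s < R) (J : Multiset (Fin N)) (σ : Fin m) :
    ∑ i, (dTot hU i (lepageCoeff hU R J i σ f) +
        if i ∈ J then lepageCoeff hU R (J.erase i) i σ f else 0) =
      dFib hU J σ f - if J = 0 then momentum hU R 0 σ f else 0 := by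
  have h1 := congrArg (multinomialFactor J • ·)
    (momentum_add_sum_dTot hU hf J (R := R) (by omega) σ)
  simp only [smul_add, Finset.smul_sum, multinomialFactor_smul_dSym] at h1
  rw [Finset.sum_add_distrib, ← h1]
  have h2 : ∑ i, dTot hU i (lepageCoeff hU R J i σ f) =
      ∑ i, multinomialFactor J • dTot hU i (momentum hU R (i ::ₘ J) σ f) := by
    simp [lepageCoeff]
  have h3 : (∑ i, if i ∈ J then lepageCoeff hU R (J.erase i) i σ f else 0) =
      (∑ i : Fin N, if i ∈ J then multinomialFactor (J.erase i) else 0) •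
        momentum hU R J σ f := by
    rw [Finset.sum_smul]
    refine Finset.sum_congr rfl fun i _ => ?_
    split_ifs with hi
    · rw [lepageCoeff, LinearMap.smul_apply, Multiset.cons_erase hi]
    · simp
  rw [h2, h3]
  -- For `J = 0` there is no index to erase, so the momentum with index `0`, which is the
  -- Euler–Lagrange expression, is left over.
  by_cases hJ : J = 0
  · subst hJ
    simp [multinomialFactor_zero]
  · rw [sum_multinomialFactor_erase hJ, if_neg hJ]
    abel

end

section


/-! ### Exactness of the Koszul type complex of total derivatives -/

section koszul

variable {ι A : Type*} [DecidableEq ι] [AddCommGroup A] [Module ℝ A]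
  (d : ι → A →ₗ[ℝ] A)

/-- The action of the total derivative `d_i` on the coefficients of 1-contact forms. -/
def shiftDeriv (i : ι) : (Multiset ι → A) →ₗ[ℝ] (Multiset ι → A) where
  toFun Φ M := d i (Φ M) + if i ∈ M then Φ (M.erase i) else 0
  map_add' Φ Ψ := by
    funext M
    simp only [Pi.add_apply, map_add]
    split_ifs
    · abel
    · simp
  map_smul' c Φ := by
    funext M
    simp only [Pi.smul_apply, map_smul, RingHom.id_apply, smul_add]
    split_ifs <;> simp

theorem shiftDeriv_apply (i : ι) (Φ : Multiset ι → A) (M : Multiset ι) :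
    shiftDeriv d i Φ M = d i (Φ M) + if i ∈ M then Φ (M.erase i) else 0 := rfl

variable {d}

/-- The operator reflects `d_i(Φ ω_J) = (d_i Φ) ω_J + Φ ω_{Ji}`; both the derivatives and the index
shifts commute. -/
theorem shiftDeriv_comm (hd : ∀ i j a, d i (d j a) = d j (d i a)) (i j : ι) (Φ : Multiset ι → A) :
    shiftDeriv d i (shiftDeriv d j Φ) = shiftDeriv d j (shiftDeriv d i Φ) := by
  by_cases hij : i = j
  · rw [hij]
  funext M
  simp only [shiftDeriv_apply, map_add, hd i j]
  have hji := Ne.symm hij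
  by_cases hi : i ∈ M <;> by_cases hj : j ∈ M <;>
    simp [hi, hj, Multiset.mem_erase_of_ne hij, Multiset.mem_erase_of_ne hji,
      Multiset.erase_comm M i j]; abel

variable [Fintype ι]

/-- Exchanging `i` and `j` shows that the double sum equals its own negative. -/
theorem sum_shiftDeriv_shiftDeriv (hd : ∀ i j a, d i (d j a) = d j (d i a))
    {b : ι → ι → Multiset ι → A} (hb : ∀ i j, b i j = -b j i) :
    ∑ i, shiftDeriv d i (∑ j, shiftDeriv d j (b i j)) = 0 := by
  have h : ∑ i, shiftDeriv d i (∑ j, shiftDeriv d j (b i j)) =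
      -∑ i, shiftDeriv d i (∑ j, shiftDeriv d j (b i j)) := by
    conv_lhs => simp only [map_sum]
    rw [Finset.sum_comm]
    simp only [map_sum, ← Finset.sum_neg_distrib]
    refine Finset.sum_congr rfl fun i _ => Finset.sum_congr rfl fun j _ => ?_
    rw [shiftDeriv_comm hd, hb, map_neg, map_neg]
  have h2 : (2 : ℝ) • ∑ i, shiftDeriv d i (∑ j, shiftDeriv d j (b i j)) = 0 := by
    rw [two_smul]
    nth_rewrite 1 [h]
    exact neg_add_cancel _
  exact (smul_eq_zero.1 h2).resolve_left two_ne_zero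

omit [Fintype ι] in
/-- The Koszul homotopy in degree `K`. -/
def koszulHomotopy (K : ℕ) (c : ι → Multiset ι → A) (i j : ι) (J : Multiset ι) : A :=
  if J.card = K then ((K : ℝ) + 2)⁻¹ • (((J.count j : ℝ) + 1) • c i (j ::ₘ J) -
    ((J.count i : ℝ) + 1) • c j (i ::ₘ J)) else 0

omit [Fintype ι] in
theorem koszulHomotopy_antisymm (K : ℕ) (c : ι → Multiset ι → A) (i j : ι) :
    koszulHomotopy K c i j = -koszulHomotopy K c j i := by
  funext J
  simp only [koszulHomotopy, Pi.neg_apply]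
  split_ifs
  · rw [← smul_neg, neg_sub]
  · simp

/-- Encode an array `Φ` as the polynomial `∑ Φ(J) ξ^J`. Erasing an index is then multiplication by a
variable, and `koszulHomotopy` is `(∂_j c_i - ∂_i c_j)/(K+2)` restricted to degree `K`. For `c_i` of
degree `K+1`, Euler's formula gives `∑_j ξ_j (∂_j c_i - ∂_i c_j) = (K+1) c_i + c_i - ∂_i(∑_j ξ_j
c_j)`, and `hc` kills the relevant coefficient of the last term. -/
theorem sum_koszulHomotopy_erase {K : ℕ} {c : ι → Multiset ι → A} {J : Multiset ι}
    (hJ : J.card = K + 1) (i : ι)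
    (hc : ∑ j, (if j ∈ i ::ₘ J then c j ((i ::ₘ J).erase j) else 0) = 0) :
    (∑ j, if j ∈ J then koszulHomotopy K c i j (J.erase j) else 0) = c i J := by
  -- The summand present only for `j = i` is the commutator of `∂_i` with `ξ_i`; it turns the Euler
  -- factor `K+1` into `K+2`.
  have hterm : ∀ j, (if j ∈ J then koszulHomotopy K c i j (J.erase j) else 0) =
      ((K : ℝ) + 2)⁻¹ • ((J.count j : ℝ) • c i J + (if j = i then c i J else 0) -
        ((J.count i : ℝ) + 1) • (if j ∈ i ::ₘ J then c j ((i ::ₘ J).erase j) else 0)) := by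
    intro j
    by_cases hj : j ∈ J
    · have hcard : (J.erase j).card = K := by
        rw [Multiset.card_erase_of_mem hj, hJ]; rfl
      have hcount : ((J.erase j).count j : ℝ) + 1 = J.count j := by
        have := Multiset.count_pos.2 hj
        rw [Multiset.count_erase_self]
        norm_cast
        omega
      rw [if_pos hj, koszulHomotopy, if_pos hcard, hcount, Multiset.cons_erase hj,
        if_pos (Multiset.mem_cons_of_mem hj)]
      congr 1
      by_cases hji : j = i
      · subst hji
        rw [hcount, Multiset.cons_erase hj, if_pos rfl, Multiset.erase_cons_head, add_smul, one_smul]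
        abel
      · rw [if_neg hji, add_zero, Multiset.count_erase_of_ne (Ne.symm hji),
          Multiset.erase_cons_tail _ (Ne.symm hji)]
    · rw [if_neg hj, Multiset.count_eq_zero_of_notMem hj]
      by_cases hji : j = i
      · subst hji
        simp [Multiset.count_eq_zero_of_notMem hj]
      · simp [hj, hji]
  rw [Finset.sum_congr rfl fun j _ => hterm j, ← Finset.smul_sum, Finset.sum_sub_distrib,
    Finset.sum_add_distrib, ← Finset.smul_sum, hc, smul_zero, sub_zero, ← Finset.sum_smul,
    ← Nat.cast_sum, Multiset.sum_count_eq_card fun i _ => Finset.mem_univ i, hJ]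
  have h : ((K : ℝ) + 2) ≠ 0 := by positivity
  rw [Finset.sum_ite_eq' Finset.univ i, if_pos (Finset.mem_univ i), show ((K + 1 : ℕ) : ℝ) • c i J + c i J = ((K : ℝ) + 2) • c i J by push_cast; module,
    smul_smul, inv_mul_cancel₀ h, one_smul]

/-- Descending induction on the top degree of `c`. The part of `∑_i δ_i c_i` of highest length sees
only the index shifts, so it is a polynomial Koszul condition. Subtracting the boundary of the
homotopy lowers the degree and preserves the hypothesis. The equation at `M = 0` is never used. -/
theorem exists_koszul_primitive (hd : ∀ i j a, d i (d j a) = d j (d i a)) (K : ℕ) :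
    ∀ c : ι → Multiset ι → A, (∀ i J, K < J.card → c i J = 0) →
    (∀ M, M ≠ 0 → (∑ i, shiftDeriv d i (c i)) M = 0) →
    ∃ b : ι → ι → Multiset ι → A, (∀ i j, b i j = -b j i) ∧ (∀ i j J, K < J.card → b i j J = 0) ∧
      ∀ i, c i = ∑ j, shiftDeriv d j (b i j) := by
  induction K with
  | zero =>
    intro c hsupp hc
    -- In degree zero the equation at `M = {i}` already reads `c_i(0) = 0`, since the coefficients
    -- of positive length vanish.
    refine ⟨0, by simp, by simp, fun i => ?_⟩
    funext J
    simp only [Pi.zero_apply, map_zero, Finset.sum_const_zero]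
    rcases Nat.eq_zero_or_pos J.card with h | h
    · rw [Multiset.card_eq_zero.1 h]
      have := hc {i} (by simp)
      simp only [Finset.sum_apply, shiftDeriv_apply] at this
      rw [Finset.sum_eq_single i] at this
      · simpa [hsupp i {i} (by simp)] using this
      · intro j _ hj
        simp [hsupp j {i} (by simp), hj]
      · simp
    · exact hsupp i J h
  | succ K ih =>
    intro c hsupp hc
    set b₁ := koszulHomotopy K c with hb₁
    have hb₁a := koszulHomotopy_antisymm K c
    have hb₁0 : ∀ i j J, J.card ≠ K → b₁ i j J = 0 := fun i j J h => if_neg h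
    -- Beyond degree `K` only the shift part of the boundary of `b₁` remains. In degree `K + 1` it
    -- reproduces `c i`, by the hypothesis at `i ::ₘ J`, of length `K + 2`, where the derivative
    -- terms vanish.
    have h₁ : ∀ i J, K < J.card → (c i - ∑ j, shiftDeriv d j (b₁ i j)) J = 0 := by
      intro i J hJ
      simp only [Pi.sub_apply, Finset.sum_apply, shiftDeriv_apply]
      simp only [hb₁0 _ _ J (by omega : J.card ≠ K), map_zero, zero_add]
      rcases eq_or_ne J.card (K + 1) with h | h
      · rw [sum_koszulHomotopy_erase h i, sub_self]
        have h2 := hc (i ::ₘ J) (by simp)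
        simp only [Finset.sum_apply, shiftDeriv_apply] at h2
        refine Eq.trans (Finset.sum_congr rfl fun j _ => ?_) h2
        rw [hsupp j (i ::ₘ J) (by rw [Multiset.card_cons]; omega), map_zero, zero_add]
      · rw [hsupp i J (by omega), zero_sub, neg_eq_zero]
        refine Finset.sum_eq_zero fun j _ => ?_
        split_ifs with hj
        · refine hb₁0 _ _ _ ?_
          rw [Multiset.card_erase_of_mem hj, Nat.pred_eq_sub_one]
          omega
        · rfl
    -- The boundary of an antisymmetric array is itself closed, so the remainder satisfies the same
    -- equations.
    have h₂ : ∀ M, M ≠ 0 →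
        (∑ i, shiftDeriv d i (c i - ∑ j, shiftDeriv d j (b₁ i j))) M = 0 := by
      intro M hM
      simp only [map_sub, Finset.sum_sub_distrib]
      rw [sum_shiftDeriv_shiftDeriv hd hb₁a, sub_zero]
      exact hc M hM
    obtain ⟨b₂, hb₂a, hb₂0, hb₂⟩ := ih (fun i => c i - ∑ j, shiftDeriv d j (b₁ i j)) h₁ h₂
    refine ⟨b₁ + b₂, fun i j => ?_, fun i j J hJ => ?_, fun i => ?_⟩
    · simp only [Pi.add_apply, neg_add]
      rw [hb₁, hb₁a, hb₂a]
    · simp only [Pi.add_apply]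
      rw [hb₁0 i j J (by omega), hb₂0 i j J (by omega), add_zero]
    · simp only [Pi.add_apply, map_add, Finset.sum_add_distrib]
      rw [← hb₂]
      abel

end koszul

end

section


set_option maxSynthPendingDepth 3

open ContinuousAlternatingMap (alternatizeUncurryFin alternatizeUncurryFin_apply
  alternatizeUncurryFin_add alternatizeUncurryFinCLM compContinuousLinearMap_apply
  alternatizeUncurryFin_alternatizeUncurryFinCLM_comp_of_symmetric curryLeft_apply_apply
  fderivCompContinuousLinearMap_apply)

/-! ### Exterior products with covectors -/

section wedge

variable {E F : Type*} [NormedAddCommGroup E] [NormedSpace ℝ E] [NormedAddCommGroup F]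
  [NormedSpace ℝ F] {k : ℕ}

theorem wedgeOne_apply (θ : E →L[ℝ] ℝ) (η : E [⋀^Fin k]→L[ℝ] ℝ) (v : Fin (k + 1) → E) :
    wedgeOne θ η v = ∑ i : Fin (k + 1), (-1 : ℝ) ^ (i : ℕ) * (θ (v i) * η (i.removeNth v)) := by
  rw [wedgeOne, alternatizeUncurryFin_apply]
  simp

/-- `wedgeOne` as a bilinear map. -/
def wedgeₗ : (E →L[ℝ] ℝ) →ₗ[ℝ] (E [⋀^Fin k]→L[ℝ] ℝ) →ₗ[ℝ] E [⋀^Fin (k + 1)]→L[ℝ] ℝ :=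
  LinearMap.mk₂ ℝ wedgeOne
    (fun _ _ _ => by
      ext v; simp only [wedgeOne_apply, ContinuousAlternatingMap.add_apply,
        _root_.add_apply, ← Finset.sum_add_distrib]
      exact Finset.sum_congr rfl fun i _ => by ring)
    (fun _ _ _ => by
      ext v; simp only [wedgeOne_apply, ContinuousAlternatingMap.smul_apply,
        _root_.smul_apply, smul_eq_mul, Finset.mul_sum]
      exact Finset.sum_congr rfl fun i _ => by ring)
    (fun _ _ _ => by
      ext v; simp only [wedgeOne_apply, ContinuousAlternatingMap.add_apply,
        ← Finset.sum_add_distrib]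
      exact Finset.sum_congr rfl fun i _ => by ring)
    (fun _ _ _ => by
      ext v; simp only [wedgeOne_apply, ContinuousAlternatingMap.smul_apply,
        smul_eq_mul, Finset.mul_sum]
      exact Finset.sum_congr rfl fun i _ => by ring)

theorem wedgeOne_eq (θ : E →L[ℝ] ℝ) (η : E [⋀^Fin k]→L[ℝ] ℝ) : wedgeOne θ η = wedgeₗ θ η := rfl

/-- Alternating twice annihilates the symmetric tensor `θ ⊗ θ' + θ' ⊗ θ`; this is the mechanism
behind `d ∘ d = 0`. -/
theorem wedgeₗ_comm (θ θ' : E →L[ℝ] ℝ) (η : E [⋀^Fin k]→L[ℝ] ℝ) :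
    wedgeₗ θ (wedgeₗ θ' η) = -wedgeₗ θ' (wedgeₗ θ η) := by
  have h := alternatizeUncurryFin_alternatizeUncurryFinCLM_comp_of_symmetric
    (f := θ.smulRight (θ'.smulRight η) + θ'.smulRight (θ.smulRight η))
    (fun x y => by simp [smul_smul, mul_comm, add_comm])
  have h2 : ∀ (θ : E →L[ℝ] ℝ) (X : E →L[ℝ] E [⋀^Fin k]→L[ℝ] ℝ),
      alternatizeUncurryFinCLM ℝ E ℝ ∘L θ.smulRight X = θ.smulRight (alternatizeUncurryFin X) := by
    intro θ X
    ext1 x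
    exact map_smul (alternatizeUncurryFinCLM ℝ E ℝ) (θ x) X
  rw [eq_neg_iff_add_eq_zero, ← h, ContinuousLinearMap.comp_add, alternatizeUncurryFin_add, h2, h2]
  rfl

theorem wedgeₗ_compContinuousLinearMap (θ : F →L[ℝ] ℝ) (η : F [⋀^Fin k]→L[ℝ] ℝ) (A : E →L[ℝ] F) :
    (wedgeₗ θ η).compContinuousLinearMap A =
      wedgeₗ (θ ∘L A) (η.compContinuousLinearMap A) := by
  ext v
  simp only [← wedgeOne_eq, wedgeOne_apply, compContinuousLinearMap_apply]
  rfl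

theorem wedgeₗ_curryLeft (θ : E →L[ℝ] ℝ) (η : E [⋀^Fin (k + 1)]→L[ℝ] ℝ) (v : E) :
    (wedgeₗ θ η).curryLeft v = θ v • η - wedgeₗ θ (η.curryLeft v) := by
  ext w
  simp only [← wedgeOne_eq, wedgeOne_apply, curryLeft_apply_apply,
    ContinuousAlternatingMap.sub_apply, ContinuousAlternatingMap.smul_apply, smul_eq_mul]
  rw [Fin.sum_univ_succ, sub_eq_add_neg, ← Finset.sum_neg_distrib]
  congr 1
  · simp
  · refine Finset.sum_congr rfl fun i _ => ?_
    have h : (i.succ.removeNth (Matrix.vecCons v w) : Fin (k + 1) → E) =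
        Matrix.vecCons v (i.removeNth w) := by
      funext j
      refine Fin.cases ?_ (fun j => ?_) j
      · simp [Fin.removeNth]
      · simp [Fin.removeNth]
    rw [h]
    simp [pow_succ]

/-- The antiderivation rule when `η` is annihilated by contraction with `v`. The hypothesis is
phrased through arguments equal to `v`, so that it also makes sense for `η` of degree zero, where
there is no contraction. -/
theorem wedgeₗ_curryLeft_of_forall_eq_zero (θ : E →L[ℝ] ℝ) (η : E [⋀^Fin k]→L[ℝ] ℝ) (v : E)
    (h : ∀ u : Fin k → E, (∃ i, u i = v) → η u = 0) :
    (wedgeₗ θ η).curryLeft v = θ v • η := by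
  cases k with
  | zero =>
    ext w
    simp only [← wedgeOne_eq, wedgeOne_apply, curryLeft_apply_apply,
      ContinuousAlternatingMap.smul_apply, smul_eq_mul]
    rw [Fin.sum_univ_succ]
    simp only [Finset.univ_eq_empty, Finset.sum_empty, add_zero, Fin.val_zero, pow_zero, one_mul,
      Matrix.cons_val_zero]
    congr 2
  | succ k =>
    rw [wedgeₗ_curryLeft]
    have : η.curryLeft v = 0 := by
      ext w
      exact h _ ⟨0, rfl⟩
    rw [this, map_zero, sub_zero]

/-- `fderivCompContinuousLinearMap` as a linear map in the form. -/
def contactPart (g dg : E →L[ℝ] F) : (F [⋀^Fin k]→L[ℝ] ℝ) →ₗ[ℝ] (E [⋀^Fin k]→L[ℝ] ℝ) where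
  toFun f := f.fderivCompContinuousLinearMap g dg
  map_add' f f' := by
    ext v
    simp [Finset.sum_add_distrib]
  map_smul' c f := by
    ext v
    simp [Finset.mul_sum]

theorem contactPart_apply (g dg : E →L[ℝ] F) (f : F [⋀^Fin k]→L[ℝ] ℝ) (v : Fin k → E) :
    contactPart g dg f v = ∑ i, f fun j => Function.update (fun _ => g) i dg j (v j) :=
  fderivCompContinuousLinearMap_apply f g dg v

/-- Leibniz rule: the single argument sent through `dg` is either the one fed to `θ` or one of those
fed to `η`. -/
theorem contactPart_wedgeₗ (g dg : E →L[ℝ] F) (θ : F →L[ℝ] ℝ) (η : F [⋀^Fin k]→L[ℝ] ℝ) :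
    contactPart g dg (wedgeₗ θ η) =
      wedgeₗ (θ ∘L dg) (η.compContinuousLinearMap g) + wedgeₗ (θ ∘L g) (contactPart g dg η) := by
  ext v
  simp only [contactPart_apply, ← wedgeOne_eq, wedgeOne_apply, ContinuousAlternatingMap.add_apply]
  rw [Finset.sum_comm, ← Finset.sum_add_distrib]
  refine Finset.sum_congr rfl fun j _ => ?_
  rw [Fin.sum_univ_succAbove _ j, ← Finset.mul_sum, ← mul_add, ← mul_add, Finset.mul_sum]
  congr 2
  · congr 1
    · simp
    · rw [compContinuousLinearMap_apply]
      congr 1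
      funext i
      simp [Fin.removeNth]
  · refine Finset.sum_congr rfl fun i _ => ?_
    congr 1
    · rw [Function.update_of_ne (Fin.succAbove_ne j i).symm]
      rfl
    · congr 1
      funext i'
      rcases eq_or_ne i' i with rfl | h
      · simp [Fin.removeNth]
      · simp [Fin.removeNth, Function.update_of_ne h,
          Function.update_of_ne ((Fin.succAbove_right_injective (p := j)).ne h)]

theorem contactPart_comp_of_comp_eq_zero {G : Type*} [NormedAddCommGroup G] [NormedSpace ℝ G]
    (g dg : E →L[ℝ] F) (P : F →L[ℝ] G) (hP : P ∘L dg = 0) (β : G [⋀^Fin k]→L[ℝ] ℝ) :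
    contactPart g dg (β.compContinuousLinearMap P) = 0 := by
  ext v
  rw [contactPart_apply]
  refine Finset.sum_eq_zero fun i _ => ?_
  rw [compContinuousLinearMap_apply]
  refine β.map_coord_zero i ?_
  simpa using DFunLike.congr_fun hP (v i)

theorem extDeriv_smul_const {g : E → ℝ} {z : E} (hg : DifferentiableAt ℝ g z)
    (C : E [⋀^Fin k]→L[ℝ] ℝ) : extDeriv (fun z => g z • C) z = wedgeₗ (fderiv ℝ g z) C := by
  rw [extDeriv, (hg.hasFDerivAt.smul_const C).fderiv]
  rfl

theorem extDeriv_sum {ι : Type*} (t : Finset ι) {ρ : ι → E → E [⋀^Fin k]→L[ℝ] ℝ} {z : E}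
    (h : ∀ i ∈ t, DifferentiableAt ℝ (ρ i) z) :
    extDeriv (fun z => ∑ i ∈ t, ρ i z) z = ∑ i ∈ t, extDeriv (ρ i) z := by
  simp only [extDeriv]
  rw [fderiv_fun_sum h]
  exact map_sum (alternatizeUncurryFinCLM ℝ E ℝ) _ _

end wedge

/-! ### The forms `ω₀`, `ω_i`, `ω_{ij}` -/

section base

variable {n : ℕ}

/-- The interior product of `∂_i` and the volume form on `ℝ^{n+1}`. -/
def baseOne (i : Fin (n + 1)) : (Fin (n + 1) → ℝ) [⋀^Fin n]→L[ℝ] ℝ :=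
  (baseVolume (n + 1)).curryLeft (Pi.single i 1)

/-- The interior product of `∂_j` and `baseOne i`. -/
def baseTwo (i j : Fin (n + 2)) : (Fin (n + 2) → ℝ) [⋀^Fin n]→L[ℝ] ℝ :=
  (baseOne i).curryLeft (Pi.single j 1)

theorem wedge_proj_baseVolume (l : Fin (n + 1)) :
    wedgeₗ (ContinuousLinearMap.proj l : (Fin (n + 1) → ℝ) →L[ℝ] ℝ) (baseVolume (n + 1)) = 0 := by
  ext v
  refine AlternatingMap.map_linearDependent
    (wedgeₗ (ContinuousLinearMap.proj l : (Fin (n + 1) → ℝ) →L[ℝ] ℝ)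
      (baseVolume (n + 1))).toAlternatingMap v fun h => ?_
  have := h.fintype_card_le_finrank
  simp at this

/-- Contract `dx^l ∧ ω₀ = 0` with `∂_i`; contracting the result with `∂_j` gives the rule for
`baseTwo` below. -/
theorem wedge_proj_baseOne (l i : Fin (n + 1)) :
    wedgeₗ (ContinuousLinearMap.proj l : (Fin (n + 1) → ℝ) →L[ℝ] ℝ) (baseOne i) =
      if l = i then baseVolume (n + 1) else 0 := by
  have h := wedgeₗ_curryLeft (ContinuousLinearMap.proj l : (Fin (n + 1) → ℝ) →L[ℝ] ℝ)
    (baseVolume (n + 1)) (Pi.single i 1)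
  rw [wedge_proj_baseVolume] at h
  have h0 : (0 : (Fin (n + 1) → ℝ) [⋀^Fin (n + 1 + 1)]→L[ℝ] ℝ).curryLeft (Pi.single i 1) = 0 := rfl
  rw [h0, eq_comm, sub_eq_zero] at h
  rw [baseOne, ← h]
  split_ifs with hl
  · simp [hl]
  · simp [hl]

theorem wedge_proj_baseTwo (l i j : Fin (n + 2)) :
    wedgeₗ (ContinuousLinearMap.proj l : (Fin (n + 2) → ℝ) →L[ℝ] ℝ) (baseTwo i j) =
      (if l = j then baseOne i else 0) - if l = i then baseOne j else 0 := by
  have h := wedgeₗ_curryLeft (ContinuousLinearMap.proj l : (Fin (n + 2) → ℝ) →L[ℝ] ℝ)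
    (baseOne i) (Pi.single j 1)
  rw [wedge_proj_baseOne, eq_sub_iff_add_eq, ← eq_sub_iff_add_eq'] at h
  rw [baseTwo, h]
  congr 1
  · split_ifs with hl
    · simp [hl]
    · simp [hl]
  · split_ifs <;> rfl

theorem baseVolume_single : baseVolume (n + 1) (fun i => Pi.single i 1) = 1 := by
  change Matrix.det (Matrix.of fun i : Fin (n + 1) => (Pi.single i (1 : ℝ) : Fin (n + 1) → ℝ)) = 1
  rw [← Matrix.det_one (n := Fin (n + 1)) (R := ℝ)]
  congr 1
  ext i j
  simp [Matrix.one_apply, Pi.single_apply, eq_comm]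

variable (m s : ℕ)

/-- Pull-back of a constant form on the base to the `s`-jets. -/
def ofBase {k : ℕ} (β : (Fin (n + 1) → ℝ) [⋀^Fin k]→L[ℝ] ℝ) :
    (Jet (n + 1) m s) [⋀^Fin k]→L[ℝ] ℝ :=
  β.compContinuousLinearMap (baseProj (n + 1) m s)

theorem omegaOne_eq (i : Fin (n + 1)) : omegaOne m s i = ofBase m s (baseOne i) := by
  ext v
  simp only [omegaOne, omegaZero, ofBase, baseOne, curryLeft_apply_apply,
    compContinuousLinearMap_apply]
  congr 1
  funext j
  refine Fin.cases ?_ (fun j => ?_) j <;> rfl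

theorem omegaZero_eq : omegaZero (n + 1) m s = ofBase m s (baseVolume (n + 1)) := rfl

theorem wedge_dx_ofBase {k : ℕ} (l : Fin (n + 1)) (β : (Fin (n + 1) → ℝ) [⋀^Fin k]→L[ℝ] ℝ) :
    wedgeₗ (dx m s l) (ofBase m s β) =
      ofBase m s (wedgeₗ (ContinuousLinearMap.proj l : (Fin (n + 1) → ℝ) →L[ℝ] ℝ) β) :=
  (wedgeₗ_compContinuousLinearMap _ β (baseProj (n + 1) m s)).symm

theorem wedge_dx_omegaOne (l i : Fin (n + 1)) :
    wedgeₗ (dx m s l) (omegaOne m s i) = if l = i then omegaZero (n + 1) m s else 0 := by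
  rw [omegaOne_eq, wedge_dx_ofBase, wedge_proj_baseOne]
  split_ifs <;> rfl

/-- `ω_{ij}`, the interior product of `∂_j` and `ω_i`. -/
def omegaTwo (i j : Fin (n + 2)) : (Jet (n + 2) m s) [⋀^Fin n]→L[ℝ] ℝ :=
  ofBase m s (baseTwo i j)

theorem wedge_dx_omegaTwo (l i j : Fin (n + 2)) :
    wedgeₗ (dx m s l) (omegaTwo m s i j) =
      (if l = j then omegaOne m s i else 0) - if l = i then omegaOne m s j else 0 := by
  rw [omegaTwo, wedge_dx_ofBase, wedge_proj_baseTwo, omegaOne_eq, omegaOne_eq]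
  split_ifs <;> rfl

end base

end

section


set_option maxSynthPendingDepth 3

open ContinuousAlternatingMap (compContinuousLinearMap_apply)

variable {m : ℕ}

/-! ### Horizontal and contact parts of covectors and forms on jets -/

section covectors

variable {N : ℕ}

theorem horVec_apply {s S : ℕ} (h : s + 1 ≤ S) (z v : Jet N m S) :
    horVec h z v = ∑ i, v.1 i • formalVector h i z := by
  simp only [horVec, _root_.sum_apply]
  rfl

theorem comp_horVec {s S : ℕ} (h : s + 1 ≤ S) (z : Jet N m S) (θ : Jet N m s →L[ℝ] ℝ) :
    θ ∘L horVec h z = ∑ i, θ (formalVector h i z) • dx m S i := by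
  refine ContinuousLinearMap.ext fun v => ?_
  rw [ContinuousLinearMap.comp_apply, horVec_apply, map_sum, _root_.sum_apply]
  refine Finset.sum_congr rfl fun i _ => ?_
  rw [map_smul, smul_eq_mul, mul_comm]
  rfl

theorem baseProj_comp_horVec {s S : ℕ} (h : s + 1 ≤ S) (z : Jet N m S) :
    baseProj N m s ∘L horVec h z = baseProj N m S := by
  refine ContinuousLinearMap.ext fun v => ?_
  rw [ContinuousLinearMap.comp_apply, horVec_apply, map_sum]
  change ∑ i, v.1 i • (Pi.single i 1 : Fin N → ℝ) = v.1
  funext j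
  simp [Finset.sum_apply, Pi.single_apply]

theorem baseProj_comp_jetProj {s S : ℕ} (h : s ≤ S) :
    baseProj N m s ∘L jetProj h = baseProj N m S := rfl

theorem baseProj_comp_conVec {s S : ℕ} (h : s + 1 ≤ S) (z : Jet N m S) :
    baseProj N m s ∘L conVec h z = 0 := by
  rw [conVec, ContinuousLinearMap.comp_sub, baseProj_comp_horVec, baseProj_comp_jetProj, sub_self]

theorem comp_jetProj_eq {s S : ℕ} (h : s + 1 ≤ S) (z : Jet N m S) (θ : Jet N m s →L[ℝ] ℝ) :
    θ ∘L jetProj ((Nat.le_succ s).trans h) = θ ∘L conVec h z + θ ∘L horVec h z := by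
  rw [conVec, ContinuousLinearMap.comp_sub, sub_add_cancel]

theorem jetCoord_apply {s : ℕ} {J : Multiset (Fin N)} (hJ : J.card ≤ s) (σ : Fin m)
    (v : Jet N m s) : jetCoord s J σ v = v.2 ⟨J, hJ⟩ σ := by
  rw [jetCoord, dif_pos hJ]
  rfl

theorem jetCoord_eq_extend {s : ℕ} (J : Multiset (Fin N)) (σ : Fin m)
    (v : Jet N m s) : jetCoord s J σ v = (extend v).2 J σ := by
  rw [jetCoord]
  by_cases hJ : J.card ≤ s
  · simp [extend, hJ]
  · simp [extend, hJ]

theorem jetCoord_comp_jetProj {s S : ℕ} (h : s ≤ S) {J : Multiset (Fin N)} (hJ : J.card ≤ s)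
    (σ : Fin m) : jetCoord s J σ ∘L jetProj h = jetCoord S J σ := by
  refine ContinuousLinearMap.ext fun v => ?_
  rw [ContinuousLinearMap.comp_apply, jetCoord_apply hJ, jetCoord_apply (hJ.trans h)]
  rfl

theorem jetCoord_jetProj {s S : ℕ} (h : s ≤ S) {J : Multiset (Fin N)} (hJ : J.card ≤ s)
    (σ : Fin m) (z : Jet N m S) : jetCoord s J σ (jetProj h z) = jetCoord S J σ z :=
  DFunLike.congr_fun (jetCoord_comp_jetProj h hJ σ) z

theorem jetCoord_formalVector {s S : ℕ} (h : s + 1 ≤ S) {J : Multiset (Fin N)} (hJ : J.card ≤ s)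
    (σ : Fin m) (i : Fin N) (z : Jet N m S) :
    jetCoord s J σ (formalVector h i z) = jetCoord S (i ::ₘ J) σ z := by
  rw [jetCoord_apply hJ, jetCoord_apply (by rw [Multiset.card_cons]; omega)]
  rfl

theorem jetCoord_comp_horVec {s S : ℕ} (h : s + 1 ≤ S) {J : Multiset (Fin N)} (hJ : J.card ≤ s)
    (σ : Fin m) (z : Jet N m S) :
    jetCoord s J σ ∘L horVec h z = ∑ i, jetCoord S (i ::ₘ J) σ z • dx m S i := by
  rw [comp_horVec]
  exact Finset.sum_congr rfl fun i _ => by rw [jetCoord_formalVector h hJ]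

theorem jetCoord_comp_conVec {s S : ℕ} (h : s + 1 ≤ S) {J : Multiset (Fin N)} (hJ : J.card ≤ s)
    (σ : Fin m) (z : Jet N m S) : jetCoord s J σ ∘L conVec h z = contactForm S J σ z := by
  rw [conVec, ContinuousLinearMap.comp_sub, jetCoord_comp_horVec h hJ, jetCoord_comp_jetProj _ hJ]
  rfl

theorem dx_comp_jetProj {s S : ℕ} (h : s ≤ S) (i : Fin N) : dx m s i ∘L jetProj h = dx m S i := rfl

theorem contactForm_comp_jetProj {s S : ℕ} (h : s ≤ S) {J : Multiset (Fin N)} (hJ : J.card < s)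
    (σ : Fin m) (z : Jet N m S) :
    contactForm s J σ (jetProj h z) ∘L jetProj h = contactForm S J σ z := by
  rw [contactForm, ContinuousLinearMap.sub_comp, jetCoord_comp_jetProj h hJ.le, contactForm,
    ContinuousLinearMap.finsetSum_comp]
  congr 1
  refine Finset.sum_congr rfl fun i _ => ?_
  rw [ContinuousLinearMap.smul_comp, dx_comp_jetProj, jetCoord_jetProj h
    (by rw [Multiset.card_cons]; omega)]

/-- Contact forms annihilate the total derivative fields. -/
theorem contactForm_comp_horVec {s S : ℕ} (h : s + 1 ≤ S) {J : Multiset (Fin N)} (hJ : J.card < s)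
    (σ : Fin m) (z : Jet N m S) :
    contactForm s J σ (jetProj ((Nat.le_succ s).trans h) z) ∘L horVec h z = 0 := by
  have hd : ∀ i, dx m s i ∘L horVec h z = dx m S i := fun i =>
    congrArg (ContinuousLinearMap.proj i ∘L ·) (baseProj_comp_horVec h z)
  rw [contactForm, ContinuousLinearMap.sub_comp, jetCoord_comp_horVec h hJ.le,
    ContinuousLinearMap.finsetSum_comp, sub_eq_zero]
  refine Finset.sum_congr rfl fun i _ => ?_
  rw [ContinuousLinearMap.smul_comp, hd, jetCoord_jetProj _ (by rw [Multiset.card_cons]; omega)]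

theorem contactForm_comp_conVec {s S : ℕ} (h : s + 1 ≤ S) {J : Multiset (Fin N)} (hJ : J.card < s)
    (σ : Fin m) (z : Jet N m S) :
    contactForm s J σ (jetProj ((Nat.le_succ s).trans h) z) ∘L conVec h z =
      contactForm S J σ z := by
  rw [conVec, ContinuousLinearMap.comp_sub, contactForm_comp_horVec h hJ,
    contactForm_comp_jetProj _ hJ, sub_zero]

theorem covector_eq_sum_of_vertical {s : ℕ} (θ : Jet N m s →L[ℝ] ℝ)
    (w : JetIndex N s → Fin m → ℝ) :
    θ (0, w) = ∑ J : JetIndex N s, ∑ σ : Fin m, w J σ * θ (fibrePartial s J.1 σ) := by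
  have : ((0, w) : Jet N m s) =
      ∑ J : JetIndex N s, ∑ σ : Fin m, w J σ • fibrePartial s J.1 σ := by
    refine Prod.ext ?_ ?_
    · simp [Prod.fst_sum, fibrePartial]
    · funext K τ
      simp only [Prod.snd_sum, Finset.sum_apply, Prod.smul_snd, Pi.smul_apply, smul_eq_mul]
      rw [Finset.sum_eq_single K, Finset.sum_eq_single τ]
      · simp [fibrePartial]
      · intro σ _ hσ
        simp [fibrePartial, Ne.symm hσ]
      · simp
      · intro J _ hJ
        have : ¬ K.1 = J.1 := fun h => hJ (Subtype.ext h.symm)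
        simp [fibrePartial, this]
      · simp
  rw [this, map_sum]
  refine Finset.sum_congr rfl fun J _ => ?_
  rw [map_sum]
  exact Finset.sum_congr rfl fun σ _ => by rw [map_smul, smul_eq_mul]

/-- Contact parts are vertical, with components `ω^σ_J(v)`. Applied to a differential this gives its
contact part `∑ ∂/∂y^σ_J ω^σ_J`. -/
theorem comp_conVec {s S : ℕ} (h : s + 1 ≤ S) (z : Jet N m S) (θ : Jet N m s →L[ℝ] ℝ) :
    θ ∘L conVec h z =
      ∑ J : JetIndex N s, ∑ σ : Fin m, θ (fibrePartial s J.1 σ) • contactForm S J.1 σ z := by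
  refine ContinuousLinearMap.ext fun v => ?_
  have hv : conVec h z v =
      (0, fun (J : JetIndex N s) σ => contactForm S J.1 σ z v) := by
    refine Prod.ext (DFunLike.congr_fun (baseProj_comp_conVec h z) v) ?_
    funext J σ
    change _ = contactForm S J.1 σ z v
    rw [← jetCoord_comp_conVec h J.2 σ z, ContinuousLinearMap.comp_apply, jetCoord_apply J.2]
  rw [ContinuousLinearMap.comp_apply, hv, covector_eq_sum_of_vertical]
  simp only [_root_.sum_apply, _root_.smul_apply, smul_eq_mul]
  exact Finset.sum_congr rfl fun J _ => Finset.sum_congr rfl fun σ _ => mul_comm _ _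

end covectors

section forms

variable {n k : ℕ}

theorem ofBase_comp_horVec {s S : ℕ} (h : s + 1 ≤ S) (z : Jet (n + 1) m S)
    (β : (Fin (n + 1) → ℝ) [⋀^Fin k]→L[ℝ] ℝ) :
    (ofBase m s β).compContinuousLinearMap (horVec h z) = ofBase m S β := by
  have := baseProj_comp_horVec h z
  ext v
  simp only [ofBase, compContinuousLinearMap_apply, ← this]
  rfl

theorem ofBase_comp_jetProj {s S : ℕ} (h : s ≤ S) (β : (Fin (n + 1) → ℝ) [⋀^Fin k]→L[ℝ] ℝ) :
    (ofBase m s β).compContinuousLinearMap (jetProj h) = ofBase m S β := rfl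

theorem contactPart_ofBase {s S : ℕ} (h : s + 1 ≤ S) (z : Jet (n + 1) m S)
    (β : (Fin (n + 1) → ℝ) [⋀^Fin k]→L[ℝ] ℝ) :
    contactPart (horVec h z) (conVec h z) (ofBase m s β) = 0 :=
  contactPart_comp_of_comp_eq_zero _ _ _ (baseProj_comp_conVec h z) β

theorem contactOne_eq {N s k : ℕ} (ρ : JetForm N m s k) (z : Jet N m (s + 1)) :
    contactOne ρ z = contactPart (horVec le_rfl z) (conVec le_rfl z) (ρ (jetProj (Nat.le_succ s) z)) :=
  rfl

theorem contactPart_wedge_ofBase {s S : ℕ} (h : s + 1 ≤ S) (z : Jet (n + 1) m S)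
    (θ : Jet (n + 1) m s →L[ℝ] ℝ) (β : (Fin (n + 1) → ℝ) [⋀^Fin k]→L[ℝ] ℝ) :
    contactPart (horVec h z) (conVec h z) (wedgeₗ θ (ofBase m s β)) =
      wedgeₗ (θ ∘L conVec h z) (ofBase m S β) := by
  rw [contactPart_wedgeₗ, contactPart_ofBase, ofBase_comp_horVec, _root_.map_zero, add_zero]

theorem contactPart_contactForm_wedge {s S : ℕ} (h : s + 1 ≤ S) (z : Jet (n + 1) m S)
    {J : Multiset (Fin (n + 1))} (hJ : J.card < s) (σ : Fin m)
    (β : (Fin (n + 1) → ℝ) [⋀^Fin k]→L[ℝ] ℝ) :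
    contactPart (horVec h z) (conVec h z)
        (wedgeₗ (contactForm s J σ (jetProj ((Nat.le_succ s).trans h) z)) (ofBase m s β)) =
      wedgeₗ (contactForm S J σ z) (ofBase m S β) := by
  rw [contactPart_wedge_ofBase, contactForm_comp_conVec h hJ]

theorem contactForm_wedge_comp_jetProj {s S : ℕ} (h : s ≤ S) (z : Jet (n + 1) m S)
    {J : Multiset (Fin (n + 1))} (hJ : J.card < s) (σ : Fin m)
    (β : (Fin (n + 1) → ℝ) [⋀^Fin k]→L[ℝ] ℝ) :
    (wedgeₗ (contactForm s J σ (jetProj h z)) (ofBase m s β)).compContinuousLinearMap (jetProj h) =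
      wedgeₗ (contactForm S J σ z) (ofBase m S β) := by
  rw [wedgeₗ_compContinuousLinearMap, contactForm_comp_jetProj h hJ, ofBase_comp_jetProj]

theorem contactForm_wedge_omegaTwo {s : ℕ} (J : Multiset (Fin (n + 2))) (σ : Fin m)
    (i j : Fin (n + 2)) (z : Jet (n + 2) m s) :
    wedgeₗ (contactForm s J σ z) (omegaTwo m s i j) =
      wedgeₗ (jetCoord s J σ) (omegaTwo m s i j) - jetCoord s (j ::ₘ J) σ z • omegaOne m s i +
        jetCoord s (i ::ₘ J) σ z • omegaOne m s j := by
  rw [contactForm, map_sub, LinearMap.sub_apply, map_sum, LinearMap.sum_apply]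
  simp only [map_smul, LinearMap.smul_apply, wedge_dx_omegaTwo, smul_sub, smul_ite, smul_zero,
    Finset.sum_sub_distrib, Finset.sum_ite_eq', Finset.mem_univ, if_true]
  abel

/-- Expanding the contact form leaves functions times constant-coefficient forms, for which `d(gC) =
dg ∧ C`. -/
theorem extDeriv_contactForm_wedge {s : ℕ} {b : Jet (n + 2) m s → ℝ} {w₀ : Jet (n + 2) m s}
    (hb : DifferentiableAt ℝ b w₀) (J : Multiset (Fin (n + 2))) (σ : Fin m) (i j : Fin (n + 2)) :
    extDeriv (fun w => b w • wedgeₗ (contactForm s J σ w) (omegaTwo m s i j)) w₀ =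
      wedgeₗ (fderiv ℝ b w₀) (wedgeₗ (jetCoord s J σ) (omegaTwo m s i j)) -
        wedgeₗ (b w₀ • jetCoord s (j ::ₘ J) σ + jetCoord s (j ::ₘ J) σ w₀ • fderiv ℝ b w₀)
          (omegaOne m s i) +
        wedgeₗ (b w₀ • jetCoord s (i ::ₘ J) σ + jetCoord s (i ::ₘ J) σ w₀ • fderiv ℝ b w₀)
          (omegaOne m s j) := by
  have hlin : ∀ K : Multiset (Fin (n + 2)), DifferentiableAt ℝ (fun w => jetCoord s K σ w) w₀ :=
    fun K => (jetCoord s K σ).differentiableAt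
  have h1 : (fun w => b w • wedgeₗ (contactForm s J σ w) (omegaTwo m s i j)) =
      (fun w => b w • wedgeₗ (jetCoord s J σ) (omegaTwo m s i j)) +
      (-1 : ℝ) • (fun w => (b w * jetCoord s (j ::ₘ J) σ w) • omegaOne m s i) +
      (fun w => (b w * jetCoord s (i ::ₘ J) σ w) • omegaOne m s j) := by
    funext w
    simp only [Pi.add_apply, Pi.smul_apply]
    rw [contactForm_wedge_omegaTwo]
    module
  have hm : ∀ K : Multiset (Fin (n + 2)),
      DifferentiableAt ℝ (fun w => b w * jetCoord s K σ w) w₀ := fun K => hb.mul (hlin K)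
  have hd : ∀ (K : Multiset (Fin (n + 2))), fderiv ℝ (fun w => b w * jetCoord s K σ w) w₀ =
      b w₀ • jetCoord s K σ + jetCoord s K σ w₀ • fderiv ℝ b w₀ := by
    intro K
    rw [fderiv_fun_mul hb (hlin K), ContinuousLinearMap.fderiv]
  rw [h1, extDeriv_add, extDeriv_add, extDeriv_smul, extDeriv_smul_const hb,
    extDeriv_smul_const (hm _), extDeriv_smul_const (hm _), hd, hd]
  · module
  · exact hb.smul_const _
  · exact ((hm _).smul_const _).const_smul _
  · exact (hb.smul_const _).add (((hm _).smul_const _).const_smul _)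
  · exact (hm _).smul_const _

-- In `p₁(db ∧ dy_J ∧ ω_{ij})` either `db` or `dy_J` contributes its contact part. The terms
-- containing the contact part of `db` cancel against the products `y_{Ji} db` and `y_{Jj} db` from
-- the other two summands. What is left are the total derivatives of `b` and the contact forms with
-- one more index.
set_option maxHeartbeats 800000 in
theorem contactOne_extDeriv_contactForm_wedge {s : ℕ} {b : Jet (n + 2) m s → ℝ}
    {z : Jet (n + 2) m (s + 1)} (hb : DifferentiableAt ℝ b (jetProj (Nat.le_succ s) z))
    {J : Multiset (Fin (n + 2))} (hJ : J.card < s) (σ : Fin m) (i j : Fin (n + 2)) :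
    contactOne (extDeriv fun w => b w • wedgeₗ (contactForm s J σ w) (omegaTwo m s i j)) z =
      wedgeₗ (totalDeriv i b z • contactForm (s + 1) J σ z +
          b (jetProj (Nat.le_succ s) z) • contactForm (s + 1) (i ::ₘ J) σ z)
        (omegaOne m (s + 1) j) -
      wedgeₗ (totalDeriv j b z • contactForm (s + 1) J σ z +
          b (jetProj (Nat.le_succ s) z) • contactForm (s + 1) (j ::ₘ J) σ z)
        (omegaOne m (s + 1) i) := by
  set w₀ := jetProj (Nat.le_succ s) z with hw₀
  have hcard : ∀ i : Fin (n + 2), (i ::ₘ J).card ≤ s := fun i => by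
    rw [Multiset.card_cons]; omega
  have hext : extDeriv (fun w => b w • wedgeₗ (contactForm s J σ w) (omegaTwo m s i j)) w₀ =
      wedgeₗ (fderiv ℝ b w₀) (wedgeₗ (jetCoord s J σ) (omegaTwo m s i j)) -
        wedgeₗ (b w₀ • jetCoord s (j ::ₘ J) σ + jetCoord s (j ::ₘ J) σ w₀ • fderiv ℝ b w₀)
          (omegaOne m s i) +
        wedgeₗ (b w₀ • jetCoord s (i ::ₘ J) σ + jetCoord s (i ::ₘ J) σ w₀ • fderiv ℝ b w₀)
          (omegaOne m s j) :=
    extDeriv_contactForm_wedge hb J σ i j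
  have hhor : fderiv ℝ b w₀ ∘L horVec le_rfl z = ∑ l, totalDeriv l b z • dx m (s + 1) l :=
    comp_horVec _ _ _
  rw [contactOne_eq, ← hw₀, hext]
  simp only [map_add, map_sub, map_smul, LinearMap.add_apply, LinearMap.smul_apply]
  rw [contactPart_wedgeₗ, wedgeₗ_compContinuousLinearMap, hhor, jetCoord_comp_horVec _ hJ.le]
  simp only [omegaTwo, omegaOne_eq, contactPart_wedge_ofBase, ofBase_comp_horVec]
  rw [jetCoord_comp_conVec _ hJ.le, jetCoord_comp_conVec _ (hcard i), jetCoord_comp_conVec _ (hcard j),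
    map_sum, LinearMap.sum_apply, map_sum, map_sum, LinearMap.sum_apply, jetCoord_jetProj _ (hcard _),
    jetCoord_jetProj _ (hcard _)]
  have h2 : ∀ l, wedgeₗ (dx m (s + 1) l) (ofBase m (s + 1) (baseTwo i j)) =
      (if l = j then ofBase m (s + 1) (baseOne i) else 0) -
        if l = i then ofBase m (s + 1) (baseOne j) else 0 := by
    intro l
    rw [← omegaOne_eq, ← omegaOne_eq]
    exact wedge_dx_omegaTwo m (s + 1) l i j
  have h3 : ∀ l, wedgeₗ (dx m (s + 1) l)
      (wedgeₗ (contactForm (s + 1) J σ z) (ofBase m (s + 1) (baseTwo i j))) =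
      -wedgeₗ (contactForm (s + 1) J σ z) ((if l = j then ofBase m (s + 1) (baseOne i) else 0) -
        if l = i then ofBase m (s + 1) (baseOne j) else 0) := by
    intro l
    rw [wedgeₗ_comm, h2]
  simp only [map_smul, LinearMap.smul_apply, h2, h3, map_sub,
    smul_sub, smul_ite, smul_zero, apply_ite (wedgeₗ _), _root_.map_zero,
    Finset.sum_sub_distrib, Finset.sum_ite_eq', Finset.mem_univ, if_true, neg_sub]
  module

end forms

end

section


open MeasureTheory Filter Topology Set

/-! ### Smooth dependence of integrals on parameters -/

section parametric

variable {E G : Type} [NormedAddCommGroup E] [NormedSpace ℝ E] [NormedAddCommGroup G]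
  [NormedSpace ℝ G] {Ω : Set (ℝ × E)} {W : Set E}

-- Tube lemma around the compact segment `[0,1] × {z}`. It supplies the bound, uniform near `z`,
-- needed for dominated convergence and for differentiation under the integral.
omit [NormedSpace ℝ E] in
theorem exists_bound_near_segment {X : Type} [NormedAddCommGroup X] (hΩ : IsOpen Ω)
    {g : ℝ × E → X} (hg : ContinuousOn g Ω) {z : E} (hz : ∀ t ∈ Icc (0 : ℝ) 1, (t, z) ∈ Ω) :
    ∃ C : ℝ, ∃ v ∈ 𝓝 z, ∀ t ∈ Icc (0 : ℝ) 1, ∀ x ∈ v, (t, x) ∈ Ω ∧ ‖g (t, x)‖ ≤ C := by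
  have hK : IsCompact (Icc (0 : ℝ) 1 ×ˢ ({z} : Set E)) := isCompact_Icc.prod isCompact_singleton
  have hKΩ : Icc (0 : ℝ) 1 ×ˢ ({z} : Set E) ⊆ Ω := by
    rintro ⟨t, x⟩ ⟨ht, hx⟩
    obtain rfl : x = z := hx
    exact hz t ht
  obtain ⟨C, hC⟩ := hK.exists_bound_of_continuousOn (hg.mono hKΩ)
  have hopen : IsOpen (Ω ∩ (fun p => ‖g p‖) ⁻¹' Iio (C + 1)) :=
    hg.norm.isOpen_inter_preimage hΩ isOpen_Iio
  obtain ⟨u, v, -, hv, hu', hv', huv⟩ := generalized_tube_lemma isCompact_Icc isCompact_singleton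
    hopen (fun p hp => ⟨hKΩ hp, lt_of_le_of_lt (hC p hp) (lt_add_one C)⟩)
  refine ⟨C + 1, v, hv.mem_nhds (hv' rfl), fun t ht x hx => ?_⟩
  have := huv (mk_mem_prod (hu' ht) hx)
  exact ⟨this.1, le_of_lt this.2⟩

omit [NormedSpace ℝ E] in
theorem continuousOn_slice {X : Type} [NormedAddCommGroup X] {g : ℝ × E → X}
    (hg : ContinuousOn g Ω) {z : E} (hz : ∀ t ∈ Icc (0 : ℝ) 1, (t, z) ∈ Ω) :
    ContinuousOn (fun t => g (t, z)) (uIcc 0 1) := by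
  rw [uIcc_of_le zero_le_one]
  exact hg.comp (by fun_prop) hz

omit [NormedSpace ℝ E] in
theorem aestronglyMeasurable_slice {X : Type} [NormedAddCommGroup X] {g : ℝ × E → X}
    (hg : ContinuousOn g Ω) {z : E} (hz : ∀ t ∈ Icc (0 : ℝ) 1, (t, z) ∈ Ω) :
    AEStronglyMeasurable (fun t => g (t, z)) (volume.restrict (uIoc 0 1)) :=
  ((continuousOn_slice hg hz).mono uIoc_subset_uIcc).aestronglyMeasurable measurableSet_uIoc

theorem mem_Icc_of_mem_uIoc {t : ℝ} (ht : t ∈ uIoc (0 : ℝ) 1) : t ∈ Icc (0 : ℝ) 1 := by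
  rw [uIoc_of_le zero_le_one] at ht
  exact ⟨ht.1.le, ht.2⟩

omit [NormedSpace ℝ E] in
theorem continuousOn_parametric_integral (hΩ : IsOpen Ω)
    (hΩW : ∀ z ∈ W, ∀ t ∈ Icc (0 : ℝ) 1, (t, z) ∈ Ω) {f : ℝ × E → G} (hf : ContinuousOn f Ω) :
    ContinuousOn (fun z => ∫ t in (0 : ℝ)..1, f (t, z)) W := by
  intro z hz
  obtain ⟨C, v, hv, hCv⟩ := exists_bound_near_segment hΩ hf (hΩW z hz)
  refine ContinuousAt.continuousWithinAt ?_
  refine intervalIntegral.continuousAt_of_dominated_interval (bound := fun _ => C) ?_ ?_ ?_ ?_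
  · filter_upwards [hv] with x hx
    exact aestronglyMeasurable_slice hf fun t ht => (hCv t ht x hx).1
  · filter_upwards [hv] with x hx
    exact ae_of_all _ fun t ht => (hCv t (mem_Icc_of_mem_uIoc ht) x hx).2
  · exact intervalIntegrable_const
  · refine ae_of_all _ fun t ht => ?_
    have h1 : ContinuousAt f (t, z) := hf.continuousAt
      (hΩ.mem_nhds (hΩW z hz t (mem_Icc_of_mem_uIoc ht)))
    exact h1.comp (by fun_prop)

theorem hasFDerivAt_parametric_integral (hΩ : IsOpen Ω)
    (hΩW : ∀ z ∈ W, ∀ t ∈ Icc (0 : ℝ) 1, (t, z) ∈ Ω) {f : ℝ × E → G} (hf : ContDiffOn ℝ 1 f Ω)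
    {z : E} (hz : z ∈ W) :
    HasFDerivAt (fun z => ∫ t in (0 : ℝ)..1, f (t, z))
      (∫ t in (0 : ℝ)..1, (fderiv ℝ f (t, z)) ∘L ContinuousLinearMap.inr ℝ ℝ E) z := by
  have hf' : ContinuousOn (fun p => (fderiv ℝ f p) ∘L ContinuousLinearMap.inr ℝ ℝ E) Ω :=
    (hf.continuousOn_fderiv_of_isOpen hΩ le_rfl).clm_comp continuousOn_const
  obtain ⟨C, v, hv, hCv⟩ := exists_bound_near_segment hΩ hf' (hΩW z hz)
  refine intervalIntegral.hasFDerivAt_integral_of_dominated_of_fderiv_le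
    (F' := fun z t => (fderiv ℝ f (t, z)) ∘L ContinuousLinearMap.inr ℝ ℝ E)
    (bound := fun _ => C) hv ?_ ?_ ?_ ?_ ?_ ?_
  · filter_upwards [hv] with x hx
    exact aestronglyMeasurable_slice hf.continuousOn fun t ht => (hCv t ht x hx).1
  · exact (continuousOn_slice hf.continuousOn (hΩW z hz)).intervalIntegrable
  · exact aestronglyMeasurable_slice hf' (hΩW z hz)
  · exact ae_of_all _ fun t ht x hx => (hCv t (mem_Icc_of_mem_uIoc ht) x hx).2
  · exact intervalIntegrable_const
  · refine ae_of_all _ fun t ht x hx => ?_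
    have h1 : HasFDerivAt f (fderiv ℝ f (t, x)) (t, x) :=
      ((hf.contDiffAt (hΩ.mem_nhds (hCv t (mem_Icc_of_mem_uIoc ht) x hx).1)).differentiableAt
        one_ne_zero).hasFDerivAt
    exact h1.comp x (hasFDerivAt_prodMk_right t x)

/-- The target space varies in the induction, because the derivative takes values in `E →L[ℝ] G`. -/
theorem contDiffOn_nat_parametric_integral (hΩ : IsOpen Ω) (hW : IsOpen W)
    (hΩW : ∀ z ∈ W, ∀ t ∈ Icc (0 : ℝ) 1, (t, z) ∈ Ω) (k : ℕ) :
    ∀ {G : Type} [NormedAddCommGroup G] [NormedSpace ℝ G] {f : ℝ × E → G},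
    ContDiffOn ℝ k f Ω → ContDiffOn ℝ k (fun z => ∫ t in (0 : ℝ)..1, f (t, z)) W := by
  induction k with
  | zero =>
    intro G _ _ f hf
    exact contDiffOn_zero.2 (continuousOn_parametric_integral hΩ hΩW hf.continuousOn)
  | succ k ih =>
    intro G _ _ f hf
    have h1 : ContDiffOn ℝ 1 f Ω := hf.of_le (by exact_mod_cast Nat.le_add_left 1 k)
    push_cast at hf ⊢
    rw [contDiffOn_succ_iff_fderiv_of_isOpen hW]
    refine ⟨fun z hz => (hasFDerivAt_parametric_integral hΩ hΩW h1 hz).differentiableAt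
      |>.differentiableWithinAt, by simp, ?_⟩
    have h2 : ContDiffOn ℝ k (fun p => (fderiv ℝ f p) ∘L ContinuousLinearMap.inr ℝ ℝ E) Ω :=
      (hf.fderiv_of_isOpen hΩ le_rfl).clm_comp contDiffOn_const
    exact (ih h2).congr fun z hz => (hasFDerivAt_parametric_integral hΩ hΩW h1 hz).fderiv

theorem contDiffOn_parametric_integral (hΩ : IsOpen Ω) (hW : IsOpen W)
    (hΩW : ∀ z ∈ W, ∀ t ∈ Icc (0 : ℝ) 1, (t, z) ∈ Ω) {f : ℝ × E → G} (hf : ContDiffOn ℝ ∞ f Ω) :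
    ContDiffOn ℝ ∞ (fun z => ∫ t in (0 : ℝ)..1, f (t, z)) W :=
  contDiffOn_infty.2 fun k =>
    contDiffOn_nat_parametric_integral hΩ hW hΩW k (contDiffOn_infty.1 hf k)

theorem fderiv_parametric_integral_apply [CompleteSpace G] (hΩ : IsOpen Ω)
    (hΩW : ∀ z ∈ W, ∀ t ∈ Icc (0 : ℝ) 1, (t, z) ∈ Ω) {f : ℝ × E → G} (hf : ContDiffOn ℝ 1 f Ω)
    {z : E} (hz : z ∈ W) (v : E) :
    fderiv ℝ (fun z => ∫ t in (0 : ℝ)..1, f (t, z)) z v =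
      ∫ t in (0 : ℝ)..1, fderiv ℝ (fun z => f (t, z)) z v := by
  have hf' : ContinuousOn (fun p => (fderiv ℝ f p) ∘L ContinuousLinearMap.inr ℝ ℝ E) Ω :=
    (hf.continuousOn_fderiv_of_isOpen hΩ le_rfl).clm_comp continuousOn_const
  rw [(hasFDerivAt_parametric_integral hΩ hΩW hf hz).fderiv, ContinuousLinearMap.intervalIntegral_apply
    (continuousOn_slice hf' (hΩW z hz)).intervalIntegrable]
  refine intervalIntegral.integral_congr fun t ht => ?_
  rw [uIcc_of_le zero_le_one] at ht
  have h1 : HasFDerivAt f (fderiv ℝ f (t, z)) (t, z) :=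
    ((hf.contDiffAt (hΩ.mem_nhds (hΩW z hz t ht))).differentiableAt one_ne_zero).hasFDerivAt
  exact (DFunLike.congr_fun (h1.comp z (hasFDerivAt_prodMk_right t z)).fderiv v).symm

end parametric

end

section


set_option maxSynthPendingDepth 3

variable {m : ℕ}

/-! ### The principal Lepage equivalent and the Euler–Lagrange form in terms of momenta -/

section momenta

variable {N : ℕ} {U : Set ((Fin N → ℝ) × (Fin m → ℝ))}

theorem IsLagrangian.contDiffOn {s : ℕ} {lam : JetForm N m s N} (h : IsLagrangian U lam) :
    ContDiffOn ℝ ∞ (lagrangeFunction lam) (jetDomain U s) :=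
  (ContinuousAlternatingMap.apply ℝ (Jet N m s) ℝ (basePartial m s)).contDiff.comp_contDiffOn
    h.smooth

theorem momentum_apply_eq (hU : IsOpen U) (R : ℕ) (M : Multiset (Fin N)) (σ : Fin m)
    (f : smoothFn U) (z : InfJet N m) :
    momentum hU R M σ f z = ∑ l : Fin R, ∑ p : Fin l → Fin N,
      (-1 : ℝ) ^ (l : ℕ) * dIter hU l p (dSym hU (M + tupleIndex p) σ f) z := by
  rw [momentum_apply, smoothFn.sum_apply, Finset.sum_range]
  refine Finset.sum_congr rfl fun l _ => ?_
  rw [smoothFn.smul_apply, dIterSym, LinearMap.sum_apply, smoothFn.sum_apply, Finset.mul_sum]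
  rfl

theorem iterTotalDeriv_symPartial_eq (hU : IsOpen U) {s S l : ℕ} {g : Jet N m s → ℝ}
    (hg : ContDiffOn ℝ ∞ g (jetDomain U s)) (h : s + l ≤ S) (p : Fin l → Fin N)
    (M : Multiset (Fin N)) (σ : Fin m) {z : Jet N m S} (hz : z ∈ jetDomain U S) :
    iterTotalDeriv l p (symPartial M σ g) (jetProj h z) =
      dIter hU l p (dSym hU M σ (ofJet g hg)) (extend z) := by
  rw [← ofJet_symPartial hU hg, ← ofJet_iterTotalDeriv hU, ofJet_extend _ h hz]

theorem eulerLagrangeExpr_eq (hU : IsOpen U) {s : ℕ} {lam : JetForm N m s N}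
    (hL : ContDiffOn ℝ ∞ (lagrangeFunction lam) (jetDomain U s)) (σ : Fin m)
    {z : Jet N m (2 * s)} (hz : z ∈ jetDomain U (2 * s)) :
    eulerLagrangeExpr lam σ z =
      momentum hU (s + 1) 0 σ (ofJet (lagrangeFunction lam) hL) (extend z) := by
  rw [momentum_apply_eq, eulerLagrangeExpr]
  refine Finset.sum_congr rfl fun k _ => Finset.sum_congr rfl fun j _ => ?_
  rw [iterTotalDeriv_symPartial_eq hU hL _ _ _ _ hz, zero_add]

protected theorem HasOrder.momentum (hU : IsOpen U) {f : smoothFn U} {s : ℕ} (hf : HasOrder U f s) (R : ℕ)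
    (M : Multiset (Fin N)) (σ : Fin m) :
    HasOrder U (momentum hU (R + 1) M σ f) (s + R) := by
  rw [momentum_apply]
  refine HasOrder.sum _ fun l hl => HasOrder.smul _ ?_
  simp only [dIterSym, LinearMap.sum_apply]
  refine HasOrder.sum _ fun q _ => ?_
  have h1 : HasOrder U (dSym hU (M + tupleIndex q) σ f) s := (hf.dFib hU _ σ).smul _
  exact (h1.dIter hU l q).mono (by have := Finset.mem_range.1 hl; omega)

/-- With the cut-off reduced to `s`, at most `s - 1` total derivatives act on a function of order
`s`. -/
protected theorem HasOrder.lepageCoeff (hU : IsOpen U) {f : smoothFn U} {s : ℕ} (hf : HasOrder U f s)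
    (hs : 1 ≤ s) {R : ℕ} (hR : s ≤ R) (J : Multiset (Fin N)) (i : Fin N) (σ : Fin m) :
    HasOrder U (lepageCoeff hU R J i σ f) (2 * s - 1) := by
  rw [hf.lepageCoeff_eq hU hR le_rfl]
  obtain ⟨t, rfl⟩ : ∃ t, s = t + 1 := ⟨s - 1, by omega⟩
  exact ((hf.momentum hU t (i ::ₘ J) σ).smul _).mono (by omega)

end momenta

section lepage

variable {n : ℕ} {U : Set ((Fin (n + 1) → ℝ) × (Fin m → ℝ))}

theorem sum_comm_three {ι κ μ M : Type*} [Fintype ι] [Fintype κ] [Fintype μ] [AddCommMonoid M]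
    (ψ : ι → κ → μ → M) : ∑ a, ∑ b, ∑ c, ψ a b c = ∑ b, ∑ c, ∑ a, ψ a b c := by
  rw [Finset.sum_comm]
  exact Finset.sum_congr rfl fun _ _ => Finset.sum_comm

/-- Sums over tuples become weighted sums over multi-indices. Both cut-offs `R` and `K` are free, so
that equivalents of Lagrangians of different orders can be compared term by term. If `K` is so large
that `contactForm` meets the default value of `jetCoord`, the coefficient in front is already zero.
-/
theorem principalLepage_eq (hU : IsOpen U) {s : ℕ} (hs : 1 ≤ s)
    {lam : JetForm (n + 1) m s (n + 1)}
    (hL : ContDiffOn ℝ ∞ (lagrangeFunction lam) (jetDomain U s)) {R K : ℕ} (hR : s ≤ R)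
    (hK : s ≤ K + 1) {z : Jet (n + 1) m (2 * s - 1)} (hz : z ∈ jetDomain U (2 * s - 1)) :
    principalLepage lam z =
      ofJet (lagrangeFunction lam) hL (extend z) • omegaZero (n + 1) m (2 * s - 1) +
      ∑ J : JetIndex (n + 1) K, ∑ i : Fin (n + 1), ∑ σ : Fin m,
        lepageCoeff hU R J.1 i σ (ofJet (lagrangeFunction lam) hL) (extend z) •
          wedgeₗ (contactForm (2 * s - 1) J.1 σ z) (omegaOne m (2 * s - 1) i) := by
  set f := ofJet (lagrangeFunction lam) hL with hf
  have hfs : HasOrder U f s := hasOrder_ofJet hL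
  let W : Multiset (Fin (n + 1)) → (Jet (n + 1) m (2 * s - 1)) [⋀^Fin (n + 1)]→L[ℝ] ℝ := fun J =>
    ∑ i : Fin (n + 1), ∑ σ : Fin m, momentum hU R (i ::ₘ J) σ f (extend z) •
      wedgeₗ (contactForm (2 * s - 1) J σ z) (omegaOne m (2 * s - 1) i)
  have hW : ∀ J : Multiset (Fin (n + 1)), multinomialFactor J • W J =
      ∑ i : Fin (n + 1), ∑ σ : Fin m, lepageCoeff hU R J i σ f (extend z) •
        wedgeₗ (contactForm (2 * s - 1) J σ z) (omegaOne m (2 * s - 1) i) := by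
    intro J
    simp only [W, Finset.smul_sum, smul_smul]
    rfl
  rw [sum_jetIndex_of_le (K := s - 1) (by omega) (Φ := fun J => ∑ i : Fin (n + 1), ∑ σ : Fin m,
      lepageCoeff hU R J i σ f (extend z) •
        wedgeₗ (contactForm (2 * s - 1) J σ z) (omegaOne m (2 * s - 1) i))
    (fun J hJ => Finset.sum_eq_zero fun i _ => Finset.sum_eq_zero fun σ _ => by
      rw [hfs.lepageCoeff_eq_zero hU R (by omega), smoothFn.zero_apply, zero_smul])]
  rw [← Finset.sum_congr rfl fun (J : JetIndex (n + 1) (s - 1)) _ => hW J.1,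
    ← sum_range_tupleIndex, Nat.sub_add_cancel hs, Finset.sum_range, principalLepage,
    hf, ofJet_extend hL (by omega) hz]
  congr 1
  refine Finset.sum_congr rfl fun k _ => ?_
  rw [Finset.sum_comm]
  refine Finset.sum_congr rfl fun j _ => ?_
  simp only [W]
  have hmom : ∀ i σ, momentum hU R (i ::ₘ tupleIndex j) σ f (extend z) =
      ∑ l : Fin (s - k), ∑ p : Fin l → Fin (n + 1), (-1 : ℝ) ^ (l : ℕ) *
        dIter hU l p (dSym hU (tupleIndex j + tupleIndex p + {i}) σ f) (extend z) := by
    intro i σ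
    rw [hfs.momentum_eq hU (R := s - k) (by omega)
      (by rw [Multiset.card_cons, card_tupleIndex]; have := k.2; omega), momentum_apply_eq]
    refine Finset.sum_congr rfl fun l _ => Finset.sum_congr rfl fun p _ => ?_
    rw [add_comm (tupleIndex j + tupleIndex p), Multiset.singleton_add, Multiset.cons_add]
  simp only [hmom, Finset.sum_smul]
  have hcomm : ∀ (ψ : (l : Fin (s - k)) → (Fin l → Fin (n + 1)) → Fin (n + 1) → Fin m →
      (Jet (n + 1) m (2 * s - 1)) [⋀^Fin (n + 1)]→L[ℝ] ℝ),
      ∑ l, ∑ p, ∑ i, ∑ σ, ψ l p i σ = ∑ i, ∑ σ, ∑ l, ∑ p, ψ l p i σ := by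
    intro ψ
    rw [Finset.sum_congr rfl fun l _ => sum_comm_three (ψ l), sum_comm_three]
  rw [← hcomm]
  refine Finset.sum_congr rfl fun l _ => Finset.sum_congr rfl fun p _ =>
    Finset.sum_congr rfl fun i _ => Finset.sum_congr rfl fun σ _ => ?_
  rw [iterTotalDeriv_symPartial_eq hU hL _ _ _ _ hz]
  rfl

end lepage

end

section


set_option maxSynthPendingDepth 3

open MeasureTheory Filter Topology

variable {m : ℕ}

/-! ### The fibered homotopy operator -/

section scaling

variable {N : ℕ} {U : Set ((Fin N → ℝ) × (Fin m → ℝ))}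

theorem fibreScaling_apply {s : ℕ} (t : ℝ) (z : Jet N m s) :
    fibreScaling N m s t z = (z.1, t • z.2) := rfl

theorem VerticallyStarShaped.fibreScaling_mem (h : VerticallyStarShaped U) {s : ℕ} {z : Jet N m s}
    (hz : z ∈ jetDomain U s) {t : ℝ} (ht : t ∈ Set.Icc (0 : ℝ) 1) :
    fibreScaling N m s t z ∈ jetDomain U s := h _ hz t ht

/-- The fibre rescaling on the infinite jets. -/
def infScaling (t : ℝ) (z : InfJet N m) : InfJet N m := (z.1, t • z.2)

theorem infScaling_extend {s : ℕ} (t : ℝ) (z : Jet N m s) :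
    infScaling t (extend z) = extend (fibreScaling N m s t z) := by
  refine Prod.ext rfl ?_
  funext J σ
  by_cases h : J.card ≤ s <;> simp [infScaling, extend, fibreScaling, h]

theorem VerticallyStarShaped.infScaling_mem (h : VerticallyStarShaped U) {z : InfJet N m}
    (hz : z ∈ infDomain U) {t : ℝ} (ht : t ∈ Set.Icc (0 : ℝ) 1) :
    infScaling t z ∈ infDomain U := h _ hz t ht

theorem HasOrder.extend_fibreScaling {f : InfJet N m → ℝ} {s : ℕ} (hf : HasOrder U f s)
    (hstar : VerticallyStarShaped U) {z : InfJet N m} (hz : z ∈ infDomain U) {t : ℝ}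
    (ht : t ∈ Set.Icc (0 : ℝ) 1) :
    f (extend (fibreScaling N m s t (trunc s z))) = f (infScaling t z) :=
  (hf.2 _ (hstar.infScaling_mem hz ht)).symm

/-- Pairs `(t, z)` with `χ(t, z)` in the domain. -/
def scalingDomain (U : Set ((Fin N → ℝ) × (Fin m → ℝ))) (s : ℕ) : Set (ℝ × Jet N m s) :=
  (fun p => fibreScaling N m s p.1 p.2) ⁻¹' jetDomain U s

theorem contDiff_fibreScaling {s : ℕ} :
    ContDiff ℝ ∞ fun p : ℝ × Jet N m s => fibreScaling N m s p.1 p.2 := by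
  simp only [fibreScaling_apply]
  fun_prop

theorem isOpen_scalingDomain (hU : IsOpen U) (s : ℕ) : IsOpen (scalingDomain U s) :=
  (isOpen_jetDomain hU s).preimage contDiff_fibreScaling.continuous

theorem HasOrder.contDiffOn_scaling {f : InfJet N m → ℝ} {s : ℕ} (hf : HasOrder U f s) :
    ContDiffOn ℝ ∞ (fun p : ℝ × Jet N m s => f (extend (fibreScaling N m s p.1 p.2)))
      (scalingDomain U s) :=
  hf.1.comp contDiff_fibreScaling.contDiffOn fun _ hp => hp

end scaling

/-! ### The first variation formula integrated along the fibre rescaling -/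

section homotopy

variable {N : ℕ} {U : Set ((Fin N → ℝ) × (Fin m → ℝ))}

/-- The integrand of `homotopyCoeff`. -/
def homotopyIntegrand (hU : IsOpen U) (f : smoothFn U) (s : ℕ) (i : Fin N)
    (p : ℝ × Jet N m (2 * s - 1)) : ℝ :=
  ∑ J : JetIndex N (s - 1), ∑ σ : Fin m,
    lepageCoeff hU (s + 1) J.1 i σ f (extend (fibreScaling N m (2 * s - 1) p.1 p.2)) *
      jetCoord (2 * s - 1) J.1 σ p.2

/-- The coefficient of `ω_i` in the image of the principal Lepage equivalent under the fibered
homotopy operator. -/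
def homotopyCoeff (hU : IsOpen U) (f : smoothFn U) (s : ℕ) (i : Fin N)
    (z : Jet N m (2 * s - 1)) : ℝ :=
  ∫ t in (0 : ℝ)..1, homotopyIntegrand hU f s i (t, z)

variable {s : ℕ} {f : smoothFn U}

theorem HasOrder.contDiffOn_homotopyIntegrand (hU : IsOpen U) (hs : 1 ≤ s) (hf : HasOrder U f s)
    (i : Fin N) : ContDiffOn ℝ ∞ (homotopyIntegrand hU f s i) (scalingDomain U (2 * s - 1)) := by
  refine ContDiffOn.sum fun J _ => ContDiffOn.sum fun σ _ => ContDiffOn.mul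
    (hf.lepageCoeff hU hs (Nat.le_succ s) J.1 i σ).contDiffOn_scaling ?_
  exact ((jetCoord (2 * s - 1) J.1 σ).contDiff.comp contDiff_snd).contDiffOn

theorem mem_scalingDomain (hstar : VerticallyStarShaped U) {S : ℕ} :
    ∀ z ∈ jetDomain U S, ∀ t ∈ Set.Icc (0 : ℝ) 1, (t, z) ∈ scalingDomain U S :=
  fun _ hz _ ht => hstar.fibreScaling_mem hz ht

theorem HasOrder.contDiffOn_homotopyCoeff (hU : IsOpen U) (hstar : VerticallyStarShaped U)
    (hs : 1 ≤ s) (hf : HasOrder U f s) (i : Fin N) :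
    ContDiffOn ℝ ∞ (homotopyCoeff hU f s i) (jetDomain U (2 * s - 1)) :=
  contDiffOn_parametric_integral (isOpen_scalingDomain hU _) (isOpen_jetDomain hU _)
    (mem_scalingDomain hstar) (hf.contDiffOn_homotopyIntegrand hU hs i)

theorem HasOrder.intervalIntegrable_homotopyIntegrand (hU : IsOpen U)
    (hstar : VerticallyStarShaped U) (hs : 1 ≤ s) (hf : HasOrder U f s) (i : Fin N)
    {z : Jet N m (2 * s - 1)} (hz : z ∈ jetDomain U (2 * s - 1)) :
    IntervalIntegrable (fun t => homotopyIntegrand hU f s i (t, z)) volume 0 1 :=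
  (continuousOn_slice (hf.contDiffOn_homotopyIntegrand hU hs i).continuousOn
    (mem_scalingDomain hstar z hz)).intervalIntegrable

/-- The derivative of `homotopyIntegrand` along the total derivative field. -/
def homotopyTotalIntegrand (hU : IsOpen U) (f : smoothFn U) (s : ℕ) (i : Fin N) (z : InfJet N m)
    (t : ℝ) : ℝ :=
  ∑ J : JetIndex N (s - 1), ∑ σ : Fin m,
    (dTot hU i (lepageCoeff hU (s + 1) J.1 i σ f) (infScaling t z) * z.2 J.1 σ +
      lepageCoeff hU (s + 1) J.1 i σ f (infScaling t z) * z.2 (i ::ₘ J.1) σ)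

/-- The rescaling maps the total derivative field at `z` to the one at the rescaled point, so the
chain rule produces `d_i` of the coefficient evaluated there, without any factor `t`. The other
factor contributes `d_i y^σ_J = y^σ_{Ji}`. -/
theorem HasOrder.fderiv_homotopyIntegrand (hU : IsOpen U) (hstar : VerticallyStarShaped U)
    (hs : 1 ≤ s) (hf : HasOrder U f s) (i : Fin N) {z : InfJet N m} (hz : z ∈ infDomain U) {t : ℝ}
    (ht : t ∈ Set.Icc (0 : ℝ) 1) :
    fderiv ℝ (fun w => homotopyIntegrand hU f s i (t, w)) (trunc (2 * s - 1) z)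
      (trunc (2 * s - 1) (totalField i z)) = homotopyTotalIntegrand hU f s i z t := by
  have hmem := hstar.infScaling_mem hz ht
  have hcoeff : ∀ (J : JetIndex N (s - 1)) (σ : Fin m), HasFDerivAt
      (fun w : Jet N m (2 * s - 1) =>
        lepageCoeff hU (s + 1) J.1 i σ f (extend (fibreScaling N m (2 * s - 1) t w)))
      ((fderiv ℝ (fun w : Jet N m (2 * s - 1) => lepageCoeff hU (s + 1) J.1 i σ f (extend w))
        (fibreScaling N m (2 * s - 1) t (trunc (2 * s - 1) z))) ∘L fibreScaling N m (2 * s - 1) t)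
      (trunc (2 * s - 1) z) := fun J σ =>
    HasFDerivAt.comp (g := fun w : Jet N m (2 * s - 1) =>
      lepageCoeff hU (s + 1) J.1 i σ f (extend w)) (trunc (2 * s - 1) z)
      ((hf.lepageCoeff hU hs (Nat.le_succ s) J.1 i σ).differentiableAt hU
        (trunc_mem_jetDomain.2 hmem)).hasFDerivAt (fibreScaling N m (2 * s - 1) t).hasFDerivAt
  have hterm := fun (J : JetIndex N (s - 1)) (σ : Fin m) =>
    (hcoeff J σ).fun_mul (jetCoord (2 * s - 1) J.1 σ).hasFDerivAt
  have hsum := HasFDerivAt.fun_sum (u := Finset.univ) fun (J : JetIndex N (s - 1)) _ =>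
    HasFDerivAt.fun_sum (u := Finset.univ) fun (σ : Fin m) _ => hterm J σ
  refine (DFunLike.congr_fun hsum.fderiv _).trans ?_
  simp only [_root_.sum_apply, homotopyTotalIntegrand]
  refine Finset.sum_congr rfl fun J _ => Finset.sum_congr rfl fun σ _ => ?_
  have hJ : J.1.card ≤ 2 * s - 1 := by have := J.2; omega
  have hord := hf.lepageCoeff hU hs (Nat.le_succ s) J.1 i σ
  rw [dTot_apply hU i _ hmem, hord.lineDeriv_eq hU hmem, hord.2 _ hmem]
  simp only [_root_.add_apply, _root_.smul_apply, smul_eq_mul, ContinuousLinearMap.comp_apply,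
    jetCoord_apply hJ]
  rw [add_comm, mul_comm]
  congr 1

theorem HasOrder.dTot_homotopyCoeff (hU : IsOpen U) (hstar : VerticallyStarShaped U)
    (hs : 1 ≤ s) (hf : HasOrder U f s) (i : Fin N) {z : InfJet N m} (hz : z ∈ infDomain U) :
    dTot hU i (ofJet (homotopyCoeff hU f s i) (hf.contDiffOn_homotopyCoeff hU hstar hs i)) z =
      ∫ t in (0 : ℝ)..1, homotopyTotalIntegrand hU f s i z t := by
  rw [dTot_ofJet_apply _ hU i hz]
  refine (fderiv_parametric_integral_apply (isOpen_scalingDomain hU _) (mem_scalingDomain hstar)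
    ((hf.contDiffOn_homotopyIntegrand hU hs i).of_le (by simp)) (trunc_mem_jetDomain.2 hz)
    _).trans ?_
  refine intervalIntegral.integral_congr fun t ht => ?_
  rw [Set.uIcc_of_le zero_le_one] at ht
  exact hf.fderiv_homotopyIntegrand hU hstar hs i hz ht

theorem HasOrder.continuousOn_infScaling {g : InfJet N m → ℝ} {S : ℕ} (hg : HasOrder U g S)
    (hstar : VerticallyStarShaped U) {z : InfJet N m} (hz : z ∈ infDomain U) :
    ContinuousOn (fun t : ℝ => g (infScaling t z)) (Set.uIcc 0 1) := by
  refine (continuousOn_slice hg.contDiffOn_scaling.continuousOn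
    (mem_scalingDomain hstar (trunc S z) (trunc_mem_jetDomain.2 hz))).congr fun t ht => ?_
  rw [Set.uIcc_of_le zero_le_one] at ht
  exact (hg.extend_fibreScaling hstar hz ht).symm

/-- Fundamental theorem of calculus along the fibre rescaling. -/
theorem HasOrder.integral_dFib (hU : IsOpen U) (hstar : VerticallyStarShaped U)
    (hf : HasOrder U f s) {z : InfJet N m} (hz : z ∈ infDomain U) :
    ∫ t in (0 : ℝ)..1, (∑ J : JetIndex N s, ∑ σ : Fin m,
      dFib hU J.1 σ f (infScaling t z) * z.2 J.1 σ) = f z - f (infScaling 0 z) := by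
  have hz1 : infScaling 1 z = z := by simp [infScaling]
  rw [← congrArg f.1 hz1]
  change _ = (fun t => f (infScaling t z)) 1 - (fun t => f (infScaling t z)) 0
  have hcont : ContinuousOn (fun t => ∑ J : JetIndex N s, ∑ σ : Fin m,
      dFib hU J.1 σ f (infScaling t z) * z.2 J.1 σ) (Set.uIcc 0 1) :=
    continuousOn_finsetSum _ fun J _ => continuousOn_finsetSum _ fun σ _ =>
      ((hf.dFib hU J.1 σ).continuousOn_infScaling hstar hz).mul continuousOn_const
  refine intervalIntegral.integral_eq_sub_of_hasDerivAt (f := fun t => f (infScaling t z))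
    (fun t ht => ?_) hcont.intervalIntegrable
  rw [Set.uIcc_of_le zero_le_one] at ht
  have hmem := hstar.infScaling_mem hz ht
  have h1 : HasDerivAt (fun t => fibreScaling N m s t (trunc s z)) (0, (trunc s z).2) t := by
    simp only [fibreScaling_apply]
    refine (hasDerivAt_const t _).prodMk ?_
    simpa using (hasDerivAt_id t).smul_const (trunc s z).2
  have h2 := (hf.differentiableAt hU (z := fibreScaling N m s t (trunc s z))
    (trunc_mem_jetDomain.2 hmem)).hasFDerivAt.comp_hasDerivAt t h1
  -- A two-sided derivative is available even at the end points of `[0,1]`, since the open domain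
  -- contains the rescaled points for nearby parameters.
  have h3 : HasDerivAt (fun t => f (infScaling t z)) _ t := h2.congr_of_eventuallyEq (by
    have hev : ∀ᶠ u in 𝓝 t, fibreScaling N m s u (trunc s z) ∈ jetDomain U s :=
      h1.continuousAt.eventually_mem ((isOpen_jetDomain hU s).mem_nhds
        (trunc_mem_jetDomain.2 hmem))
    filter_upwards [hev] with u hu
    exact hf.2 (infScaling u z) (trunc_mem_jetDomain.1 hu))
  refine h3.congr_deriv ?_
  rw [covector_eq_sum_of_vertical]
  refine Finset.sum_congr rfl fun J _ => Finset.sum_congr rfl fun σ _ => ?_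
  rw [dFib_apply hU _ _ _ hmem, hf.lineDeriv_eq hU hmem, trunc_fibreField, mul_comm]
  rfl

/-- Moving the extra index from `y^σ_{Ji}` to the coefficient gives the left side of
`sum_dTot_lepageCoeff`, contracted with `y^σ_J`. -/
theorem HasOrder.sum_homotopyTotalIntegrand (hU : IsOpen U) (hs : 1 ≤ s) (hf : HasOrder U f s)
    (z : InfJet N m) (t : ℝ) :
    ∑ i, homotopyTotalIntegrand hU f s i z t =
      ∑ J : JetIndex N s, ∑ σ : Fin m, dFib hU J.1 σ f (infScaling t z) * z.2 J.1 σ -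
        ∑ σ : Fin m, momentum hU (s + 1) 0 σ f (infScaling t z) * z.2 0 σ := by
  obtain ⟨r, rfl⟩ : ∃ r, s = r + 1 := ⟨s - 1, by omega⟩
  set w := infScaling t z
  let c : Multiset (Fin N) → Fin N → Fin m → smoothFn U := fun J i σ =>
    lepageCoeff hU (r + 1 + 1) J i σ f
  have hc : ∀ (J : Multiset (Fin N)) i σ, r < J.card → c J i σ = 0 := fun J i σ h =>
    hf.lepageCoeff_eq_zero hU _ h i σ
  have h1 : ∀ i, homotopyTotalIntegrand hU f (r + 1) i z t =
      ∑ J : JetIndex N (r + 1), ∑ σ : Fin m, (dTot hU i (c J.1 i σ) +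
        if i ∈ J.1 then c (J.1.erase i) i σ else 0) w * z.2 J.1 σ := by
    intro i
    have e1 : ∑ J : JetIndex N r, ∑ σ : Fin m, dTot hU i (c J.1 i σ) w * z.2 J.1 σ =
        ∑ J : JetIndex N (r + 1), ∑ σ : Fin m, dTot hU i (c J.1 i σ) w * z.2 J.1 σ :=
      (sum_jetIndex_of_le (Nat.le_succ r)
        (Φ := fun J => ∑ σ : Fin m, dTot hU i (c J i σ) w * z.2 J σ)
        fun J hJ => Finset.sum_eq_zero fun σ _ => by
          rw [hc J i σ hJ, map_zero, smoothFn.zero_apply, zero_mul]).symm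
    have e2 : ∑ J : JetIndex N r, ∑ σ : Fin m, c J.1 i σ w * z.2 (i ::ₘ J.1) σ =
        ∑ J : JetIndex N (r + 1), ∑ σ : Fin m,
          (if i ∈ J.1 then c (J.1.erase i) i σ else 0) w * z.2 J.1 σ := by
      rw [← sum_jetIndex_succ_erase i fun J => ∑ σ : Fin m, c J i σ w * z.2 (i ::ₘ J) σ]
      refine Finset.sum_congr rfl fun J _ => ?_
      split_ifs with hi
      · rw [Multiset.cons_erase hi]
      · simp [smoothFn.zero_apply]
    change ∑ J : JetIndex N r, ∑ σ : Fin m,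
      (dTot hU i (c J.1 i σ) w * z.2 J.1 σ + c J.1 i σ w * z.2 (i ::ₘ J.1) σ) = _
    simp only [Finset.sum_add_distrib, smoothFn.add_apply, add_mul]
    rw [e1, e2]
  rw [Finset.sum_congr rfl fun i _ => h1 i, sum_comm_three]
  have h2 : ∀ (J : JetIndex N (r + 1)) (σ : Fin m), ∑ i, (dTot hU i (c J.1 i σ) +
        if i ∈ J.1 then c (J.1.erase i) i σ else 0) w * z.2 J.1 σ =
      dFib hU J.1 σ f w * z.2 J.1 σ -
        (if J.1 = 0 then momentum hU (r + 1 + 1) 0 σ f w * z.2 J.1 σ else 0) := by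
    intro J σ
    rw [← Finset.sum_mul, ← smoothFn.sum_apply, sum_dTot_lepageCoeff hU hf (by omega) J.1 σ,
      smoothFn.sub_apply, sub_mul]
    congr 1
    split_ifs <;> simp [smoothFn.zero_apply]
  simp only [h2, Finset.sum_sub_distrib]
  congr 1
  rw [Finset.sum_eq_single (⟨0, Nat.zero_le _⟩ : JetIndex N (r + 1))]
  · simp
  · intro J _ hJ
    have : J.1 ≠ 0 := fun h => hJ (Subtype.ext h)
    simp [this]
  · simp

theorem HasOrder.continuousOn_homotopyTotalIntegrand (hU : IsOpen U)
    (hstar : VerticallyStarShaped U) (hs : 1 ≤ s) (hf : HasOrder U f s) (i : Fin N)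
    {z : InfJet N m} (hz : z ∈ infDomain U) :
    ContinuousOn (homotopyTotalIntegrand hU f s i z) (Set.uIcc 0 1) := by
  refine continuousOn_finsetSum _ fun J _ => continuousOn_finsetSum _ fun σ _ => ?_
  have hord := hf.lepageCoeff hU hs (Nat.le_succ s) J.1 i σ
  exact (((hord.dTot hU i).continuousOn_infScaling hstar hz).mul continuousOn_const).add
    ((hord.continuousOn_infScaling hstar hz).mul continuousOn_const)

/-- The first variation formula, integrated along the fibre rescaling. -/
theorem HasOrder.integral_momentum_add_sum_dTot (hU : IsOpen U) (hstar : VerticallyStarShaped U)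
    (hs : 1 ≤ s) (hf : HasOrder U f s) {z : InfJet N m} (hz : z ∈ infDomain U) :
    (∫ t in (0 : ℝ)..1, ∑ σ : Fin m, momentum hU (s + 1) 0 σ f (infScaling t z) * z.2 0 σ) +
      ∑ i, dTot hU i (ofJet (homotopyCoeff hU f s i)
        (hf.contDiffOn_homotopyCoeff hU hstar hs i)) z = f z - f (infScaling 0 z) := by
  rw [Finset.sum_congr rfl fun i _ => hf.dTot_homotopyCoeff hU hstar hs i hz,
    ← intervalIntegral.integral_finsetSum fun i _ =>
      (hf.continuousOn_homotopyTotalIntegrand hU hstar hs i hz).intervalIntegrable,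
    ← intervalIntegral.integral_add, ← hf.integral_dFib hU hstar hz]
  · refine intervalIntegral.integral_congr fun t _ => ?_
    simp only [hf.sum_homotopyTotalIntegrand hU hs, add_sub_cancel]
  · refine ContinuousOn.intervalIntegrable (continuousOn_finsetSum _ fun σ _ => ?_)
    exact ((hf.momentum hU s 0 σ).continuousOn_infScaling hstar hz).mul continuousOn_const
  · refine ContinuousOn.intervalIntegrable (continuousOn_finsetSum _ fun i _ => ?_)
    exact hf.continuousOn_homotopyTotalIntegrand hU hstar hs i hz

end homotopy

end

section


set_option maxSynthPendingDepth 3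

open MeasureTheory Filter Topology
open ContinuousAlternatingMap (compContinuousLinearMap_apply curryLeft_apply_apply)

variable {m : ℕ}

/-! ### Homotopy of the principal Lepage equivalent -/

section alternating

variable {E F : Type*} [NormedAddCommGroup E] [NormedSpace ℝ E] [NormedAddCommGroup F]
  [NormedSpace ℝ F] {k : ℕ}

/-- Pull-back of covectors as a linear map. -/
def pullₗ (A : E →L[ℝ] F) : (F [⋀^Fin k]→L[ℝ] ℝ) →ₗ[ℝ] (E [⋀^Fin k]→L[ℝ] ℝ) where
  toFun η := η.compContinuousLinearMap A
  map_add' _ _ := rfl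
  map_smul' _ _ := rfl

theorem pullₗ_apply (A : E →L[ℝ] F) (η : F [⋀^Fin k]→L[ℝ] ℝ) :
    pullₗ A η = η.compContinuousLinearMap A := rfl

/-- Contraction with `v` followed by pull-back along `A`. -/
def insertPull (v : F) (A : E →L[ℝ] F) :
    (F [⋀^Fin (k + 1)]→L[ℝ] ℝ) →ₗ[ℝ] (E [⋀^Fin k]→L[ℝ] ℝ) where
  toFun η := (η.curryLeft v).compContinuousLinearMap A
  map_add' _ _ := rfl
  map_smul' _ _ := rfl

end alternating

section forms

variable {n k : ℕ}

theorem ofBase_apply_eq_zero {s : ℕ} (β : (Fin (n + 1) → ℝ) [⋀^Fin k]→L[ℝ] ℝ)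
    {v : Jet (n + 1) m s} (hv : v.1 = 0) (u : Fin k → Jet (n + 1) m s) (hu : ∃ i, u i = v) :
    ofBase m s β u = 0 := by
  obtain ⟨i, hi⟩ := hu
  refine β.map_coord_zero i ?_
  simp only [hi]
  exact hv

theorem insertPull_ofBase {s : ℕ} (t : ℝ) (w : JetIndex (n + 1) s → Fin m → ℝ)
    (β : (Fin (n + 1) → ℝ) [⋀^Fin (k + 1)]→L[ℝ] ℝ) :
    insertPull (0, w) (fibreScaling (n + 1) m s t) (ofBase m s β) = 0 := by
  ext u
  exact ofBase_apply_eq_zero β (v := (0, w)) rfl _ ⟨0, rfl⟩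

theorem insertPull_wedge {s : ℕ} (t : ℝ) (w : JetIndex (n + 1) s → Fin m → ℝ)
    (θ : Jet (n + 1) m s →L[ℝ] ℝ) (β : (Fin (n + 1) → ℝ) [⋀^Fin k]→L[ℝ] ℝ) :
    insertPull (0, w) (fibreScaling (n + 1) m s t) (wedgeₗ θ (ofBase m s β)) =
      θ (0, w) • ofBase m s β := by
  change ((wedgeₗ θ (ofBase m s β)).curryLeft (0, w)).compContinuousLinearMap _ = _
  rw [wedgeₗ_curryLeft_of_forall_eq_zero _ _ _ fun u hu =>
    ofBase_apply_eq_zero β (v := (0, w)) rfl u hu]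
  rfl

theorem contactForm_vertical {N s : ℕ} (J : Multiset (Fin N)) (σ : Fin m) (z : Jet N m s)
    (w : JetIndex N s → Fin m → ℝ) :
    contactForm s J σ z (0, w) = jetCoord s J σ (0, w) := by
  simp [contactForm, dx, baseProj]

theorem jetCoord_vertical {N s : ℕ} (J : Multiset (Fin N)) (σ : Fin m) (z : Jet N m s) :
    jetCoord s J σ (0, z.2) = jetCoord s J σ z := by
  rw [jetCoord_eq_extend, jetCoord_eq_extend]
  rfl

theorem omegaZero_basePartial {s : ℕ} : omegaZero (n + 1) m s (basePartial m s) = 1 :=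
  baseVolume_single

end forms

section homotopy

variable {n s : ℕ} {U : Set ((Fin (n + 1) → ℝ) × (Fin m → ℝ))}

/-- The vertical vector `(0, y)` annihilates `ω₀` and `ω_i` and pairs with `ω^σ_J` to `y^σ_J`, while
the rescaling fixes forms from the base. -/
theorem fiberedHomotopy_principalLepage (hU : IsOpen U) (hstar : VerticallyStarShaped U)
    (hs : 1 ≤ s) {lam : JetForm (n + 1) m s (n + 1)}
    (hL : ContDiffOn ℝ ∞ (lagrangeFunction lam) (jetDomain U s)) {z : Jet (n + 1) m (2 * s - 1)}
    (hz : z ∈ jetDomain U (2 * s - 1)) :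
    fiberedHomotopy (principalLepage lam) z =
      ∑ i, homotopyCoeff hU (ofJet (lagrangeFunction lam) hL) s i z • omegaOne m (2 * s - 1) i := by
  set f := ofJet (lagrangeFunction lam) hL with hf
  have hord : HasOrder U f s := hasOrder_ofJet hL
  have h1 : ∀ t ∈ Set.uIcc (0 : ℝ) 1,
      ((principalLepage lam (fibreScaling (n + 1) m (2 * s - 1) t z)).curryLeft
        (0, z.2)).compContinuousLinearMap (fibreScaling (n + 1) m (2 * s - 1) t) =
      ∑ i, homotopyIntegrand hU f s i (t, z) • omegaOne m (2 * s - 1) i := by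
    intro t ht
    rw [Set.uIcc_of_le zero_le_one] at ht
    rw [principalLepage_eq hU hs hL (Nat.le_succ s) (K := s - 1) (by omega)
      (hstar.fibreScaling_mem hz ht), ← hf]
    change insertPull (0, z.2) (fibreScaling (n + 1) m (2 * s - 1) t) _ = _
    simp only [map_add, map_sum, map_smul, omegaZero_eq, omegaOne_eq, insertPull_ofBase,
      insertPull_wedge, contactForm_vertical, jetCoord_vertical, smul_zero, zero_add]
    rw [Finset.sum_comm]
    refine Finset.sum_congr rfl fun i _ => ?_
    simp only [homotopyIntegrand, Finset.sum_smul, smul_smul]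
  rw [fiberedHomotopy, intervalIntegral.integral_congr h1, intervalIntegral.integral_finsetSum]
  · refine Finset.sum_congr rfl fun i _ => ?_
    rw [intervalIntegral.integral_smul_const]
    rfl
  · intro i _
    have h := hord.intervalIntegrable_homotopyIntegrand hU hstar hs i hz
    exact ⟨h.1.smul_const _, h.2.smul_const _⟩

theorem vainbergTonti_eq (hU : IsOpen U) (hstar : VerticallyStarShaped U)
    {lam : JetForm (n + 1) m s (n + 1)}
    (hL : ContDiffOn ℝ ∞ (lagrangeFunction lam) (jetDomain U s)) {z : Jet (n + 1) m (2 * s)}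
    (hz : z ∈ jetDomain U (2 * s)) :
    vainbergTonti lam z =
      (∫ t in (0 : ℝ)..1, ∑ σ : Fin m,
        momentum hU (s + 1) 0 σ (ofJet (lagrangeFunction lam) hL) (infScaling t (extend z)) *
          (extend z).2 0 σ) • omegaZero (n + 1) m (2 * s) := by
  rw [vainbergTonti, fiberedHomotopy, ← intervalIntegral.integral_smul_const]
  refine intervalIntegral.integral_congr fun t ht => ?_
  rw [Set.uIcc_of_le zero_le_one] at ht
  change insertPull (0, z.2) (fibreScaling (n + 1) m (2 * s) t) (eulerLagrangeForm lam
    (fibreScaling (n + 1) m (2 * s) t z)) = _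
  simp only [eulerLagrangeForm, wedgeOne_eq, map_sum, map_smul, omegaZero_eq, insertPull_wedge,
    contactForm_vertical, jetCoord_vertical, Finset.sum_smul]
  refine Finset.sum_congr rfl fun σ _ => ?_
  rw [eulerLagrangeExpr_eq hU hL σ (hstar.fibreScaling_mem hz ht), infScaling_extend, smul_smul,
    jetCoord_eq_extend]

theorem infScaling_zero {N : ℕ} (z : InfJet N m) : infScaling 0 z = (z.1, 0) := by
  simp [infScaling]

theorem extend_prod_zero {N s : ℕ} (x : Fin N → ℝ) :
    (extend ((x, 0) : Jet N m s) : InfJet N m) = (x, 0) := by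
  refine Prod.ext rfl ?_
  funext J σ
  simp [extend]

theorem pullback_zeroSection_principalLepage (hU : IsOpen U) (hs : 1 ≤ s)
    {lam : JetForm (n + 1) m s (n + 1)}
    (hL : ContDiffOn ℝ ∞ (lagrangeFunction lam) (jetDomain U s)) {x : Fin (n + 1) → ℝ}
    (hx : (x, 0) ∈ U) :
    pullback (zeroSection (n + 1) m (2 * s - 1)) (principalLepage lam) x =
      ofJet (lagrangeFunction lam) hL (x, 0) • baseVolume (n + 1) := by
  have hx' : zeroSection (n + 1) m (2 * s - 1) x ∈ jetDomain U (2 * s - 1) := hx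
  have hext : (extend (zeroSection (n + 1) m (2 * s - 1) x) : InfJet (n + 1) m) = (x, 0) :=
    extend_prod_zero x
  change pullₗ (zeroSection (n + 1) m (2 * s - 1)) _ = _
  rw [principalLepage_eq hU hs hL le_rfl (K := s - 1) (by omega) hx', hext]
  have hcoord : ∀ (J : Multiset (Fin (n + 1))) (σ : Fin m) (v : Fin (n + 1) → ℝ),
      jetCoord (2 * s - 1) J σ (zeroSection (n + 1) m (2 * s - 1) v) = 0 := by
    intro J σ v
    rw [jetCoord_eq_extend]
    exact congrFun (congrFun (congrArg Prod.snd (extend_prod_zero v)) J) σ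
  have hcon : ∀ (J : Multiset (Fin (n + 1))) (σ : Fin m),
      contactForm (2 * s - 1) J σ (zeroSection (n + 1) m (2 * s - 1) x) ∘L
        zeroSection (n + 1) m (2 * s - 1) = 0 := by
    intro J σ
    refine ContinuousLinearMap.ext fun v => ?_
    simp [contactForm, hcoord]
  simp only [map_add, map_sum, map_smul, pullₗ_apply, wedgeₗ_compContinuousLinearMap, hcon,
    _root_.map_zero, LinearMap.zero_apply, smul_zero, Finset.sum_const_zero, add_zero]
  rfl

end homotopy

end

section


set_option maxSynthPendingDepth 3

open MeasureTheory Filter Topology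

variable {m : ℕ}

/-! ### The trivial part of a Lagrangian -/

section trivial

variable {N s : ℕ} {U : Set ((Fin N → ℝ) × (Fin m → ℝ))} {f : smoothFn U}

/-- `homotopyCoeff` as an element of `smoothFn U`. -/
def homotopyFn (hU : IsOpen U) (hstar : VerticallyStarShaped U) (hs : 1 ≤ s)
    (hf : HasOrder U f s) (i : Fin N) : smoothFn U :=
  ofJet (homotopyCoeff hU f s i) (hf.contDiffOn_homotopyCoeff hU hstar hs i)

theorem hasOrder_homotopyFn (hU : IsOpen U) (hstar : VerticallyStarShaped U) (hs : 1 ≤ s)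
    (hf : HasOrder U f s) (i : Fin N) : HasOrder U (homotopyFn hU hstar hs hf i) (2 * s - 1) :=
  hasOrder_ofJet _

theorem HasOrder.contDiffOn_zeroSection (hf : HasOrder U f s) (hstar : VerticallyStarShaped U) :
    ContDiffOn ℝ ∞ (fun w : Jet N m 0 => f (w.1, 0)) (jetDomain U 0) := by
  have h1 : ContDiffOn ℝ ∞ (fun w : Jet N m 0 => ((w.1, 0) : Jet N m s)) (jetDomain U 0) := by
    fun_prop
  refine (hf.1.comp h1 fun w hw => ?_).congr fun w _ => ?_
  · have := hstar _ hw 0 (by simp)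
    rwa [zero_smul] at this
  · exact congrArg f.1 (extend_prod_zero w.1).symm

/-- The value of `f` on the zero section. -/
def zeroSectionFn (hstar : VerticallyStarShaped U) (hf : HasOrder U f s) : smoothFn U :=
  ofJet (fun w : Jet N m 0 => f (w.1, 0)) (hf.contDiffOn_zeroSection hstar)

theorem zeroSectionFn_apply (hstar : VerticallyStarShaped U) (hf : HasOrder U f s)
    {z : InfJet N m} (hz : z ∈ infDomain U) : zeroSectionFn hstar hf z = f (z.1, 0) :=
  ofJet_apply _ hz

theorem dFib_zeroSectionFn (hU : IsOpen U) (hstar : VerticallyStarShaped U) (hf : HasOrder U f s)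
    (J : Multiset (Fin N)) (σ : Fin m) : dFib hU J σ (zeroSectionFn hstar hf) = 0 := by
  ext z hz
  rw [dFib_apply hU J σ _ hz, smoothFn.zero_apply, lineDeriv]
  have : (fun t : ℝ => zeroSectionFn hstar hf (z + t • fibreField J σ)) =ᶠ[𝓝 0]
      fun _ => f (z.1, 0) := by
    filter_upwards [eventually_mem_infDomain hU hz (fibreField J σ)] with t ht
    rw [zeroSectionFn_apply hstar hf ht]
    simp [fibreField]
  rw [this.deriv_eq, deriv_const]

/-- The Lagrange function `∑ d_i a^i + L(x, 0)` of `hdα`. -/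
def trivialFn (hU : IsOpen U) (hstar : VerticallyStarShaped U) (hs : 1 ≤ s)
    (hf : HasOrder U f s) : smoothFn U :=
  ∑ i, dTot hU i (homotopyFn hU hstar hs hf i) + zeroSectionFn hstar hf

theorem hasOrder_trivialFn (hU : IsOpen U) (hstar : VerticallyStarShaped U) (hs : 1 ≤ s)
    (hf : HasOrder U f s) : HasOrder U (trivialFn hU hstar hs hf) (2 * s) := by
  refine HasOrder.add (HasOrder.sum _ fun i _ => ?_)
    (HasOrder.mono (hasOrder_ofJet (s := 0) _) (Nat.zero_le _))
  exact ((hasOrder_homotopyFn hU hstar hs hf i).dTot hU i).mono (by omega)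

/-- The coefficient of `ω^σ_J ∧ ω_i` in `dα - Θ_{hdα}`. -/
def defectCoeff (hU : IsOpen U) (hstar : VerticallyStarShaped U) (hs : 1 ≤ s)
    (hf : HasOrder U f s) (σ : Fin m) (i : Fin N) (J : Multiset (Fin N)) : smoothFn U :=
  dFib hU J σ (homotopyFn hU hstar hs hf i) -
    lepageCoeff hU (2 * s + 1) J i σ (trivialFn hU hstar hs hf)

theorem defectCoeff_eq_zero (hU : IsOpen U) (hstar : VerticallyStarShaped U) (hs : 1 ≤ s)
    (hf : HasOrder U f s) (σ : Fin m) (i : Fin N) (J : Multiset (Fin N))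
    (hJ : 2 * s - 1 < J.card) : defectCoeff hU hstar hs hf σ i J = 0 := by
  rw [defectCoeff, (hasOrder_homotopyFn hU hstar hs hf i).dFib_eq_zero hU hJ,
    (hasOrder_trivialFn hU hstar hs hf).lepageCoeff_eq_zero hU _ (by omega), sub_zero]

theorem hasOrder_defectCoeff (hU : IsOpen U) (hstar : VerticallyStarShaped U) (hs : 1 ≤ s)
    (hf : HasOrder U f s) (σ : Fin m) (i : Fin N) (J : Multiset (Fin N)) :
    HasOrder U (defectCoeff hU hstar hs hf σ i J) (2 * (2 * s) - 1) :=
  (((hasOrder_homotopyFn hU hstar hs hf i).dFib hU J σ).mono (by omega)).sub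
    ((hasOrder_trivialFn hU hstar hs hf).lepageCoeff hU (by omega) (by omega) J i σ)

/-- Express `∂T/∂y^σ_M` in two ways: by commuting it past the `d_i` in `T = ∑ d_i a^i + L(x,0)`, and
by the first variation formula for `T`. For `M ≠ 0` the difference is the claim; for `M = 0` it
would be the Euler–Lagrange expression of `T`. -/
theorem sum_shiftDeriv_defectCoeff (hU : IsOpen U) (hstar : VerticallyStarShaped U) (hs : 1 ≤ s)
    (hf : HasOrder U f s) (σ : Fin m) (M : Multiset (Fin N)) (hM : M ≠ 0) :
    (∑ i, shiftDeriv (dTot hU) i (defectCoeff hU hstar hs hf σ i)) M = 0 := by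
  have h1 := sum_dTot_lepageCoeff hU (hasOrder_trivialFn hU hstar hs hf) (R := 2 * s + 1)
    (by omega) M σ
  have h2 : dFib hU M σ (trivialFn hU hstar hs hf) =
      ∑ i, (dTot hU i (dFib hU M σ (homotopyFn hU hstar hs hf i)) +
        if i ∈ M then dFib hU (M.erase i) σ (homotopyFn hU hstar hs hf i) else 0) := by
    rw [trivialFn, map_add, dFib_zeroSectionFn, add_zero, map_sum]
    exact Finset.sum_congr rfl fun i _ => dFib_dTot hU M σ i _
  rw [if_neg hM, sub_zero, h2] at h1
  rw [← sub_eq_zero.2 h1.symm, Finset.sum_apply, ← Finset.sum_sub_distrib]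
  refine Finset.sum_congr rfl fun i _ => ?_
  simp only [shiftDeriv_apply, defectCoeff, map_sub]
  split_ifs <;> abel

theorem exists_defect_primitive (hU : IsOpen U) (hstar : VerticallyStarShaped U) (hs : 1 ≤ s)
    (hf : HasOrder U f s) (σ : Fin m) :
    ∃ b : Fin N → Fin N → Multiset (Fin N) → smoothFn U, (∀ i j, b i j = -b j i) ∧
      (∀ i j J, 2 * s - 1 < J.card → b i j J = 0) ∧
      ∀ i, defectCoeff hU hstar hs hf σ i = ∑ j, shiftDeriv (dTot hU) j (b i j) :=
  exists_koszul_primitive (dTot_comm hU) (2 * s - 1) _ (defectCoeff_eq_zero hU hstar hs hf σ)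
    (sum_shiftDeriv_defectCoeff hU hstar hs hf σ)

end trivial

/-! ### The differential of `α` and its horizontal part -/

section alpha

variable {n s : ℕ} {U : Set ((Fin (n + 1) → ℝ) × (Fin m → ℝ))}

theorem IsLagrangian.eq_smul_omegaZero {lam : JetForm (n + 1) m s (n + 1)}
    (h : IsLagrangian U lam) {z : Jet (n + 1) m s} (hz : z ∈ jetDomain U s) :
    lam z = lagrangeFunction lam z • omegaZero (n + 1) m s := by
  have hbase : lam z = (lam z).compContinuousLinearMap
      (zeroSection (n + 1) m s ∘L baseProj (n + 1) m s) := by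
    ext v
    rw [ContinuousAlternatingMap.compContinuousLinearMap_apply]
    -- The arguments are projected one at a time; each replacement changes an argument by a vertical
    -- vector, which a horizontal form does not see.
    have hstep : ∀ t : Finset (Fin (n + 1)), lam z v = lam z (fun i => if i ∈ t then
        (zeroSection (n + 1) m s ∘L baseProj (n + 1) m s) (v i) else v i) := by
      intro t
      induction t using Finset.induction_on with
      | empty => simp
      | insert a t ha ih =>
        rw [ih]
        set u : Fin (n + 1) → Jet (n + 1) m s := fun i => if i ∈ t then
          (zeroSection (n + 1) m s ∘L baseProj (n + 1) m s) (v i) else v i with hu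
        have h1 : (fun i => if i ∈ insert a t then
            (zeroSection (n + 1) m s ∘L baseProj (n + 1) m s) (v i) else v i) =
            Function.update u a ((zeroSection (n + 1) m s ∘L baseProj (n + 1) m s) (v a)) := by
          funext i
          rcases eq_or_ne i a with rfl | hi
          · simp
          · simp [hi, hu]
        have h2 : u = Function.update u a (v a) := by
          rw [eq_comm, Function.update_eq_self_iff]
          simp [hu, ha]
        rw [h1, ← sub_eq_zero]
        nth_rewrite 1 [h2]
        rw [← ContinuousAlternatingMap.map_update_sub]
        refine h.horizontal z hz _ ⟨a, ?_⟩
        rw [Function.update_self, map_sub, sub_eq_zero]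
        rfl
    have := hstep Finset.univ
    simp only [Finset.mem_univ, if_true] at this
    exact this
  have hdet := AlternatingMap.eq_smul_basis_det (Pi.basisFun ℝ (Fin (n + 1)))
    ((lam z).compContinuousLinearMap (zeroSection (n + 1) m s)).toAlternatingMap
  ext v
  rw [hbase]
  have := DFunLike.congr_fun hdet fun i => (v i).1
  refine this.trans ?_
  rw [Pi.basisFun_det]
  change _ * (Matrix.detRowAlternating fun i => (v i).1) =
    _ * (Matrix.detRowAlternating fun i => (v i).1)
  congr 1
  change lam z (fun i => zeroSection (n + 1) m s (Pi.basisFun ℝ (Fin (n + 1)) i)) =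
    lam z (basePartial m s)
  congr 1
  funext i
  rw [Pi.basisFun_apply]
  rfl

variable {lam : JetForm (n + 1) m s (n + 1)} {mu0 : BaseForm (n + 1) n}

/-- The `μ₀` term contributes only the value of `L` on the zero section: `d` commutes with
pull-back, and the contact part of `Θ_λ` vanishes along the zero section. -/
theorem extDeriv_alphaForm (hU : IsOpen U) (hstar : VerticallyStarShaped U) (hs : 1 ≤ s)
    (hL : ContDiffOn ℝ ∞ (lagrangeFunction lam) (jetDomain U s))
    (hmu0 : ContDiffOn ℝ ∞ mu0 (Prod.fst '' U))
    (hdmu0 : ∀ x ∈ Prod.fst '' U,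
      extDeriv mu0 x = pullback (zeroSection (n + 1) m (2 * s - 1)) (principalLepage lam) x)
    {w : Jet (n + 1) m (2 * s - 1)} (hw : w ∈ jetDomain U (2 * s - 1)) :
    extDeriv (alphaForm lam mu0) w =
      ∑ i, wedgeₗ (fderiv ℝ (homotopyCoeff hU (ofJet (lagrangeFunction lam) hL) s i) w)
        (omegaOne m (2 * s - 1) i) +
      ofJet (lagrangeFunction lam) hL (w.1, 0) • omegaZero (n + 1) m (2 * s - 1) := by
  set f := ofJet (lagrangeFunction lam) hL
  have hord : HasOrder U f s := hasOrder_ofJet hL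
  set P := baseProj (n + 1) m (2 * s - 1) with hP
  have hopen := isOpen_jetDomain hU (2 * s - 1)
  have hwx : P w ∈ Prod.fst '' U := ⟨_, hw, rfl⟩
  have hx0 : (P w, 0) ∈ U := by
    have := hstar _ hw 0 (by simp)
    rwa [zero_smul] at this
  have hdiff : ∀ i, DifferentiableAt ℝ (homotopyCoeff hU f s i) w := fun i =>
    ((hord.contDiffOn_homotopyCoeff hU hstar hs i).contDiffAt
      (hopen.mem_nhds hw)).differentiableAt (by simp)
  have hmu : DifferentiableAt ℝ mu0 (P w) :=
    (hmu0.contDiffAt ((isOpenMap_fst U hU).mem_nhds hwx)).differentiableAt (by simp)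
  have hev : alphaForm lam mu0 =ᶠ[𝓝 w]
      (fun z => ∑ i, homotopyCoeff hU f s i z • omegaOne m (2 * s - 1) i) + pullback P mu0 := by
    filter_upwards [hopen.mem_nhds hw] with z hz
    rw [alphaForm, Pi.add_apply, Pi.add_apply, fiberedHomotopy_principalLepage hU hstar hs hL hz]
  have hpull : DifferentiableAt ℝ (pullback P mu0) w :=
    (ContinuousAlternatingMap.compContinuousLinearMapCLM (F := ℝ) (ι := Fin n)
      P).differentiableAt.comp w (hmu.comp w P.differentiableAt)
  rw [hev.extDeriv_eq, extDeriv_add (DifferentiableAt.fun_sum fun i _ => (hdiff i).smul_const _)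
    hpull, extDeriv_sum _ fun i _ => (hdiff i).smul_const _]
  congr 1
  · exact Finset.sum_congr rfl fun i _ => extDeriv_smul_const (hdiff i) _
  · have h1 := extDeriv_pullback (r := ∞) (f := P) (x := w) hmu P.contDiff.contDiffAt
      (by
        rw [minSmoothness_of_isRCLikeNormedField]
        exact WithTop.coe_le_coe.2 (le_top : (2 : ℕ∞) ≤ ⊤))
    simp only [ContinuousLinearMap.fderiv] at h1
    refine h1.trans ?_
    rw [hdmu0 _ hwx, pullback_zeroSection_principalLepage hU hs hL hx0]
    rfl

theorem wedge_fderiv_comp_horVec {S : ℕ} (h : s + 1 ≤ S) (z : Jet (n + 1) m S)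
    (θ : Jet (n + 1) m s →L[ℝ] ℝ) (i : Fin (n + 1)) :
    wedgeₗ (θ ∘L horVec h z) (omegaOne m S i) =
      θ (formalVector h i z) • omegaZero (n + 1) m S := by
  rw [comp_horVec, map_sum, LinearMap.sum_apply]
  simp only [map_smul, LinearMap.smul_apply, wedge_dx_omegaOne, smul_ite, smul_zero,
    Finset.sum_ite_eq', Finset.mem_univ, if_true]

variable (hU : IsOpen U) (hstar : VerticallyStarShaped U) (hs : 1 ≤ s)
    (hL : ContDiffOn ℝ ∞ (lagrangeFunction lam) (jetDomain U s))
    (hmu0 : ContDiffOn ℝ ∞ mu0 (Prod.fst '' U))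
    (hdmu0 : ∀ x ∈ Prod.fst '' U,
      extDeriv mu0 x = pullback (zeroSection (n + 1) m (2 * s - 1)) (principalLepage lam) x)

include hmu0 hdmu0

theorem horizontalize_extDeriv_alphaForm {S : ℕ} (h : 2 * s - 1 + 1 ≤ S) {z : Jet (n + 1) m S}
    (hz : z ∈ jetDomain U S) :
    horizontalize h (extDeriv (alphaForm lam mu0)) z =
      trivialFn hU hstar hs (hasOrder_ofJet hL) (extend z) • omegaZero (n + 1) m S := by
  have hcoeff := (hasOrder_ofJet hL).contDiffOn_homotopyCoeff hU hstar hs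
  change pullₗ (horVec h z) _ = _
  rw [extDeriv_alphaForm hU hstar hs hL hmu0 hdmu0 (w := jetProj _ z) hz]
  simp only [map_add, map_sum, map_smul, pullₗ_apply, wedgeₗ_compContinuousLinearMap]
  have h0 : (omegaZero (n + 1) m (2 * s - 1)).compContinuousLinearMap (horVec h z) =
      omegaZero (n + 1) m S := ofBase_comp_horVec h z _
  have h1 : ∀ i, (omegaOne m (2 * s - 1) i).compContinuousLinearMap (horVec h z) =
      omegaOne m S i := fun i => by
    rw [omegaOne_eq, omegaOne_eq, ofBase_comp_horVec]
  simp only [h0, h1, wedge_fderiv_comp_horVec]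
  rw [trivialFn, smoothFn.add_apply, smoothFn.sum_apply, add_smul, Finset.sum_smul,
    zeroSectionFn_apply hstar _ (extend_mem_infDomain.2 hz)]
  congr 1
  refine Finset.sum_congr rfl fun i _ => ?_
  rw [homotopyFn, dTot_ofJet_extend (hcoeff i) hU i h hz]

/-- Each `da^i` splits into its horizontal part, which contributes to `T ω₀`, and its contact part,
whose coefficients are the partial derivatives of `a^i`. -/
theorem lift_extDeriv_alphaForm {S : ℕ} (h : 2 * s - 1 + 1 ≤ S) {z : Jet (n + 1) m S}
    (hz : z ∈ jetDomain U S) :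
    lift ((Nat.le_succ _).trans h) (extDeriv (alphaForm lam mu0)) z =
      trivialFn hU hstar hs (hasOrder_ofJet hL) (extend z) • omegaZero (n + 1) m S +
      ∑ J : JetIndex (n + 1) (2 * s - 1), ∑ i, ∑ σ : Fin m,
        dFib hU J.1 σ (homotopyFn hU hstar hs (hasOrder_ofJet hL) i) (extend z) •
          wedgeₗ (contactForm S J.1 σ z) (omegaOne m S i) := by
  have hcoeff := (hasOrder_ofJet hL).contDiffOn_homotopyCoeff hU hstar hs
  have hhor := horizontalize_extDeriv_alphaForm hU hstar hs hL hmu0 hdmu0 h hz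
  change pullₗ (horVec h z) _ = _ at hhor
  rw [← hhor]
  change pullₗ (jetProj _) (extDeriv _ (jetProj _ z)) = _
  rw [extDeriv_alphaForm hU hstar hs hL hmu0 hdmu0 (w := jetProj _ z) hz]
  have h0 : (omegaZero (n + 1) m (2 * s - 1)).compContinuousLinearMap (horVec h z) =
      omegaZero (n + 1) m S := ofBase_comp_horVec h z _
  have h1 : ∀ i, (omegaOne m (2 * s - 1) i).compContinuousLinearMap (horVec h z) =
      omegaOne m S i := fun i => by
    rw [omegaOne_eq, omegaOne_eq, ofBase_comp_horVec]
  have h2 : ∀ i : Fin (n + 1), (omegaOne m (2 * s - 1) i).compContinuousLinearMap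
      (jetProj ((Nat.le_succ _).trans h)) = omegaOne m S i := fun i => by
    rw [omegaOne_eq, omegaOne_eq, ofBase_comp_jetProj]
  simp only [map_add, map_sum, map_smul, pullₗ_apply, wedgeₗ_compContinuousLinearMap, h0, h1, h2,
    comp_jetProj_eq h z, LinearMap.add_apply, Finset.sum_add_distrib, comp_conVec,
    LinearMap.sum_apply, LinearMap.smul_apply]
  have h3 : (omegaZero (n + 1) m (2 * s - 1)).compContinuousLinearMap
      (jetProj ((Nat.le_succ _).trans h)) = omegaZero (n + 1) m S := rfl
  rw [h3, sum_comm_three]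
  have h4 : ∀ (J : JetIndex (n + 1) (2 * s - 1)) (i : Fin (n + 1)) (σ : Fin m),
      dFib hU J.1 σ (homotopyFn hU hstar hs (hasOrder_ofJet hL) i) (extend z) =
        fderiv ℝ (homotopyCoeff hU (ofJet (lagrangeFunction lam) hL) s i)
          (jetProj ((Nat.le_succ _).trans h) z) (fibrePartial (2 * s - 1) J.1 σ) :=
    fun J i σ => dFib_ofJet_extend (hcoeff i) hU J.1 σ ((Nat.le_succ _).trans h) hz
  simp only [h4]
  rw [Finset.sum_congr rfl fun J _ => Finset.sum_comm]
  abel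

end alpha

end

section


set_option maxSynthPendingDepth 3

open MeasureTheory Filter Topology

variable {m : ℕ}

/-! ### Contact primitives -/

section primitive

theorem HasOrder.ofJet_extend_eq {N s : ℕ} {U : Set ((Fin N → ℝ) × (Fin m → ℝ))} {g : smoothFn U}
    (hg : HasOrder U g s) : ofJet (fun w : Jet N m s => g (extend w)) hg.1 = g := by
  ext z hz
  rw [ofJet_apply _ hz, ← hg.2 z hz]

theorem HasOrder.totalDeriv_eq {N s : ℕ} {U : Set ((Fin N → ℝ) × (Fin m → ℝ))} {g : smoothFn U}
    (hg : HasOrder U g s) (hU : IsOpen U) (i : Fin N) {z : Jet N m (s + 1)}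
    (hz : z ∈ jetDomain U (s + 1)) :
    totalDeriv i (fun w : Jet N m s => g (extend w)) z = dTot hU i g (extend z) := by
  conv_rhs => rw [← hg.ofJet_extend_eq, dTot_ofJet_extend hg.1 hU i le_rfl hz]
  rfl

theorem HasOrder.extend_jetProj {N s S : ℕ} {U : Set ((Fin N → ℝ) × (Fin m → ℝ))}
    {g : InfJet N m → ℝ} (hg : HasOrder U g s) (h : s ≤ S) {z : Jet N m S}
    (hz : z ∈ jetDomain U S) : g (extend (jetProj h z)) = g (extend z) := by
  rw [hg.2 _ (extend_mem_infDomain.2 hz), trunc_extend h]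

variable {n : ℕ} {U : Set ((Fin (n + 2) → ℝ) × (Fin m → ℝ))}

/-- The contact form `-1/2 ∑ b^{ij}_{σJ} ω^σ_J ∧ ω_{ij}`. -/
def contactPrimitive (K S : ℕ)
    (b : Fin m → Fin (n + 2) → Fin (n + 2) → Multiset (Fin (n + 2)) → smoothFn U) :
    JetForm (n + 2) m S (n + 1) := fun w =>
  ∑ x : Fin m × JetIndex (n + 2) K × Fin (n + 2) × Fin (n + 2), (-(1 / 2) : ℝ) •
    (b x.1 x.2.2.1 x.2.2.2 x.2.1.1 (extend w) •
      wedgeₗ (contactForm S x.2.1.1 x.1 w) (omegaTwo m S x.2.2.1 x.2.2.2))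

variable {K S : ℕ} {b : Fin m → Fin (n + 2) → Fin (n + 2) → Multiset (Fin (n + 2)) → smoothFn U}

theorem contDiff_contactForm_wedge (J : Multiset (Fin (n + 2))) (σ : Fin m) (i j : Fin (n + 2)) :
    ContDiff ℝ ∞ fun w => wedgeₗ (contactForm S J σ w) (omegaTwo m S i j) := by
  simp only [contactForm_wedge_omegaTwo]
  exact (contDiff_const.sub ((jetCoord S _ σ).contDiff.smul contDiff_const)).add
    ((jetCoord S _ σ).contDiff.smul contDiff_const)

theorem contDiffOn_contactPrimitive (hb : ∀ σ i j (J : JetIndex (n + 2) K),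
    HasOrder U (b σ i j J.1) S) : ContDiffOn ℝ ∞ (contactPrimitive K S b) (jetDomain U S) :=
  ContDiffOn.sum fun x _ => ((hb x.1 x.2.2.1 x.2.2.2 x.2.1).1.smul
    (contDiff_contactForm_wedge x.2.1.1 x.1 x.2.2.1 x.2.2.2).contDiffOn).const_smul (-(1 / 2) : ℝ)

theorem isOneContact_contactPrimitive (hKS : K < S) : IsOneContact U (contactPrimitive K S b) := by
  intro z _
  change pullₗ (jetProj _) (∑ x, _) = contactPart _ _ (∑ x, _)
  rw [map_sum, map_sum]
  refine Finset.sum_congr rfl fun x _ => ?_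
  have hJ : x.2.1.1.card < S := x.2.1.2.trans_lt hKS
  simp only [map_smul, pullₗ_apply, omegaTwo]
  rw [contactForm_wedge_comp_jetProj _ _ hJ, contactPart_contactForm_wedge _ _ hJ]

/-- Each term of `ν` yields two expressions exchanged by `i ↔ j` with opposite signs. Antisymmetry
of `b` makes their sums equal, which cancels the factor `1/2`. -/
theorem contactOne_extDeriv_contactPrimitive (hU : IsOpen U) (hKS : K < S)
    (hanti : ∀ σ i j, b σ i j = -b σ j i)
    (hb : ∀ σ i j (J : JetIndex (n + 2) K), HasOrder U (b σ i j J.1) S)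
    {z : Jet (n + 2) m (S + 1)} (hz : z ∈ jetDomain U (S + 1)) :
    contactOne (extDeriv (contactPrimitive K S b)) z =
      ∑ σ, ∑ J : JetIndex (n + 2) K, ∑ i, ∑ j,
        wedgeₗ (dTot hU j (b σ i j J.1) (extend z) • contactForm (S + 1) J.1 σ z +
          b σ i j J.1 (extend z) • contactForm (S + 1) (j ::ₘ J.1) σ z)
          (omegaOne m (S + 1) i) := by
  let y : Fin m → JetIndex (n + 2) K → Fin (n + 2) → Fin (n + 2) →
      (Jet (n + 2) m (S + 1)) [⋀^Fin (n + 2)]→L[ℝ] ℝ := fun σ J i j =>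
    wedgeₗ (dTot hU j (b σ i j J.1) (extend z) • contactForm (S + 1) J.1 σ z +
      b σ i j J.1 (extend z) • contactForm (S + 1) (j ::ₘ J.1) σ z) (omegaOne m (S + 1) i)
  change _ = ∑ σ, ∑ J, ∑ i, ∑ j, y σ J i j
  have hdiff : ∀ x : Fin m × JetIndex (n + 2) K × Fin (n + 2) × Fin (n + 2),
      DifferentiableAt ℝ (fun w : Jet (n + 2) m S => b x.1 x.2.2.1 x.2.2.2 x.2.1.1 (extend w))
        (jetProj (Nat.le_succ S) z) := fun x =>
    (hb x.1 x.2.2.1 x.2.2.2 x.2.1).differentiableAt hU hz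
  have hdiff' : ∀ x : Fin m × JetIndex (n + 2) K × Fin (n + 2) × Fin (n + 2),
      DifferentiableAt ℝ (fun w : Jet (n + 2) m S => b x.1 x.2.2.1 x.2.2.2 x.2.1.1 (extend w) •
        wedgeₗ (contactForm S x.2.1.1 x.1 w) (omegaTwo m S x.2.2.1 x.2.2.2))
        (jetProj (Nat.le_succ S) z) := fun x =>
    (hdiff x).smul ((contDiff_contactForm_wedge _ _ _ _).differentiable (by simp) _)
  have hext : extDeriv (contactPrimitive K S b) (jetProj (Nat.le_succ S) z) =
      ∑ x : Fin m × JetIndex (n + 2) K × Fin (n + 2) × Fin (n + 2), (-(1 / 2) : ℝ) •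
        extDeriv (fun w => b x.1 x.2.2.1 x.2.2.2 x.2.1.1 (extend w) •
          wedgeₗ (contactForm S x.2.1.1 x.1 w) (omegaTwo m S x.2.2.1 x.2.2.2))
          (jetProj (Nat.le_succ S) z) := by
    refine (extDeriv_sum _ fun x _ => (hdiff' x).const_smul (-(1 / 2) : ℝ)).trans ?_
    exact Finset.sum_congr rfl fun x _ => extDeriv_fun_smul _ _
  rw [contactOne_eq, hext, map_sum]
  have hterm : ∀ x : Fin m × JetIndex (n + 2) K × Fin (n + 2) × Fin (n + 2),
      contactPart (horVec le_rfl z) (conVec le_rfl z) ((-(1 / 2) : ℝ) •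
        extDeriv (fun w => b x.1 x.2.2.1 x.2.2.2 x.2.1.1 (extend w) •
          wedgeₗ (contactForm S x.2.1.1 x.1 w) (omegaTwo m S x.2.2.1 x.2.2.2))
          (jetProj (Nat.le_succ S) z)) =
      (1 / 2 : ℝ) • y x.1 x.2.1 x.2.2.2 x.2.2.1 + (1 / 2 : ℝ) • y x.1 x.2.1 x.2.2.1 x.2.2.2 := by
    rintro ⟨σ, J, i, j⟩
    have hord := hb σ i j J
    rw [map_smul, ← contactOne_eq, contactOne_extDeriv_contactForm_wedge (hdiff (σ, J, i, j))
      (J.2.trans_lt hKS), hord.totalDeriv_eq hU i hz, hord.totalDeriv_eq hU j hz,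
      hord.extend_jetProj _ hz]
    have hneg : b σ i j J.1 = -b σ j i J.1 := congrFun (hanti σ i j) J.1
    have hy : y σ J j i = -wedgeₗ (dTot hU i (b σ i j J.1) (extend z) • contactForm (S + 1) J.1 σ z +
        b σ i j J.1 (extend z) • contactForm (S + 1) (i ::ₘ J.1) σ z)
        (omegaOne m (S + 1) j) := by
      have h1 : dTot hU i (b σ i j J.1) (extend z) = -dTot hU i (b σ j i J.1) (extend z) := by
        rw [hneg, map_neg]
        rfl
      have h2 : b σ i j J.1 (extend z) = -b σ j i J.1 (extend z) := by
        rw [hneg]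
        rfl
      rw [h1, h2, neg_smul, neg_smul, ← neg_add, map_neg, LinearMap.neg_apply, neg_neg]
    simp only [hy, y]
    module
  rw [Finset.sum_congr rfl fun x _ => hterm x, Finset.sum_add_distrib]
  simp only [Fintype.sum_prod_type]
  rw [← Finset.sum_add_distrib]
  refine Finset.sum_congr rfl fun σ _ => ?_
  rw [← Finset.sum_add_distrib]
  refine Finset.sum_congr rfl fun J _ => ?_
  rw [Finset.sum_comm, ← Finset.sum_add_distrib]
  refine Finset.sum_congr rfl fun i _ => ?_
  rw [← Finset.sum_add_distrib]
  refine Finset.sum_congr rfl fun j _ => ?_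
  module

/-- Summation by parts: the index shift passes from the coefficients to `W`. It can reach length `K
+ 1`, so the left sum is first extended there by zeros, using `hc0`. -/
theorem sum_shiftDeriv_smul_contactForm_wedge (hU : IsOpen U)
    {c : Multiset (Fin (n + 2)) → smoothFn U} {β : Fin (n + 2) → Multiset (Fin (n + 2)) → smoothFn U}
    (hc : c = ∑ j, shiftDeriv (dTot hU) j (β j)) (hc0 : ∀ J, K < J.card → c J = 0)
    (hβ0 : ∀ j J, K < J.card → β j J = 0) {E : Type*} [AddCommGroup E] [Module ℝ E]
    (z : InfJet (n + 2) m) (W : Multiset (Fin (n + 2)) → E) :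
    ∑ J : JetIndex (n + 2) K, c J.1 z • W J.1 =
      ∑ J : JetIndex (n + 2) K, ∑ j,
        (dTot hU j (β j J.1) z • W J.1 + β j J.1 z • W (j ::ₘ J.1)) := by
  rw [← sum_jetIndex_of_le (Nat.le_succ K) (Φ := fun J => c J z • W J) fun J hJ => by
    rw [hc0 J hJ, smoothFn.zero_apply, zero_smul]]
  have h1 : ∀ J, c J z • W J = ∑ j, (dTot hU j (β j J) z • W J +
      if j ∈ J then β j (J.erase j) z • W J else 0) := by
    intro J
    rw [hc, Finset.sum_apply, smoothFn.sum_apply, Finset.sum_smul]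
    refine Finset.sum_congr rfl fun j _ => ?_
    rw [shiftDeriv_apply, smoothFn.add_apply, add_smul]
    congr 1
    split_ifs
    · rfl
    · rw [smoothFn.zero_apply, zero_smul]
  simp only [h1, Finset.sum_add_distrib]
  congr 1
  · exact sum_jetIndex_of_le (Nat.le_succ K) (Φ := fun J => ∑ j, dTot hU j (β j J) z • W J)
      fun J hJ => Finset.sum_eq_zero fun j _ => by
        rw [hβ0 j J hJ, map_zero, smoothFn.zero_apply, zero_smul]
  · rw [Finset.sum_comm, Finset.sum_comm (s := (Finset.univ : Finset (JetIndex (n + 2) K)))]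
    refine Finset.sum_congr rfl fun j _ => ?_
    rw [← sum_jetIndex_succ_erase j fun J => β j J z • W (j ::ₘ J)]
    refine Finset.sum_congr rfl fun J _ => ?_
    split_ifs with hj
    · rw [Multiset.cons_erase hj]
    · rfl

end primitive

/-! ### Contact primitives for forms with Koszul-exact coefficients -/

section defect

variable {n K T : ℕ} {U : Set ((Fin (n + 1) → ℝ) × (Fin m → ℝ))}
  {D : JetForm (n + 1) m T (n + 1)}
  {c : Fin m → Fin (n + 1) → Multiset (Fin (n + 1)) → smoothFn U}

theorem isOneContact_of_eq_sum (hKT : K < T)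
    (hD : ∀ z ∈ jetDomain U T, D z = ∑ J : JetIndex (n + 1) K, ∑ i, ∑ σ,
      c σ i J.1 (extend z) • wedgeₗ (contactForm T J.1 σ z) (omegaOne m T i)) :
    IsOneContact U D := by
  intro z hz
  change pullₗ (jetProj _) (D (jetProj _ z)) = contactPart _ _ (D (jetProj _ z))
  rw [hD (jetProj _ z) hz]
  simp only [map_sum, map_smul, pullₗ_apply, omegaOne_eq]
  refine Finset.sum_congr rfl fun J _ => Finset.sum_congr rfl fun i _ =>
    Finset.sum_congr rfl fun σ _ => ?_
  have hJ : J.1.card < T := J.2.trans_lt hKT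
  rw [contactForm_wedge_comp_jetProj _ _ hJ, contactPart_contactForm_wedge _ _ hJ]

theorem lift_of_eq_sum (hKT : K < T) (hc : ∀ σ i J, HasOrder U (c σ i J) T)
    (hD : ∀ z ∈ jetDomain U T, D z = ∑ J : JetIndex (n + 1) K, ∑ i, ∑ σ,
      c σ i J.1 (extend z) • wedgeₗ (contactForm T J.1 σ z) (omegaOne m T i))
    {S : ℕ} (h : T ≤ S) {z : Jet (n + 1) m S} (hz : z ∈ jetDomain U S) :
    lift h D z = ∑ J : JetIndex (n + 1) K, ∑ i, ∑ σ,
      c σ i J.1 (extend z) • wedgeₗ (contactForm S J.1 σ z) (omegaOne m S i) := by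
  change pullₗ (jetProj h) (D (jetProj h z)) = _
  rw [hD (jetProj _ z) hz]
  simp only [map_sum, map_smul, pullₗ_apply, omegaOne_eq]
  refine Finset.sum_congr rfl fun J _ => Finset.sum_congr rfl fun i _ =>
    Finset.sum_congr rfl fun σ _ => ?_
  rw [contactForm_wedge_comp_jetProj _ _ (J.2.trans_lt hKT), (hc σ i J.1).extend_jetProj h hz]

theorem exists_contact_primitive (hU : IsOpen U) (hKT : K < T)
    (hc : ∀ σ i J, HasOrder U (c σ i J) T) (hc0 : ∀ σ i J, K < J.card → c σ i J = 0)
    (hD : ∀ z ∈ jetDomain U T, D z = ∑ J : JetIndex (n + 1) K, ∑ i, ∑ σ,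
      c σ i J.1 (extend z) • wedgeₗ (contactForm T J.1 σ z) (omegaOne m T i))
    {b : Fin m → Fin (n + 1) → Fin (n + 1) → Multiset (Fin (n + 1)) → smoothFn U}
    (hanti : ∀ σ i j, b σ i j = -b σ j i) (hb0 : ∀ σ i j J, K < J.card → b σ i j J = 0)
    (hcb : ∀ σ i, c σ i = ∑ j, shiftDeriv (dTot hU) j (b σ i j)) :
    ∃ (s : ℕ) (hs : T ≤ s + 1) (ν : JetForm (n + 1) m s n),
      ContDiffOn ℝ ∞ ν (jetDomain U s) ∧ IsOneContact U ν ∧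
      ∀ z ∈ jetDomain U (s + 1), lift hs D z = contactOne (extDeriv ν) z := by
  cases n with
  | zero =>
    -- Over a one-dimensional base there is no `ω_{ij}`, but an antisymmetric array with a single
    -- index value is zero; so `D` vanishes on the domain and `ν = 0` will do.
    have hb : ∀ σ i j, b σ i j = 0 := fun σ i j => by
      obtain rfl : j = i := Fin.ext (by omega)
      have h : (2 : ℝ) • b σ j j = 0 := by
        rw [two_smul]
        nth_rewrite 1 [hanti]
        exact neg_add_cancel _
      exact (smul_eq_zero.1 h).resolve_left two_ne_zero
    refine ⟨T, Nat.le_succ T, 0, contDiffOn_const, fun z _ => ?_, fun z hz => ?_⟩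
    · change pullₗ (jetProj _) 0 = contactPart _ _ 0
      rw [map_zero, map_zero]
    · rw [lift_of_eq_sum hKT hc hD _ hz, contactOne_eq]
      have h0 : extDeriv (0 : JetForm 1 m T 0) (jetProj (Nat.le_succ T) z) = 0 := by
        simp only [extDeriv, Pi.zero_def, fderiv_fun_const, Pi.zero_apply]
        exact map_zero (ContinuousAlternatingMap.alternatizeUncurryFinCLM ℝ _ ℝ)
      rw [h0, map_zero]
      refine Finset.sum_eq_zero fun J _ => Finset.sum_eq_zero fun i _ =>
        Finset.sum_eq_zero fun σ _ => ?_
      have : c σ i J.1 = 0 := by rw [hcb]; simp [hb]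
      rw [this, smoothFn.zero_apply, zero_smul]
  | succ n =>
    -- The orders of the primitives `b` are not tracked by the Koszul lemma; since only finitely
    -- many occur, they have a common bound.
    choose ord hord using fun x : Fin m × Fin (n + 2) × Fin (n + 2) × JetIndex (n + 2) K =>
      (b x.1 x.2.1 x.2.2.1 x.2.2.2.1).2.2
    set S := max T (Finset.univ.sup ord)
    have hTS : T ≤ S := le_max_left _ _
    have hbS : ∀ σ i j (J : JetIndex (n + 2) K), HasOrder U (b σ i j J.1) S := fun σ i j J =>
      (hord (σ, i, j, J)).mono ((Finset.le_sup (Finset.mem_univ _)).trans (le_max_right _ _))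
    refine ⟨S, hTS.trans (Nat.le_succ S), contactPrimitive K S b,
      contDiffOn_contactPrimitive hbS, isOneContact_contactPrimitive (hKT.trans_le hTS),
      fun z hz => ?_⟩
    rw [contactOne_extDeriv_contactPrimitive hU (hKT.trans_le hTS) hanti hbS hz,
      lift_of_eq_sum hKT hc hD _ hz]
    have h1 : ∀ σ, ∑ J : JetIndex (n + 2) K, ∑ i, c σ i J.1 (extend z) •
        wedgeₗ (contactForm (S + 1) J.1 σ z) (omegaOne m (S + 1) i) =
        ∑ J : JetIndex (n + 2) K, ∑ i, ∑ j,
        wedgeₗ (dTot hU j (b σ i j J.1) (extend z) • contactForm (S + 1) J.1 σ z +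
          b σ i j J.1 (extend z) • contactForm (S + 1) (j ::ₘ J.1) σ z)
          (omegaOne m (S + 1) i) := fun σ => by
      rw [Finset.sum_comm, Finset.sum_comm (s := (Finset.univ : Finset (JetIndex (n + 2) K)))]
      refine Finset.sum_congr rfl fun i _ => ?_
      rw [sum_shiftDeriv_smul_contactForm_wedge hU (hcb σ i) (hc0 σ i) (hb0 σ i) (extend z)
        fun J => wedgeₗ (contactForm (S + 1) J σ z) (omegaOne m (S + 1) i)]
      simp only [map_add, map_smul, LinearMap.add_apply, LinearMap.smul_apply]
    exact (sum_comm_three _).trans ((sum_comm_three _).trans (Finset.sum_congr rfl fun σ _ => h1 σ))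

end defect

end

section


set_option maxSynthPendingDepth 3

variable {m : ℕ}

/-! ### The canonical Lepage equivalent -/

section canonical

variable {n s : ℕ} {U : Set ((Fin (n + 1) → ℝ) × (Fin m → ℝ))}

theorem HasOrder.principalLepage_eq (hU : IsOpen U) (hs : 1 ≤ s)
    {lam : JetForm (n + 1) m s (n + 1)} {g : smoothFn U} (hg : HasOrder U g s)
    (hlam : ∀ z ∈ jetDomain U s, lam z = g (extend z) • omegaZero (n + 1) m s) {R K : ℕ}
    (hR : s ≤ R) (hK : s ≤ K + 1) {z : Jet (n + 1) m (2 * s - 1)}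
    (hz : z ∈ jetDomain U (2 * s - 1)) :
    principalLepage lam z = g (extend z) • omegaZero (n + 1) m (2 * s - 1) +
      ∑ J : JetIndex (n + 1) K, ∑ i : Fin (n + 1), ∑ σ : Fin m,
        lepageCoeff hU R J.1 i σ g (extend z) •
          wedgeₗ (contactForm (2 * s - 1) J.1 σ z) (omegaOne m (2 * s - 1) i) := by
  have hL : ∀ w ∈ jetDomain U s, lagrangeFunction lam w = g (extend w) := fun w hw => by
    rw [lagrangeFunction, hlam w hw, ContinuousAlternatingMap.smul_apply, omegaZero_basePartial,
      smul_eq_mul, mul_one]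
  have hsm : ContDiffOn ℝ ∞ (lagrangeFunction lam) (jetDomain U s) := hg.1.congr hL
  have heq : ofJet (lagrangeFunction lam) hsm = g := by
    ext w hw
    rw [ofJet_apply _ hw, hL _ (trunc_mem_jetDomain.2 hw), ← hg.2 w hw]
  have h := LepageForms.principalLepage_eq hU hs hsm hR hK hz
  rwa [heq] at h

theorem lift_principalLepage (hU : IsOpen U) (hs : 1 ≤ s) {lam : JetForm (n + 1) m s (n + 1)}
    (hL : ContDiffOn ℝ ∞ (lagrangeFunction lam) (jetDomain U s)) {R K S : ℕ} (hR : s ≤ R)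
    (hK : s ≤ K + 1) (hS : 2 * s - 1 < S) {z : Jet (n + 1) m S} (hz : z ∈ jetDomain U S) :
    lift hS.le (principalLepage lam) z =
      ofJet (lagrangeFunction lam) hL (extend z) • omegaZero (n + 1) m S +
      ∑ J : JetIndex (n + 1) K, ∑ i : Fin (n + 1), ∑ σ : Fin m,
        lepageCoeff hU R J.1 i σ (ofJet (lagrangeFunction lam) hL) (extend z) •
          wedgeₗ (contactForm S J.1 σ z) (omegaOne m S i) := by
  have hord : HasOrder U (ofJet (lagrangeFunction lam) hL) s := hasOrder_ofJet hL
  rw [sum_jetIndex_of_le (K := s - 1) (by omega) (Φ := fun J => ∑ i : Fin (n + 1), ∑ σ : Fin m,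
      lepageCoeff hU R J i σ (ofJet (lagrangeFunction lam) hL) (extend z) •
        wedgeₗ (contactForm S J σ z) (omegaOne m S i))
    (fun J hJ => Finset.sum_eq_zero fun i _ => Finset.sum_eq_zero fun σ _ => by
      rw [hord.lepageCoeff_eq_zero hU R (by omega), smoothFn.zero_apply, zero_smul])]
  change pullₗ (jetProj _) (principalLepage lam (jetProj _ z)) = _
  rw [LepageForms.principalLepage_eq hU hs hL hR (K := s - 1) (by omega) (z := jetProj hS.le z) hz]
  simp only [map_add, map_sum, map_smul, pullₗ_apply, omegaOne_eq]
  have h0 : (omegaZero (n + 1) m (2 * s - 1)).compContinuousLinearMap (jetProj hS.le) =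
    omegaZero (n + 1) m S := rfl
  rw [h0, (hord.mono (by omega : s ≤ 2 * s - 1)).extend_jetProj hS.le hz]
  congr 1
  refine Finset.sum_congr rfl fun J _ => Finset.sum_congr rfl fun i _ =>
    Finset.sum_congr rfl fun σ _ => ?_
  have hJ : J.1.card < 2 * s - 1 := by have := J.2; omega
  rw [contactForm_wedge_comp_jetProj _ _ hJ,
    (hord.lepageCoeff hU hs hR J.1 i σ).extend_jetProj hS.le hz]

variable (hU : IsOpen U) (hstar : VerticallyStarShaped U) (hs : 1 ≤ s)

variable {lam : JetForm (n + 1) m s (n + 1)}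
  (hL : ContDiffOn ℝ ∞ (lagrangeFunction lam) (jetDomain U s))

theorem vainbergTonti_eq_sub {z : Jet (n + 1) m (2 * s)} (hz : z ∈ jetDomain U (2 * s)) :
    vainbergTonti lam z =
      (ofJet (lagrangeFunction lam) hL - trivialFn hU hstar hs (hasOrder_ofJet hL) : smoothFn U)
        (extend z) • omegaZero (n + 1) m (2 * s) := by
  have hz' := extend_mem_infDomain.2 hz
  have h := (hasOrder_ofJet hL).integral_momentum_add_sum_dTot hU hstar hs hz'
  rw [vainbergTonti_eq hU hstar hL hz, smoothFn.sub_apply, trivialFn, smoothFn.add_apply,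
    smoothFn.sum_apply, zeroSectionFn_apply hstar _ hz', ← infScaling_zero]
  congr 1
  rw [← sub_sub, sub_right_comm]
  exact eq_sub_of_add_eq h

variable {lamTriv : JetForm (n + 1) m (2 * s) (n + 1)}
  (htriv : ∀ z ∈ jetDomain U (2 * s), lamTriv z =
    trivialFn hU hstar hs (hasOrder_ofJet hL) (extend z) • omegaZero (n + 1) m (2 * s))

include htriv

theorem principalLepage_vainbergTonti_add (h : 2 * s - 1 ≤ 2 * (2 * s) - 1)
    {z : Jet (n + 1) m (2 * (2 * s) - 1)}
    (hz : z ∈ jetDomain U (2 * (2 * s) - 1)) :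
    principalLepage (vainbergTonti lam) z + principalLepage lamTriv z =
      lift h (principalLepage lam) z := by
  have hord : HasOrder U (ofJet (lagrangeFunction lam) hL) s := hasOrder_ofJet hL
  have ht := hasOrder_trivialFn hU hstar hs hord
  -- The cut-offs suit the order `2s` of the two summands and are used for `λ` as well, so that
  -- linearity can be applied coefficient by coefficient.
  rw [((hord.mono (by omega : s ≤ 2 * s)).sub ht).principalLepage_eq hU (by omega)
      (fun z hz => vainbergTonti_eq_sub hU hstar hs hL hz) (R := 2 * s + 1) (K := 2 * s - 1)
      (by omega) (by omega) hz,
    ht.principalLepage_eq hU (by omega) htriv (R := 2 * s + 1) (K := 2 * s - 1) (by omega)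
      (by omega) hz,
    lift_principalLepage hU hs hL (R := 2 * s + 1) (K := 2 * s - 1) (by omega) (by omega)
      (by omega) hz, add_add_add_comm]
  simp only [← Finset.sum_add_distrib, ← add_smul, map_sub, smoothFn.sub_apply, sub_add_cancel]

/-- Both forms have horizontal part `T ω₀`; only contact terms survive the subtraction. -/
theorem lift_extDeriv_alphaForm_sub_principalLepage {mu0 : BaseForm (n + 1) n}
    (hmu0 : ContDiffOn ℝ ∞ mu0 (Prod.fst '' U))
    (hdmu0 : ∀ x ∈ Prod.fst '' U,
      extDeriv mu0 x = pullback (zeroSection (n + 1) m (2 * s - 1)) (principalLepage lam) x)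
    (h : 2 * s - 1 ≤ 2 * (2 * s) - 1) {z : Jet (n + 1) m (2 * (2 * s) - 1)}
    (hz : z ∈ jetDomain U (2 * (2 * s) - 1)) :
    lift h (extDeriv (alphaForm lam mu0)) z - principalLepage lamTriv z =
      ∑ J : JetIndex (n + 1) (2 * s - 1), ∑ i, ∑ σ,
        defectCoeff hU hstar hs (hasOrder_ofJet hL) σ i J.1 (extend z) •
          wedgeₗ (contactForm (2 * (2 * s) - 1) J.1 σ z) (omegaOne m (2 * (2 * s) - 1) i) := by
  rw [lift_extDeriv_alphaForm hU hstar hs hL hmu0 hdmu0 (by omega) hz,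
    (hasOrder_trivialFn hU hstar hs _).principalLepage_eq hU (by omega) htriv (R := 2 * s + 1)
      (K := 2 * s - 1) (by omega) (by omega) hz, add_sub_add_left_eq_sub]
  simp only [← Finset.sum_sub_distrib, ← sub_smul]
  rfl

end canonical

end

end LepageForms

end

open LepageForms in
theorem mainTheorem6 (n m r : ℕ) (hr : 1 ≤ r)
    (U : Set ((Fin (n + 1) → ℝ) × (Fin m → ℝ))) (hU : IsOpen U) (hstar : VerticallyStarShaped U)
    (lam : JetForm (n + 1) m r (n + 1)) (hlam : IsLagrangian U lam)
    (mu0 : BaseForm (n + 1) n) (hmu0 : ContDiffOn ℝ ∞ mu0 (Prod.fst '' U))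
    (hdmu0 : ∀ x ∈ Prod.fst '' U,
      extDeriv mu0 x = pullback (zeroSection (n + 1) m (2 * r - 1)) (principalLepage lam) x)
    (α : JetForm (n + 1) m (2 * r - 1) n) (hα : α = alphaForm lam mu0)
    (lamTriv : JetForm (n + 1) m (2 * r) (n + 1))
    (h_triv : lamTriv = horizontalize (by omega) (extDeriv α))
    (D : JetForm (n + 1) m (2 * (2 * r) - 1) (n + 1))
    (hD : D = lift (by omega) (extDeriv α) - principalLepage lamTriv) :
    (∀ z ∈ jetDomain U (2 * r), lift (by omega) lam z = vainbergTonti lam z + lamTriv z) ∧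
    (∀ z ∈ jetDomain U (2 * (2 * r) - 1),
      canonicalLepage lam mu0 z = lift (by omega) (principalLepage lam) z + D z) ∧
    IsOneContact U D ∧
    ∃ (s : ℕ) (hs : 2 * (2 * r) - 1 ≤ s + 1) (ν : JetForm (n + 1) m s n),
      ContDiffOn ℝ ∞ ν (jetDomain U s) ∧ IsOneContact U ν ∧
      ∀ z ∈ jetDomain U (s + 1), lift hs D z = contactOne (extDeriv ν) z := by
  subst hα h_triv hD
  have hL := hlam.contDiffOn
  have hhor : ∀ z ∈ jetDomain U (2 * r),
      horizontalize (by omega) (extDeriv (alphaForm lam mu0)) z =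
        trivialFn hU hstar hr (hasOrder_ofJet hL) (extend z) • omegaZero (n + 1) m (2 * r) :=
    fun z hz => horizontalize_extDeriv_alphaForm hU hstar hr hL hmu0 hdmu0 (by omega) hz
  have hD := fun z hz =>
    lift_extDeriv_alphaForm_sub_principalLepage hU hstar hr hL hhor hmu0 hdmu0 (by omega)
      (z := z) hz
  refine ⟨fun z hz => ?_, fun z hz => ?_, isOneContact_of_eq_sum (by omega) hD, ?_⟩
  · rw [vainbergTonti_eq_sub hU hstar hr hL hz, hhor z hz, ← add_smul, smoothFn.sub_apply,
      sub_add_cancel, ofJet_extend hL (by omega) hz]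
    change pullₗ (jetProj _) (lam (jetProj _ z)) = _
    rw [hlam.eq_smul_omegaZero hz, map_smul]
    rfl
  · rw [canonicalLepage, Pi.add_apply, Pi.sub_apply,
      ← principalLepage_vainbergTonti_add hU hstar hr hL hhor (by omega) hz]
    abel
  -- The Koszul primitive is found for each fibre index `σ` separately, since the total derivatives
  -- do not mix them.
  · choose b hanti hb0 hcb using exists_defect_primitive hU hstar hr (hasOrder_ofJet hL)
    exact exists_contact_primitive hU (by omega)
      (hasOrder_defectCoeff hU hstar hr (hasOrder_ofJet hL))
      (defectCoeff_eq_zero hU hstar hr (hasOrder_ofJet hL)) hD hanti hb0 hcb
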